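/- Work with $m\ge 1$ bosonic modes on $L^2(\mathbb R^m)$, with position and momentum quadratures $\hat q_j$ (multiplication by $x_j$) and $\hat p_j=-2i\,\partial_j$, so $[\hat q_j,\hat p_j]=2i$. A displaced orthogonal gate is $\hat D\,\hat U_O$, where $(\hat U_O\psi)(x)=\psi(O^{-1}x)$ for an orthogonal matrix $O$ and $\hat D$ is a multimode displacement operator. For $\boldsymbol\gamma=(\gamma_1,\dots,\gamma_t)\in\mathbb R^t$ let a block be $$\hat O_{\boldsymbol\gamma}=\hat O_t\,e^{i\gamma_t\hat q_1^3}\,\hat O_{t-1}\cdots\hat O_1\,e^{i\gamma_1\hat q_1^3}\,\hat O_0$$ with displaced orthogonal gates $\hat O_0,\dots,\hat O_t$, and consider circuits $$\hat U=\hat O_{\boldsymbol\gamma_c}\,\hat R_1(\theta_c)\,\hat O_{\boldsymbol\gamma_{c-1}}\cdots\hat R_1(\theta_1)\,\hat O_{\boldsymbol\gamma_0}$$ of $c+1$ such blocks (each with $t\ge 0$ cubic phase gates and its own displaced orthogonal gates), separated by $c$ rotation gates $\hat R_1(\theta)=e^{-i\theta\hat n_1}$ on the first mode, $\hat n_1=(\hat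 q_1^2+\hat p_1^2)/4-1/2$. Let $\rho$ be an input state with finite moments of all orders, and let $H=H(\hat{\boldsymbol q},\hat{\boldsymbol p})$ be a polynomial of degree at most $d$ in the quadratures, given by the coefficients of the ordered products of at most $d$ quadratures. The state is described by its moments $\mathrm{Tr}[\rho\,\hat r_1\cdots\hat r_k]$, $k\le d2^{c+1}$ (with $\hat r_1,\dots,\hat r_k$ quadratures); the circuit is described by the orthogonal matrices and displacement vectors, the numbers $\gamma$ in each block, and $\cos\theta_i,\sin\theta_i$. Entries of these descriptions are read in unit time. There is a single classical algorithm (a program of a random access machine with exact complex arithmetic, where every elementary instruction takes one step) that, given $m,t,c,d$ and these descriptions, computes the expectation value $$\mathrm{Tr}\big[\hat U\rho\,\hat U^\dagger H\big]=\mathrm{Tr}\big[\rho\,\hat U^\dagger H\,\hat U\big],$$ and such that, for all $c\ge 1$ and $d\ge 0$, its running time is $$O\big(m^{d\,2^{c+1}}+(c+1)\,t^2m^7\big),$$ where the implied constant depends only on $c$ and $d$, and is uniform in $m\ge1$, $t\ge0$ and in the circuit, the state and the polynomial. In particular (and also for $c=0$), when $c$ and $d$ are constant and $t$ is bounded by a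 polynomial in $m$, the running time is bounded by a polynomial in $m$. -/

import Mathlib

open scoped SchwartzMap FourierTransform LineDeriv

noncomputable section

namespace CVSim

/-! ## Modes, quadratures, observables -/

/-- Configuration space `ℝ^m` of `m` modes. -/
abbrev Conf (m : ℕ) : Type := EuclideanSpace ℝ (Fin m)

/-- Schwartz wave functions: the common invariant domain, dense in `L²(ℝ^m)`, of all
quadratures and of all gates below. -/
abbrev Wave (m : ℕ) : Type := 𝓢(Conf m, ℂ)

/-- The `L²(ℝ^m)` class of a Schwartz wave function. -/
def toL2 {m : ℕ} (ψ : Wave m) : MeasureTheory.Lp ℂ 2 (MeasureTheory.volume : MeasureTheory.Measure (Conf m)) :=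
  ψ.toLp 2 MeasureTheory.volume

theorem coord_temperate {m : ℕ} (i : Fin m) :
    Function.HasTemperateGrowth (fun x : Conf m => x i) :=
  (EuclideanSpace.proj (𝕜 := ℝ) i).hasTemperateGrowth

/-- Labels of the `2m` quadratures: `Sum.inl i` is `q_i`, `Sum.inr i` is `p_i`. -/
abbrev Quad (m : ℕ) : Type := Fin m ⊕ Fin m

/-- Position quadrature `(q_i ψ)(x) = x_i ψ(x)`. -/
def position {m : ℕ} (i : Fin m) : Module.End ℂ (Wave m) :=
  (SchwartzMap.smulLeftCLM ℂ (fun x : Conf m => ((x i : ℝ) : ℂ))).toLinearMap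

/-- Momentum quadrature `p_i = -2i ∂_i`, so that `[q_i, p_i] = 2i` (the convention `ħ = 2`). -/
def momentum {m : ℕ} (i : Fin m) : Module.End ℂ (Wave m) :=
  (-2 * Complex.I) •
    (LineDeriv.lineDerivOpCLM ℂ (Wave m) (EuclideanSpace.single i (1 : ℝ) : Conf m)).toLinearMap

/-- The quadrature with a given label. -/
def quadrature {m : ℕ} : Quad m → Module.End ℂ (Wave m)
  | Sum.inl i => position i
  | Sum.inr i => momentum i

/-- The ordered product `r_1 r_2 ⋯ r_k` of the quadratures in a word. -/
def wordOp {m : ℕ} (w : List (Quad m)) : Module.End ℂ (Wave m) :=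
  (w.map quadrature).prod

/-- The polynomial of degree at most `d` in the (noncommuting) quadratures with coefficient `h w`
in front of the ordered product `w`, for every word `w` of length at most `d`. Polynomials in
normal order are the ones whose `h` vanishes on all other words. -/
def polyOp {m : ℕ} (d : ℕ) (h : List (Quad m) → ℂ) : Module.End ℂ (Wave m) :=
  ∑ k ∈ Finset.range (d + 1), ∑ v : Fin k → Quad m, h (List.ofFn v) • wordOp (List.ofFn v)

/-! ## Gates -/

theorem expI_temperate : Function.HasTemperateGrowth (fun s : ℝ => Complex.exp (Complex.I * s)) := by
  have hs : ContDiff ℝ (⊤ : ℕ∞) (fun s : ℝ => Complex.exp (Complex.I * s)) :=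
    (contDiff_const.mul Complex.ofRealCLM.contDiff).cexp
  refine ⟨hs, fun n => ⟨0, 1, fun x => ?_⟩⟩
  rw [norm_iteratedFDeriv_eq_norm_iteratedDeriv]
  have key : ∀ n : ℕ, iteratedDeriv n (fun s : ℝ => Complex.exp (Complex.I * s))
      = fun s : ℝ => Complex.I ^ n * Complex.exp (Complex.I * s) := by
    intro n
    induction n with
    | zero => simp
    | succ n ih =>
      rw [iteratedDeriv_succ, ih]
      funext s
      have h1 : HasDerivAt (fun s : ℝ => Complex.I * (s : ℂ)) Complex.I s := by
        simpa using (Complex.ofRealCLM.hasDerivAt (x := s)).const_mul Complex.I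
      have h2 := (h1.cexp).const_mul (Complex.I ^ n)
      rw [h2.deriv]
      ring
  rw [key]
  simp [Complex.norm_exp]

theorem phase_temperate {m : ℕ} {f : Conf m → ℝ} (hf : f.HasTemperateGrowth) :
    Function.HasTemperateGrowth (fun x => Complex.exp (Complex.I * f x)) :=
  expI_temperate.comp hf

/-- Multiplication by `e^{i f(x)}`, that is, the unitary `e^{i f(q)}`. -/
def phaseGate {m : ℕ} (f : Conf m → ℝ) (hf : f.HasTemperateGrowth) : Wave m ≃ₗ[ℂ] Wave m :=
  LinearEquiv.ofLinearMap
    (SchwartzMap.smulLeftCLM ℂ (fun x => Complex.exp (Complex.I * f x))).toLinearMap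
    (SchwartzMap.smulLeftCLM ℂ (fun x => Complex.exp (Complex.I * (-f x : ℝ)))).toLinearMap
    (by
      ext ψ x
      have h1 := phase_temperate hf
      have h2 : Function.HasTemperateGrowth (fun x => Complex.exp (Complex.I * (-f x : ℝ))) :=
        phase_temperate (f := fun x => -f x) hf.neg
      simp only [LinearMap.comp_apply, ContinuousLinearMap.coe_coe, LinearMap.id_apply]
      rw [SchwartzMap.smulLeftCLM_apply_apply h1, SchwartzMap.smulLeftCLM_apply_apply h2,
        smul_smul, ← Complex.exp_add]
      simp)
    (by
      ext ψ x
      have h1 := phase_temperate hf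
      have h2 : Function.HasTemperateGrowth (fun x => Complex.exp (Complex.I * (-f x : ℝ))) :=
        phase_temperate (f := fun x => -f x) hf.neg
      simp only [LinearMap.comp_apply, ContinuousLinearMap.coe_coe, LinearMap.id_apply]
      rw [SchwartzMap.smulLeftCLM_apply_apply h2, SchwartzMap.smulLeftCLM_apply_apply h1,
        smul_smul, ← Complex.exp_add]
      simp)

/-- The cubic phase gate `e^{iγ q_1³}` on the first mode. -/
def cubicGate {m : ℕ} [NeZero m] (γ : ℝ) : Wave m ≃ₗ[ℂ] Wave m :=
  phaseGate (fun x => γ * x 0 ^ 3)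
    (by have := coord_temperate (m := m) 0; fun_prop)

/-- `(U_L ψ)(x) = ψ(L⁻¹ x)` for an invertible linear map `L` of the configuration space. -/
def linearGate {m : ℕ} (L : Conf m ≃L[ℝ] Conf m) : Wave m ≃ₗ[ℂ] Wave m :=
  LinearEquiv.ofLinearMap
    (SchwartzMap.compCLMOfContinuousLinearEquiv ℂ L.symm).toLinearMap
    (SchwartzMap.compCLMOfContinuousLinearEquiv ℂ L).toLinearMap
    (by ext ψ x; simp) (by ext ψ x; simp)

/-- Translation `ψ ↦ ψ(x - a)`. -/
def translationGate {m : ℕ} (a : Conf m) : Wave m ≃ₗ[ℂ] Wave m :=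
  LinearEquiv.ofLinearMap
    (SchwartzMap.compSubConstCLM ℂ a).toLinearMap
    (SchwartzMap.compSubConstCLM ℂ (-a)).toLinearMap
    (by ext ψ x; simp) (by ext ψ x; simp)

/-- The multimode displacement `∏_j D(α_j)`, `D(α) = e^{α a† - α* a} = e^{i(Im α q - Re α p)}`, with
`α_j = (a_j + i b_j)/2`: it shifts `q_j` by `a_j` and `p_j` by `b_j`. Explicitly,
`(D ψ)(x) = e^{i ∑_j (b_j x_j / 2 - a_j b_j / 4)} ψ(x - a)`. -/
def displacementGate {m : ℕ} (a b : Conf m) : Wave m ≃ₗ[ℂ] Wave m :=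
  (translationGate a).trans
    (phaseGate (fun x => ∑ j, (b j / 2 * x j - a j * b j / 4))
      (by
        have := coord_temperate (m := m)
        apply Function.HasTemperateGrowth.sum
        intro j _
        have := this j
        fun_prop))

/-- Description of a displaced orthogonal gate: an orthogonal transformation of `ℝ^m` and the
displacement vectors of the positions and of the momenta. -/
structure DispOrth (m : ℕ) where
  /-- the orthogonal transformation, acting in the same way on positions and on momenta -/
  orth : Conf m ≃ₗᵢ[ℝ] Conf m
  /-- displacement of the positions -/
  dq : Conf m
  /-- displacement of the momenta -/
  dp : Conf m

/-- The entry `(i, j)` of the orthogonal matrix. -/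
def DispOrth.entry {m : ℕ} (g : DispOrth m) (i j : Fin m) : ℝ :=
  g.orth (EuclideanSpace.single j (1 : ℝ)) i

/-- The displaced orthogonal gate: an orthogonal gate, followed by a displacement. -/
def DispOrth.gate {m : ℕ} (g : DispOrth m) : Wave m ≃ₗ[ℂ] Wave m :=
  (linearGate g.orth.toContinuousLinearEquiv).trans (displacementGate g.dq g.dp)

/-- The unitary `e^{-i s p_1² / 4}`. The Fourier transform (with kernel `e^{-2πi x·ξ}`) turns
`p_1 = -2i ∂_1` into multiplication by `4π ξ_1`. -/
def momentumChirp {m : ℕ} [NeZero m] (s : ℝ) : Wave m ≃ₗ[ℂ] Wave m :=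
  ((FourierTransform.fourierEquiv ℂ (Wave m)).trans
    (phaseGate (fun ξ => -(s / 4 * (4 * Real.pi * ξ 0) ^ 2))
      (by have := coord_temperate (m := m) 0; fun_prop))).trans
  (FourierTransform.fourierEquiv ℂ (Wave m)).symm

/-- The unitary `e^{-i s q_1² / 4}`. -/
def positionChirp {m : ℕ} [NeZero m] (s : ℝ) : Wave m ≃ₗ[ℂ] Wave m :=
  phaseGate (fun x => -(s / 4 * x 0 ^ 2))
    (by have := coord_temperate (m := m) 0; fun_prop)

/-- The reflection `x_1 ↦ -x_1`. -/
def firstReflection (m : ℕ) [NeZero m] : Conf m ≃L[ℝ] Conf m :=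
  (LinearIsometryEquiv.piLpCongrRight 2 (fun i : Fin m =>
    if i = 0 then LinearIsometryEquiv.neg ℝ else LinearIsometryEquiv.refl ℝ ℝ)).toContinuousLinearEquiv

open scoped Classical in
/-- The rotation gate `R_1(θ) = e^{-iθ n_1}` on the first mode, `n_1 = (q_1² + p_1²)/4 - 1/2`: it maps
`q_1` to `cos θ q_1 + sin θ p_1` and `p_1` to `-sin θ q_1 + cos θ p_1`. With `θ` reduced modulo `2π`
to `(-π, π]` (the spectrum of `n_1` is `ℕ`), it is the parity of the first mode for `θ = π`, and
otherwise the fractional Fourier transform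
`e^{iθ/2} e^{-i tan(θ/2) q_1²/4} e^{-i sin θ p_1²/4} e^{-i tan(θ/2) q_1²/4}`. -/
def rotationGate {m : ℕ} [NeZero m] (θ : ℝ) : Wave m ≃ₗ[ℂ] Wave m :=
  let τ : ℝ := (θ : Real.Angle).toReal
  if τ = Real.pi then linearGate (firstReflection m)
  else
    (((positionChirp (Real.tan (τ / 2))).trans (momentumChirp (Real.sin τ))).trans
      (positionChirp (Real.tan (τ / 2)))).trans
    (phaseGate (fun _ => τ / 2) (Function.HasTemperateGrowth.const _))

/-- Description of a circuit. Only `gate i s` for `i ≤ c`, `s ≤ t`, `cubicity i s` for `i ≤ c`,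
`1 ≤ s ≤ t`, and `angle i` for `1 ≤ i ≤ c` are used. -/
structure Circuit (m : ℕ) where
  /-- the displaced orthogonal gates of the block `i` -/
  gate : ℕ → ℕ → DispOrth m
  /-- the cubicities of the cubic phase gates of the block `i` -/
  cubicity : ℕ → ℕ → ℝ
  /-- the angles of the rotation gates -/
  angle : ℕ → ℝ

/-- The block `O_t e^{iγ_t q_1³} O_{t-1} ⋯ O_1 e^{iγ_1 q_1³} O_0` (rightmost factor applied first;
`e.trans f` applies `e` first). -/
def blockOp {m : ℕ} [NeZero m] (g : ℕ → DispOrth m) (γ : ℕ → ℝ) : ℕ → (Wave m ≃ₗ[ℂ] Wave m)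
  | 0 => (g 0).gate
  | s + 1 => ((blockOp g γ s).trans (cubicGate (γ (s + 1)))).trans (g (s + 1)).gate

/-- The circuit `O_{γ_c} R_1(θ_c) O_{γ_{c-1}} ⋯ R_1(θ_1) O_{γ_0}`, with `t` cubic phase gates in each
of the `c + 1` blocks. -/
def circuitOp {m : ℕ} [NeZero m] (D : Circuit m) (t : ℕ) : ℕ → (Wave m ≃ₗ[ℂ] Wave m)
  | 0 => blockOp (D.gate 0) (D.cubicity 0) t
  | i + 1 => ((circuitOp D t i).trans (rotationGate (D.angle (i + 1)))).trans
      (blockOp (D.gate (i + 1)) (D.cubicity (i + 1)) t)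

/-! ## States and expectation values -/

/-- `ρ` is (the restriction to Schwartz functions of) a density operator all of whose moments are
finite: `ρ = ∑_k w_k |ψ_k⟩⟨ψ_k|` with weights `w_k ≥ 0` of sum one, unit vectors `ψ_k`, and
`∑_k w_k ‖r_1 ⋯ r_l ψ_k‖² < ∞` for all quadratures `r_1, …, r_l`. -/
def IsDensity {m : ℕ} (ρ : Module.End ℂ (Wave m)) : Prop :=
  ∃ (w : ℕ → ℝ) (ψ : ℕ → Wave m),
    (∀ k, 0 ≤ w k) ∧ HasSum w 1 ∧ (∀ k, ‖toL2 (ψ k)‖ = 1) ∧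
    (∀ v : List (Quad m), Summable fun k => w k * ‖toL2 (wordOp v (ψ k))‖ ^ 2) ∧
    ∀ φ : Wave m,
      HasSum (fun k => ((w k : ℂ) * inner ℂ (toL2 (ψ k)) (toL2 φ)) • toL2 (ψ k)) (toL2 (ρ φ))

/-- `Tr A = v`: the series `∑_n ⟨e_n, A e_n⟩` converges unconditionally to `v` for every orthonormal
basis `(e_n)` of `L²(ℝ^m)` that consists of Schwartz functions. -/
def HasTrace {m : ℕ} (A : Module.End ℂ (Wave m)) (v : ℂ) : Prop :=
  ∀ (b : HilbertBasis ℕ ℂ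
      (MeasureTheory.Lp ℂ 2 (MeasureTheory.volume : MeasureTheory.Measure (Conf m))))
    (e : ℕ → Wave m), (∀ n, b n = toL2 (e n)) →
    HasSum (fun n => inner ℂ (toL2 (e n)) (toL2 (A (e n)))) v

/-! ## The computational model

A random access machine with exact scalar arithmetic: an unbounded memory of natural numbers (used
for addresses and control), an unbounded memory of complex numbers, and a read-only input. Every
elementary instruction and every test takes one step. There is no test on scalars and no access to
their digits. -/

/-- Programs. In the comments, `N` is the memory of natural numbers, `S` the memory of scalars. -/
inductive Prog : Type
  /-- `N[x] := n` -/
  | iconst (x n : ℕ)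
  /-- `N[x] := N[y] + N[z]` -/
  | iadd (x y z : ℕ)
  /-- `N[x] := N[y] - N[z]` (zero if negative) -/
  | isub (x y z : ℕ)
  /-- `N[x] := N[y] * N[z]` -/
  | imul (x y z : ℕ)
  /-- `N[x] := N[N[y]]` -/
  | iload (x y : ℕ)
  /-- `N[N[x]] := N[y]` -/
  | istore (x y : ℕ)
  /-- `S[N[x]] := z` -/
  | sconst (x : ℕ) (z : ℤ)
  /-- `S[N[x]] := S[N[y]] + S[N[z]]` -/
  | sadd (x y z : ℕ)
  /-- `S[N[x]] := S[N[y]] - S[N[z]]` -/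
  | ssub (x y z : ℕ)
  /-- `S[N[x]] := S[N[y]] * S[N[z]]` -/
  | smul (x y z : ℕ)
  /-- `S[N[x]] := ` the entry `(N[y], N[z])` of the input table number `a` -/
  | read (x a y z : ℕ)
  /-- do nothing -/
  | skip
  /-- sequential composition -/
  | seq (P Q : Prog)
  /-- if `N[x] < N[y]` then `P` else `Q` -/
  | ite (x y : ℕ) (P Q : Prog)
  /-- while `N[x] < N[y]` do `P` -/
  | loop (x y : ℕ) (P : Prog)

/-- The memory of the machine. -/
structure Mem where
  /-- natural numbers -/
  N : ℕ → ℕ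
  /-- scalars -/
  S : ℕ → ℂ

/-- The input: finitely many tables are used; `inp a i j` is the entry `(i, j)` of table `a`. -/
abbrev Input : Type := ℕ → ℕ → ℕ → ℂ

/-- Write a natural number. -/
def Mem.setN (σ : Mem) (x v : ℕ) : Mem := ⟨Function.update σ.N x v, σ.S⟩

/-- Write a scalar at the address `N[x]`. -/
def Mem.setS (σ : Mem) (x : ℕ) (v : ℂ) : Mem := ⟨σ.N, Function.update σ.S (σ.N x) v⟩

/-- Read the scalar at the address `N[x]`. -/
def Mem.getS (σ : Mem) (x : ℕ) : ℂ := σ.S (σ.N x)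

/-- `Exec inp P σ k σ'`: started in `σ`, the program `P` halts after exactly `k` steps in `σ'`. -/
inductive Exec (inp : Input) : Prog → Mem → ℕ → Mem → Prop
  | iconst (x n σ) : Exec inp (.iconst x n) σ 1 (σ.setN x n)
  | iadd (x y z σ) : Exec inp (.iadd x y z) σ 1 (σ.setN x (σ.N y + σ.N z))
  | isub (x y z σ) : Exec inp (.isub x y z) σ 1 (σ.setN x (σ.N y - σ.N z))
  | imul (x y z σ) : Exec inp (.imul x y z) σ 1 (σ.setN x (σ.N y * σ.N z))
  | iload (x y σ) : Exec inp (.iload x y) σ 1 (σ.setN x (σ.N (σ.N y)))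
  | istore (x y σ) : Exec inp (.istore x y) σ 1 (σ.setN (σ.N x) (σ.N y))
  | sconst (x z σ) : Exec inp (.sconst x z) σ 1 (σ.setS x (z : ℂ))
  | sadd (x y z σ) : Exec inp (.sadd x y z) σ 1 (σ.setS x (σ.getS y + σ.getS z))
  | ssub (x y z σ) : Exec inp (.ssub x y z) σ 1 (σ.setS x (σ.getS y - σ.getS z))
  | smul (x y z σ) : Exec inp (.smul x y z) σ 1 (σ.setS x (σ.getS y * σ.getS z))
  | read (x a y z σ) : Exec inp (.read x a y z) σ 1 (σ.setS x (inp a (σ.N y) (σ.N z)))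
  | skip (σ) : Exec inp .skip σ 1 σ
  | seq (P Q σ₁ σ₂ σ₃ k l) : Exec inp P σ₁ k σ₂ → Exec inp Q σ₂ l σ₃ →
      Exec inp (.seq P Q) σ₁ (k + l) σ₃
  | ite_true (x y P Q σ σ' k) : σ.N x < σ.N y → Exec inp P σ k σ' →
      Exec inp (.ite x y P Q) σ (k + 1) σ'
  | ite_false (x y P Q σ σ' k) : ¬ σ.N x < σ.N y → Exec inp Q σ k σ' →
      Exec inp (.ite x y P Q) σ (k + 1) σ'
  | loop_done (x y P σ) : ¬ σ.N x < σ.N y → Exec inp (.loop x y P) σ 1 σ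
  | loop_step (x y P σ₁ σ₂ σ₃ k l) : σ₁.N x < σ₁.N y → Exec inp P σ₁ k σ₂ →
      Exec inp (.loop x y P) σ₂ l σ₃ → Exec inp (.loop x y P) σ₁ (k + l + 1) σ₃

/-- The initial memory: `m, t, c, d` in the first four cells, everything else zero. -/
def initMem (m t c d : ℕ) : Mem :=
  ⟨fun x => if x = 0 then m else if x = 1 then t else if x = 2 then c else if x = 3 then d else 0,
    fun _ => 0⟩

/-- On the given sizes and input, `P` halts within `T` steps with `v` in the scalar cell `0`. -/
def Prog.OutputsWithin (P : Prog) (m t c d : ℕ) (inp : Input) (T : ℕ) (v : ℂ) : Prop :=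
  ∃ k σ, Exec inp P (initMem m t c d) k σ ∧ k ≤ T ∧ σ.S 0 = v

/-! ## The simulation problem -/

/-- The number of a quadrature: `0, …, m - 1` for the positions, `m, …, 2m - 1` for the momenta. -/
def quadCode {m : ℕ} : Quad m → ℕ
  | Sum.inl i => i
  | Sum.inr i => m + i

/-- The number of a word among the words of its length: its letters are the digits in base `2m`,
the first letter being the leading one. -/
def wordCode {m : ℕ} : List (Quad m) → ℕ
  | [] => 0
  | r :: w => quadCode r * (2 * m) ^ w.length + wordCode w

/-- The input tables describe a polynomial `∑ h w · w` of degree at most `d`, the state `ρ` and the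
circuit `D`:
table 0 holds the coefficients `h`;
table 1 holds the moments `Tr[ρ r_1 ⋯ r_k]` for `k ≤ d 2^(c+1)`;
tables 2 and 3 hold the orthogonal matrices and the displacement vectors of the displaced
orthogonal gates; table 4 holds the cubicities of the cubic phase gates; table 5 holds the matrix
entries `cos θ, sin θ` of the rotation gates. -/
structure Describes {m : ℕ} (t c d : ℕ) (inp : Input)
    (h : List (Quad m) → ℂ) (ρ : Module.End ℂ (Wave m)) (D : Circuit m) : Prop where
  coeff : ∀ w : List (Quad m), w.length ≤ d → inp 0 w.length (wordCode w) = h w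
  moment : ∀ w : List (Quad m), w.length ≤ d * 2 ^ (c + 1) →
    HasTrace (ρ * wordOp w) (inp 1 w.length (wordCode w))
  orth : ∀ i ≤ c, ∀ s ≤ t, ∀ j k : Fin m,
    inp 2 (i * (t + 1) + s) (j * m + k) = (((D.gate i s).entry j k : ℝ) : ℂ)
  dispq : ∀ i ≤ c, ∀ s ≤ t, ∀ j : Fin m,
    inp 3 (i * (t + 1) + s) j = (((D.gate i s).dq j : ℝ) : ℂ)
  dispp : ∀ i ≤ c, ∀ s ≤ t, ∀ j : Fin m,
    inp 3 (i * (t + 1) + s) (m + j) = (((D.gate i s).dp j : ℝ) : ℂ)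
  cubic : ∀ i ≤ c, ∀ s, 1 ≤ s → s ≤ t → inp 4 i s = ((D.cubicity i s : ℝ) : ℂ)
  rotCos : ∀ i, 1 ≤ i → i ≤ c → inp 5 i 0 = ((Real.cos (D.angle i) : ℝ) : ℂ)
  rotSin : ∀ i, 1 ≤ i → i ≤ c → inp 5 i 1 = ((Real.sin (D.angle i) : ℝ) : ℂ)

/-- Within `T` steps, `P` computes the expectation value `Tr[U ρ U† H] = Tr[ρ U† H U]` for every
state `ρ`, every circuit `U` with `c` rotation gates and `t` cubic phase gates per block, and every
polynomial `H` of degree at most `d`, on `m` modes. (`U` is unitary, so that `U† = U⁻¹`.) -/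
def Prog.SimulatesWithin (P : Prog) (c d m t : ℕ) [NeZero m] (T : ℕ) : Prop :=
  ∀ (D : Circuit m) (ρ : Module.End ℂ (Wave m)) (h : List (Quad m) → ℂ) (inp : Input),
    IsDensity ρ → Describes t c d inp h ρ D →
    ∃ v : ℂ, P.OutputsWithin m t c d inp T v ∧
      (let U : Module.End ℂ (Wave m) := (circuitOp D t c).toLinearMap
       let Udag : Module.End ℂ (Wave m) := (circuitOp D t c).symm.toLinearMap
       let H : Module.End ℂ (Wave m) := polyOp d h
       HasTrace (U * ρ * Udag * H) v ∧ HasTrace (ρ * Udag * H * U) v)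

end CVSim

end

noncomputable section

namespace CVSim

/-! ## Heisenberg evolution of the quadratures -/

/-! The observable is evolved instead of the state. For a gate `V` the map A ↦ V⁻¹ A V is an algebra
automorphism (`heis`), so it is determined by what it does to the quadratures. Displaced orthogonal
gates act affinely and do not mix positions with momenta; a cubic phase gate fixes the positions and
adds 6γ q₁² to p₁. Hence, however many cubic gates a block contains, positions stay affine in the
positions, and momenta become affine in the quadratures plus a quadratic polynomial in the positions
(`IsSubst.gate`, `IsSubst.cubic`). A rotation mixes q₁ and p₁ linearly (`heis_rotationGate`), so a
block together with the rotation after it sends every quadrature to a polynomial of degree at most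
2. After c + 1 blocks a polynomial of degree d has degree at most d 2^(c+1), and by linearity of the
trace its expectation value is a finite combination of the given moments (`HasTrace.sum_smul`). The
two traces agree because unitary gates permute the orthonormal bases of Schwartz functions
(`HasTrace.conj`).

The program stores a polynomial as a tensor with l indices over an alphabet of N = 2m + 1 letters,
the identity and the quadratures. A block is an array `B` that writes every letter as a combination
of pairs of letters. Replacing the last index by a pair placed in front, l times, gives a tensor
with 2l indices (`tensorVal_contract`, `block_run`). Blocks are handled from the last one of the
circuit to the first.

Dense contraction would cost N^(d 2^(c+1) + 1) for the very last letter, one factor N too many. This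
factor is saved when c ≥ 1. Quadratic terms contain a momentum only in the second place of a pair,
so after one round the leading letter of the tensor is never a momentum. Among the identity and the
positions, only q₁ can acquire quadratic terms, through the rotation. So for the pairs that are not
just one letter, the last contraction needs two values of the summation index instead of N
(`tensorVal_contract_lead`, `letter_exponent`).

The algorithm is written in a small structured language with an exact step count; `Stmt.exec` shows
that its compilation to the random access machine has the same effect in the same number of steps.
-/

theorem position_apply {m : ℕ} (i : Fin m) (ψ : Wave m) (x : Conf m) :
    position i ψ x = (x i : ℂ) * ψ x := by
  have h : Function.HasTemperateGrowth (fun x : Conf m => ((x i : ℝ) : ℂ)) :=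
    (Complex.ofRealCLM.comp (EuclideanSpace.proj (𝕜 := ℝ) i)).hasTemperateGrowth
  simp [position, SchwartzMap.smulLeftCLM_apply_apply h]

theorem momentum_apply {m : ℕ} (i : Fin m) (ψ : Wave m) (x : Conf m) :
    momentum i ψ x = -2 * Complex.I * lineDeriv ℝ ψ x (EuclideanSpace.single i 1) := by
  simp [momentum, SchwartzMap.lineDerivOp_apply]

theorem phaseGate_apply {m : ℕ} {f : Conf m → ℝ} (hf : f.HasTemperateGrowth) (ψ : Wave m)
    (x : Conf m) : phaseGate f hf ψ x = Complex.exp (Complex.I * f x) * ψ x := by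
  simp [phaseGate, SchwartzMap.smulLeftCLM_apply_apply (phase_temperate hf)]

theorem linearGate_apply {m : ℕ} (L : Conf m ≃L[ℝ] Conf m) (ψ : Wave m) (x : Conf m) :
    linearGate L ψ x = ψ (L.symm x) := by
  simp [linearGate]

theorem translationGate_apply {m : ℕ} (a : Conf m) (ψ : Wave m) (x : Conf m) :
    translationGate a ψ x = ψ (x - a) := by
  simp [translationGate]

/-- The Heisenberg evolution `A ↦ V⁻¹ A V` of an observable. -/
def heis {m : ℕ} (V : Wave m ≃ₗ[ℂ] Wave m) :
    Module.End ℂ (Wave m) ≃ₐ[ℂ] Module.End ℂ (Wave m) :=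
  V.symm.conjAlgEquiv ℂ

theorem heis_eq_mul {m : ℕ} (V : Wave m ≃ₗ[ℂ] Wave m) (A : Module.End ℂ (Wave m)) :
    heis V A = V.symm.toLinearMap * A * V.toLinearMap := rfl

theorem heis_trans {m : ℕ} (V W : Wave m ≃ₗ[ℂ] Wave m) (A : Module.End ℂ (Wave m)) :
    heis (V.trans W) A = heis V (heis W A) := rfl

/-- Multiplication by `V` removes the inverse gate and leaves the intertwining relation A V = V B,
which can be tested pointwise on wave functions. -/
theorem heis_eq_iff {m : ℕ} {V : Wave m ≃ₗ[ℂ] Wave m} {A B : Module.End ℂ (Wave m)} :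
    heis V A = B ↔ ∀ ψ x, A (V ψ) x = V (B ψ) x := by
  constructor
  · rintro rfl ψ x
    simp [heis_eq_mul, Module.End.mul_apply]
  · intro h
    apply LinearMap.ext
    intro ψ
    apply V.injective
    ext x
    simp [heis_eq_mul, Module.End.mul_apply, h]

theorem heis_phaseGate_position {m : ℕ} {f : Conf m → ℝ} (hf : f.HasTemperateGrowth) (i : Fin m) :
    heis (phaseGate f hf) (position i) = position i := by
  rw [heis_eq_iff]
  intro ψ x
  simp only [position_apply, phaseGate_apply]
  ring

/-- The product rule: -2i ∂(e^{if} ψ) = e^{if} (-2i ∂ψ + 2 (∂f) ψ). Multiplication by 2 ∂f enters as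
an operator `A`, so that cubic, quadratic, linear and constant phases are all instances. -/
theorem heis_phaseGate_momentum {m : ℕ} {f : Conf m → ℝ} (hf : f.HasTemperateGrowth) (i : Fin m)
    (A : Module.End ℂ (Wave m))
    (hA : ∀ ψ x, ∃ k : ℝ, HasLineDerivAt ℝ f k x (EuclideanSpace.single i 1) ∧
      A ψ x = 2 * k * ψ x) :
    heis (phaseGate f hf) (momentum i) = momentum i + A := by
  rw [heis_eq_iff]
  intro ψ x
  obtain ⟨k, hk, hAk⟩ := hA ψ x
  have h1 : HasLineDerivAt ℝ (phaseGate f hf ψ : Conf m → ℂ)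
      (Complex.exp (Complex.I * f x) * (Complex.I * k) * ψ x
        + Complex.exp (Complex.I * f x) * lineDeriv ℝ ψ x (EuclideanSpace.single i 1)) x
      (EuclideanSpace.single i 1) := by
    have e : (phaseGate f hf ψ : Conf m → ℂ)
        = fun y => Complex.exp (Complex.I * f y) * ψ y := by
      funext y; exact phaseGate_apply hf ψ y
    rw [e]
    have hψ : HasLineDerivAt ℝ ψ (lineDeriv ℝ ψ x (EuclideanSpace.single i 1)) x
        (EuclideanSpace.single i 1) :=
      (ψ.differentiableAt.lineDifferentiableAt).hasLineDerivAt
    unfold HasLineDerivAt at hk hψ ⊢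
    have h2 := (((Complex.ofRealCLM.hasDerivAt.scomp (0 : ℝ) hk).const_mul Complex.I).cexp).mul hψ
    refine HasDerivAt.congr_deriv h2 ?_
    simp [mul_assoc]
  rw [momentum_apply, h1.lineDeriv, phaseGate_apply, LinearMap.add_apply, add_apply,
    momentum_apply, hAk]
  linear_combination (2 * Complex.exp (Complex.I * f x) * k * ψ x) * (-1 : ℂ) * Complex.I_sq

theorem heis_linearGate_position {m : ℕ} (g : Conf m ≃ₗᵢ[ℝ] Conf m) (i : Fin m) :
    heis (linearGate g.toContinuousLinearEquiv) (position i)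
      = ∑ j, (((g (EuclideanSpace.single j (1 : ℝ)) i : ℝ)) : ℂ) • position j := by
  rw [heis_eq_iff]
  intro ψ x
  simp only [position_apply, linearGate_apply, LinearMap.sum_apply, sum_apply,
    LinearMap.smul_apply, smul_apply, smul_eq_mul, ← mul_assoc, ← Finset.sum_mul]
  congr 1
  set y := g.toContinuousLinearEquiv.symm x with hy
  have hx : x = g y := (g.apply_symm_apply x).symm
  have hs : y = ∑ j, y j • EuclideanSpace.single j (1 : ℝ) := by
    ext k; simp [Finset.sum_apply, Pi.single_apply]
  have : x i = ∑ j, g (EuclideanSpace.single j (1 : ℝ)) i * y j := by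
    rw [hx]
    conv_lhs => rw [hs]
    simp [map_sum, Finset.sum_apply, mul_comm]
  rw [this]
  push_cast
  rfl

/-- The chain rule produces the direction g⁻¹ eᵢ. As the inverse of an orthogonal matrix is its
transpose, the coordinates of this vector are row i of the matrix, and momenta transform exactly as
positions do. -/
theorem heis_linearGate_momentum {m : ℕ} (g : Conf m ≃ₗᵢ[ℝ] Conf m) (i : Fin m) :
    heis (linearGate g.toContinuousLinearEquiv) (momentum i)
      = ∑ j, (((g (EuclideanSpace.single j (1 : ℝ)) i : ℝ)) : ℂ) • momentum j := by
  rw [heis_eq_iff]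
  intro ψ x
  have hs : g.symm (EuclideanSpace.single i (1 : ℝ))
      = ∑ j, g (EuclideanSpace.single j (1 : ℝ)) i • EuclideanSpace.single j (1 : ℝ) := by
    ext k
    have : g.symm (EuclideanSpace.single i (1 : ℝ)) k
        = inner ℝ (EuclideanSpace.single k (1 : ℝ)) (g.symm (EuclideanSpace.single i (1 : ℝ))) := by
      simp [EuclideanSpace.inner_single_left]
    rw [this, ← g.inner_map_map, g.apply_symm_apply]
    simp [Finset.sum_apply, Pi.single_apply, EuclideanSpace.inner_single_right]
  have h1 : linearGate g.toContinuousLinearEquiv ψ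
      = SchwartzMap.compCLMOfContinuousLinearEquiv ℂ g.toContinuousLinearEquiv.symm ψ := rfl
  have h2 : momentum i (linearGate g.toContinuousLinearEquiv ψ)
      = (-2 * Complex.I) • ∂_{(EuclideanSpace.single i (1 : ℝ) : Conf m)}
        (SchwartzMap.compCLMOfContinuousLinearEquiv ℂ g.toContinuousLinearEquiv.symm ψ) := rfl
  rw [h2, SchwartzMap.lineDerivOp_compCLMOfContinuousLinearEquiv]
  have h3 : g.toContinuousLinearEquiv.symm (EuclideanSpace.single i (1 : ℝ))
    = g.symm (EuclideanSpace.single i (1 : ℝ)) := rfl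
  rw [h3, hs, linearGate_apply]
  simp only [smul_apply, SchwartzMap.compCLMOfContinuousLinearEquiv_apply,
    Function.comp_apply, LinearMap.sum_apply, sum_apply, LinearMap.smul_apply,
    momentum_apply, smul_eq_mul, SchwartzMap.lineDerivOp_apply_eq_fderiv, map_sum, map_smul,
    Finset.mul_sum]
  refine Finset.sum_congr rfl fun j _ => ?_
  rw [ψ.differentiableAt.lineDeriv_eq_fderiv]
  simp only [Complex.real_smul]
  ring

theorem heis_translationGate_position {m : ℕ} (a : Conf m) (i : Fin m) :
    heis (translationGate a) (position i) = position i + (a i : ℂ) • 1 := by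
  rw [heis_eq_iff]
  intro ψ x
  simp [position_apply, translationGate_apply]
  ring

theorem heis_translationGate_momentum {m : ℕ} (a : Conf m) (i : Fin m) :
    heis (translationGate a) (momentum i) = momentum i := by
  rw [heis_eq_iff]
  intro ψ x
  have : (translationGate a ψ : Conf m → ℂ) = fun y => ψ (y - a) := by
    funext y; exact translationGate_apply a ψ y
  rw [momentum_apply, this, translationGate_apply, momentum_apply]
  unfold lineDeriv
  simp only [add_sub_right_comm]

theorem heis_refl {m : ℕ} (A : Module.End ℂ (Wave m)) : heis (LinearEquiv.refl ℂ (Wave m)) A = A :=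
  rfl

theorem heis_symm_eq_iff {m : ℕ} {V : Wave m ≃ₗ[ℂ] Wave m} {A B : Module.End ℂ (Wave m)} :
    heis V.symm A = B ↔ A = heis V B := by
  constructor
  · rintro rfl
    exact ((heis V).apply_symm_apply A).symm
  · rintro rfl
    exact (heis V).symm_apply_apply B

/-! ### The Fourier transform exchanges positions and momenta. -/

theorem smulLeftCLM_inner_single {m : ℕ} (i : Fin m) (φ : Wave m) :
    SchwartzMap.smulLeftCLM ℂ
      (fun x : Conf m => inner ℝ x (EuclideanSpace.single i (1 : ℝ))) φ = position i φ := by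
  have h : Function.HasTemperateGrowth
      (fun x : Conf m => inner ℝ x (EuclideanSpace.single i (1 : ℝ))) := by fun_prop
  ext y
  rw [SchwartzMap.smulLeftCLM_apply_apply h, position_apply]
  simp [EuclideanSpace.inner_single_right]

theorem heis_fourier_position {m : ℕ} (i : Fin m) :
    heis (FourierTransform.fourierEquiv ℂ (Wave m)) (position i)
      = (1 / (4 * Real.pi) : ℂ) • momentum i := by
  rw [heis_eq_iff]
  intro ψ x
  have e : (momentum i) ψ = (-2 * Complex.I) • ∂_{(EuclideanSpace.single i (1 : ℝ) : Conf m)} ψ :=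
    rfl
  have hpi : (Real.pi : ℂ) ≠ 0 := by exact_mod_cast Real.pi_ne_zero
  rw [position_apply, LinearMap.smul_apply, map_smul, e, map_smul,
    FourierTransform.fourierEquiv_apply, FourierTransform.fourierEquiv_apply,
    SchwartzMap.fourier_lineDerivOp_eq, smulLeftCLM_inner_single]
  simp only [smul_apply, smul_eq_mul, position_apply]
  field_simp
  linear_combination (x i * (𝓕 ψ) x : ℂ) * 4 * Complex.I_sq

theorem heis_fourier_momentum {m : ℕ} (i : Fin m) :
    heis (FourierTransform.fourierEquiv ℂ (Wave m)) (momentum i)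
      = (-(4 * Real.pi) : ℂ) • position i := by
  rw [heis_eq_iff]
  intro ψ x
  have e : ∀ φ, (momentum i) φ
      = (-2 * Complex.I) • ∂_{(EuclideanSpace.single i (1 : ℝ) : Conf m)} φ := fun _ => rfl
  rw [e, FourierTransform.fourierEquiv_apply, FourierTransform.fourierEquiv_apply,
    SchwartzMap.lineDerivOp_fourier_eq, smulLeftCLM_inner_single, LinearMap.smul_apply,
    FourierTransform.fourier_smul,
    FourierTransform.fourier_smul]
  simp only [smul_apply, smul_eq_mul]
  linear_combination ((𝓕 (position i ψ)) x : ℂ) * (4 * Real.pi) * Complex.I_sq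

/-! ### Action of the individual gates on the quadratures. -/

theorem hasLineDerivAt_coord {m : ℕ} (i j : Fin m) (x : Conf m) :
    HasLineDerivAt ℝ (fun x : Conf m => x j) (if j = i then 1 else 0) x
      (EuclideanSpace.single i 1) := by
  have := ((EuclideanSpace.proj (𝕜 := ℝ) j).hasFDerivAt (x := x)).hasLineDerivAt
    (EuclideanSpace.single i (1 : ℝ))
  simpa [Pi.single_apply] using this

theorem heis_cubicGate_position {m : ℕ} [NeZero m] (γ : ℝ) (i : Fin m) :
    heis (cubicGate γ) (position i) = position i :=
  heis_phaseGate_position _ i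

/-- The coefficient is twice the derivative 3γ x₁² of the phase. This is the only place where the
degree of an observable grows. -/
theorem heis_cubicGate_momentum {m : ℕ} [NeZero m] (γ : ℝ) (i : Fin m) :
    heis (cubicGate γ) (momentum i)
      = momentum i + (if i = 0 then (6 * γ : ℂ) else 0) • (position 0 * position 0) := by
  refine heis_phaseGate_momentum _ i _ fun ψ x =>
    ⟨γ * (3 * x 0 ^ 2 * if 0 = i then 1 else 0), ?_, ?_⟩
  · have h := hasLineDerivAt_coord i 0 x
    unfold HasLineDerivAt at h ⊢
    simpa using (h.pow 3).const_mul γ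
  · simp only [LinearMap.smul_apply, Module.End.mul_apply, smul_apply, position_apply,
      smul_eq_mul, eq_comm (a := (0 : Fin m))]
    split_ifs
    · push_cast; ring
    · simp

theorem heis_quadraticPhase_momentum {m : ℕ} [NeZero m] {f : Conf m → ℝ}
    (hf : f.HasTemperateGrowth) (k : ℝ) (h : ∀ x, f x = k * x 0 ^ 2) (i : Fin m) :
    heis (phaseGate f hf) (momentum i)
      = momentum i + (if i = 0 then (4 * k : ℂ) else 0) • position 0 := by
  refine heis_phaseGate_momentum _ i _ fun ψ x =>
    ⟨k * (2 * x 0 * if 0 = i then 1 else 0), ?_, ?_⟩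
  · have h1 := hasLineDerivAt_coord i 0 x
    rw [show f = fun x => k * x 0 ^ 2 from funext h]
    unfold HasLineDerivAt at h1 ⊢
    simpa using (h1.pow 2).const_mul k
  · simp only [LinearMap.smul_apply, smul_apply, position_apply,
      smul_eq_mul, eq_comm (a := (0 : Fin m))]
    split_ifs
    · push_cast; ring
    · simp

theorem heis_displacementGate_position {m : ℕ} (a b : Conf m) (i : Fin m) :
    heis (displacementGate a b) (position i) = position i + (a i : ℂ) • 1 := by
  rw [displacementGate, heis_trans, heis_phaseGate_position, heis_translationGate_position]

theorem heis_displacementGate_momentum {m : ℕ} (a b : Conf m) (i : Fin m) :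
    heis (displacementGate a b) (momentum i) = momentum i + (b i : ℂ) • 1 := by
  rw [displacementGate, heis_trans, heis_phaseGate_momentum _ i ((b i : ℂ) • 1), map_add, map_smul,
    map_one, heis_translationGate_momentum]
  intro ψ x
  refine ⟨b i / 2, ?_, ?_⟩
  · have h : HasLineDerivAt ℝ (fun x : Conf m => ∑ j, (b j / 2 * x j - a j * b j / 4))
        (∑ j, b j / 2 * if j = i then 1 else 0) x (EuclideanSpace.single i 1) := by
      have h1 := fun j => hasLineDerivAt_coord i j x
      unfold HasLineDerivAt at h1 ⊢
      exact HasDerivAt.fun_sum fun j _ => ((h1 j).const_mul _).sub_const _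
    simpa using h
  · simp only [LinearMap.smul_apply, smul_apply, smul_eq_mul, Module.End.one_apply]
    push_cast
    ring

theorem heis_dispOrth_position {m : ℕ} (g : DispOrth m) (i : Fin m) :
    heis g.gate (position i) = ∑ j, (g.entry i j : ℂ) • position j + (g.dq i : ℂ) • 1 := by
  rw [DispOrth.gate, heis_trans, heis_displacementGate_position, map_add, map_smul, map_one,
    heis_linearGate_position]
  rfl

theorem heis_dispOrth_momentum {m : ℕ} (g : DispOrth m) (i : Fin m) :
    heis g.gate (momentum i) = ∑ j, (g.entry i j : ℂ) • momentum j + (g.dp i : ℂ) • 1 := by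
  rw [DispOrth.gate, heis_trans, heis_displacementGate_momentum, map_add, map_smul, map_one,
    heis_linearGate_momentum]
  rfl

theorem heis_positionChirp_position {m : ℕ} [NeZero m] (s : ℝ) (i : Fin m) :
    heis (positionChirp s) (position i) = position i :=
  heis_phaseGate_position _ i

theorem heis_positionChirp_momentum {m : ℕ} [NeZero m] (s : ℝ) (i : Fin m) :
    heis (positionChirp s) (momentum i)
      = momentum i - (if i = 0 then (s : ℂ) else 0) • position 0 := by
  rw [positionChirp, heis_quadraticPhase_momentum _ (-(s / 4)) (fun x => by ring)]
  split_ifs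
  · push_cast
    rw [show (4 * -(s / 4 : ℂ)) = -s by ring, neg_smul, sub_eq_add_neg]
  · simp

theorem heis_momentumChirp_momentum {m : ℕ} [NeZero m] (s : ℝ) (i : Fin m) :
    heis (momentumChirp s) (momentum i) = momentum i := by
  have hpi : (Real.pi : ℂ) ≠ 0 := by exact_mod_cast Real.pi_ne_zero
  have h : heis (FourierTransform.fourierEquiv ℂ (Wave m)).symm (momentum i)
      = (4 * Real.pi : ℂ) • position i := by
    rw [heis_symm_eq_iff, map_smul, heis_fourier_position, smul_smul]
    field_simp
    simp
  rw [momentumChirp, heis_trans, heis_trans, h, map_smul, heis_phaseGate_position, ← h,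
    ← heis_trans]
  simp [heis_refl]

/-- Conjugation by the Fourier transform turns the position into a multiple of a momentum and the
chirp into a quadratic phase, whose action is known; transforming back cancels all factors 4π. -/
theorem heis_momentumChirp_position {m : ℕ} [NeZero m] (s : ℝ) (i : Fin m) :
    heis (momentumChirp s) (position i)
      = position i + (if i = 0 then (s : ℂ) else 0) • momentum 0 := by
  have hpi : (Real.pi : ℂ) ≠ 0 := by exact_mod_cast Real.pi_ne_zero
  have h : heis (FourierTransform.fourierEquiv ℂ (Wave m)).symm (position i)
      = (-(1 / (4 * Real.pi)) : ℂ) • momentum i := by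
    rw [heis_symm_eq_iff, map_smul, heis_fourier_momentum, smul_smul]
    field_simp
    simp
  rw [momentumChirp, heis_trans, heis_trans, h, map_smul,
    heis_quadraticPhase_momentum _ (-(s / 4 * (4 * Real.pi) ^ 2)) (fun x => by ring), map_smul,
    map_add, map_smul, heis_fourier_momentum, heis_fourier_position, smul_add, smul_smul,
    smul_smul, smul_smul]
  congr 1
  · field_simp
    simp
  · congr 1
    split_ifs
    · push_cast
      field_simp
    · simp

theorem heis_firstReflection_position {m : ℕ} [NeZero m] (i : Fin m) :
    heis (linearGate (firstReflection m)) (position i)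
      = (if i = 0 then (-1 : ℂ) else 1) • position i := by
  rw [firstReflection, heis_linearGate_position, Finset.sum_eq_single i]
  · congr 1
    split_ifs with h <;> simp [h]
  · intro j _ hj
    have : ((LinearIsometryEquiv.piLpCongrRight 2 fun i : Fin m =>
        if i = 0 then LinearIsometryEquiv.neg ℝ else LinearIsometryEquiv.refl ℝ ℝ)
        (EuclideanSpace.single j (1 : ℝ))) i = 0 := by
      by_cases h : i = 0 <;> simp [h, hj.symm]
      intro h2; exact absurd (h.trans h2) hj.symm
    rw [this]; simp
  · simp

theorem heis_firstReflection_momentum {m : ℕ} [NeZero m] (i : Fin m) :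
    heis (linearGate (firstReflection m)) (momentum i)
      = (if i = 0 then (-1 : ℂ) else 1) • momentum i := by
  rw [firstReflection, heis_linearGate_momentum, Finset.sum_eq_single i]
  · congr 1
    split_ifs with h <;> simp [h]
  · intro j _ hj
    have : ((LinearIsometryEquiv.piLpCongrRight 2 fun i : Fin m =>
        if i = 0 then LinearIsometryEquiv.neg ℝ else LinearIsometryEquiv.refl ℝ ℝ)
        (EuclideanSpace.single j (1 : ℝ))) i = 0 := by
      by_cases h : i = 0 <;> simp [h, hj.symm]
      intro h2; exact absurd (h.trans h2) hj.symm
    rw [this]; simp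
  · simp

theorem heis_constPhase_momentum {m : ℕ} (k : ℝ) (i : Fin m)
    (hf : (fun _ : Conf m => k).HasTemperateGrowth) :
    heis (phaseGate (fun _ => k) hf) (momentum i) = momentum i := by
  rw [heis_phaseGate_momentum _ i 0, add_zero]
  intro ψ x
  refine ⟨0, ?_, by simp⟩
  unfold HasLineDerivAt
  exact hasDerivAt_const _ _

/-- With T = tan(τ/2) and S = sin τ, these are the equations under which the product of three shears
with parameters T, S, T is a rotation. -/
theorem half_angle_identities {τ : ℝ} (h : Real.cos (τ / 2) ≠ 0) :
    Real.sin τ * Real.tan (τ / 2) = 1 - Real.cos τ ∧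
      Real.tan (τ / 2) * (1 + Real.cos τ) = Real.sin τ := by
  have h1 : Real.sin τ = 2 * Real.sin (τ / 2) * Real.cos (τ / 2) := by
    rw [← Real.sin_two_mul]; ring_nf
  have h2 : Real.cos τ = 2 * Real.cos (τ / 2) ^ 2 - 1 := by
    rw [← Real.cos_two_mul]; ring_nf
  rw [h1, h2, Real.tan_eq_sin_div_cos]
  constructor
  · field_simp
    rw [Real.sin_sq]; ring
  · field_simp
    ring

/-- The chirps act as the shears p₁ ↦ p₁ - T q₁ and q₁ ↦ q₁ + S p₁. Their product has diagonal
entries 1 - S T and off-diagonal entries S and -T (2 - S T), which the half-angle identities turn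
into the rotation matrix. -/
theorem heis_rotationGate {m : ℕ} [NeZero m] (θ : ℝ) :
    (heis (rotationGate θ) (position (0 : Fin m))
      = (Real.cos θ : ℂ) • position 0 + (Real.sin θ : ℂ) • momentum 0) ∧
    (heis (rotationGate θ) (momentum (0 : Fin m))
      = (-Real.sin θ : ℂ) • position 0 + (Real.cos θ : ℂ) • momentum 0) ∧
    ∀ i : Fin m, i ≠ 0 → heis (rotationGate θ) (position i) = position i ∧
      heis (rotationGate θ) (momentum i) = momentum i := by
  have hc : Real.cos θ = Real.cos (θ : Real.Angle).toReal := by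
    rw [Real.Angle.cos_toReal, Real.Angle.cos_coe]
  have hs : Real.sin θ = Real.sin (θ : Real.Angle).toReal := by
    rw [Real.Angle.sin_toReal, Real.Angle.sin_coe]
  rw [hc, hs]
  unfold rotationGate
  have hlo := Real.Angle.neg_pi_lt_toReal (θ : Real.Angle)
  have hhi := Real.Angle.toReal_le_pi (θ : Real.Angle)
  dsimp only
  split_ifs with h
  · simp +contextual [h, heis_firstReflection_position, heis_firstReflection_momentum]
  -- The representative lies in (-π, π] and differs from π here, so its half lies strictly between
  -- -π/2 and π/2.
  · have hcos : Real.cos ((θ : Real.Angle).toReal / 2) ≠ 0 :=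
      (Real.cos_pos_of_mem_Ioo ⟨by linarith, by
        have := lt_of_le_of_ne hhi h; linarith⟩).ne'
    obtain ⟨e1, e2⟩ := half_angle_identities hcos
    generalize Real.tan ((θ : Real.Angle).toReal / 2) = T at e1 e2 ⊢
    generalize Real.sin (θ : Real.Angle).toReal = S at e1 e2 ⊢
    generalize Real.cos (θ : Real.Angle).toReal = K at e1 e2 ⊢
    have e1' : (S : ℂ) * T = 1 - K := by exact_mod_cast e1
    have e2' : (T : ℂ) * (1 + K) = S := by exact_mod_cast e2
    simp only [heis_trans, heis_phaseGate_position, heis_constPhase_momentum,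
      heis_positionChirp_position, heis_positionChirp_momentum, heis_momentumChirp_position,
      heis_momentumChirp_momentum, map_add, map_sub, map_smul, if_true]
    refine ⟨?_, ?_, ?_⟩
    · match_scalars <;> first | linear_combination -e1' | ring
    · match_scalars <;> first
        | linear_combination -e2' + T * e1'
        | linear_combination -e1'
    · intro i hi
      simp [hi]

/-! ## Unitarity and traces -/

/-- The gate `V` preserves the norm of `L²(ℝ^m)`. -/
def NormPreserving {m : ℕ} (V : Wave m ≃ₗ[ℂ] Wave m) : Prop :=
  ∀ ψ, ‖toL2 (V ψ)‖ = ‖toL2 ψ‖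

theorem NormPreserving.trans {m : ℕ} {V W : Wave m ≃ₗ[ℂ] Wave m} (hV : NormPreserving V)
    (hW : NormPreserving W) : NormPreserving (V.trans W) := fun ψ => by
  rw [LinearEquiv.trans_apply, hW, hV]

theorem NormPreserving.symm {m : ℕ} {V : Wave m ≃ₗ[ℂ] Wave m} (hV : NormPreserving V) :
    NormPreserving V.symm := fun ψ => by
  rw [← hV, LinearEquiv.apply_symm_apply]

theorem normPreserving_of_integral {m : ℕ} {V : Wave m ≃ₗ[ℂ] Wave m}
    (h : ∀ ψ, ∫ x, ‖V ψ x‖ ^ (2 : ENNReal).toReal = ∫ x, ‖ψ x‖ ^ (2 : ENNReal).toReal) :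
    NormPreserving V := fun ψ => by
  unfold toL2
  rw [SchwartzMap.norm_toLp' two_ne_zero ENNReal.ofNat_ne_top,
    SchwartzMap.norm_toLp' two_ne_zero ENNReal.ofNat_ne_top, h]

theorem normPreserving_phaseGate {m : ℕ} {f : Conf m → ℝ} (hf : f.HasTemperateGrowth) :
    NormPreserving (phaseGate f hf) := by
  refine normPreserving_of_integral fun ψ => ?_
  simp [phaseGate_apply, Complex.norm_exp]

theorem normPreserving_linearGate {m : ℕ} (g : Conf m ≃ₗᵢ[ℝ] Conf m) :
    NormPreserving (linearGate g.toContinuousLinearEquiv) := by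
  refine normPreserving_of_integral fun ψ => ?_
  simp only [linearGate_apply]
  exact g.symm.measurePreserving.integral_comp g.symm.toHomeomorph.measurableEmbedding
    (fun y => ‖ψ y‖ ^ (2 : ENNReal).toReal)

theorem normPreserving_translationGate {m : ℕ} (a : Conf m) :
    NormPreserving (translationGate a) := by
  refine normPreserving_of_integral fun ψ => ?_
  simp only [translationGate_apply]
  exact MeasureTheory.integral_sub_right_eq_self (fun y => ‖ψ y‖ ^ (2 : ENNReal).toReal) a

theorem normPreserving_fourier {m : ℕ} :
    NormPreserving (FourierTransform.fourierEquiv ℂ (Wave m)) :=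
  fun ψ => SchwartzMap.norm_fourier_toL2_eq ψ

theorem normPreserving_dispOrth {m : ℕ} (g : DispOrth m) : NormPreserving g.gate :=
  (normPreserving_linearGate g.orth).trans
    ((normPreserving_translationGate _).trans (normPreserving_phaseGate _))

theorem normPreserving_rotationGate {m : ℕ} [NeZero m] (θ : ℝ) :
    NormPreserving (rotationGate (m := m) θ) := by
  unfold rotationGate
  dsimp only
  split_ifs
  · exact normPreserving_linearGate _
  · have hp : ∀ s, NormPreserving (positionChirp (m := m) s) := fun s =>
      normPreserving_phaseGate _
    have hm : ∀ s, NormPreserving (momentumChirp (m := m) s) := fun s =>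
      (normPreserving_fourier.trans (normPreserving_phaseGate _)).trans normPreserving_fourier.symm
    exact (((hp _).trans (hm _)).trans (hp _)).trans (normPreserving_phaseGate _)

theorem normPreserving_blockOp {m : ℕ} [NeZero m] (g : ℕ → DispOrth m) (γ : ℕ → ℝ) (t : ℕ) :
    NormPreserving (blockOp g γ t) := by
  induction t with
  | zero => exact normPreserving_dispOrth _
  | succ t ih => exact (ih.trans (normPreserving_phaseGate _)).trans (normPreserving_dispOrth _)

theorem normPreserving_circuitOp {m : ℕ} [NeZero m] (D : Circuit m) (t c : ℕ) :
    NormPreserving (circuitOp D t c) := by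
  induction c with
  | zero => exact normPreserving_blockOp _ _ _
  | succ c ih =>
    exact (ih.trans (normPreserving_rotationGate _)).trans (normPreserving_blockOp _ _ _)

/-- `toL2` as a linear map. -/
def toL2L (m : ℕ) :
    Wave m →ₗ[ℂ] MeasureTheory.Lp ℂ 2 (MeasureTheory.volume : MeasureTheory.Measure (Conf m)) :=
  (SchwartzMap.toLpCLM ℂ ℂ 2 MeasureTheory.volume).toLinearMap

theorem toL2L_apply {m : ℕ} (ψ : Wave m) : toL2L m ψ = toL2 ψ := rfl

theorem denseRange_toL2L (m : ℕ) : DenseRange (toL2L m) :=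
  SchwartzMap.denseRange_toLpCLM (E := Conf m) (F := ℂ) (p := 2) (by simp)

/-- Polarization: the inner product is a combination of the four norms ‖φ + c ψ‖² with c = 1, -1, i,
-i. -/
theorem NormPreserving.inner {m : ℕ} {V : Wave m ≃ₗ[ℂ] Wave m} (hV : NormPreserving V)
    (φ ψ : Wave m) : inner ℂ (toL2 (V φ)) (toL2 (V ψ)) = inner ℂ (toL2 φ) (toL2 ψ) := by
  have e : ∀ (c : ℂ), ‖toL2 (V φ) + c • toL2 (V ψ)‖ = ‖toL2 φ + c • toL2 ψ‖ := fun c => by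
    have := hV (φ + c • ψ)
    simpa only [← toL2L_apply, map_add, map_smul] using this
  have e1 := e 1
  have e2 := e (-1)
  have e3 := e Complex.I
  have e4 := e (-Complex.I)
  simp only [one_smul, neg_smul, ← sub_eq_add_neg] at e1 e2 e3 e4
  rw [inner_eq_sum_norm_sq_div_four, inner_eq_sum_norm_sq_div_four]
  simp only [RCLike.I_to_complex]
  rw [e1, e2, e3, e4]

/-- The trace of `V A V⁻¹` is the trace of `A`: `V` permutes the orthonormal bases that consist of
Schwartz functions. -/
theorem HasTrace.conj {m : ℕ} {V : Wave m ≃ₗ[ℂ] Wave m} (hV : NormPreserving V)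
    {A : Module.End ℂ (Wave m)} {v : ℂ} (hA : HasTrace A v) :
    HasTrace (V.toLinearMap * A * V.symm.toLinearMap) v := by
  intro b e hb
  have horth : Orthonormal ℂ fun n => toL2 (V.symm (e n)) := by
    have hb' := b.orthonormal
    rw [orthonormal_iff_ite] at hb' ⊢
    intro i j
    rw [hV.symm.inner, ← hb, ← hb, hb']
  -- The vectors V⁻¹ eₙ are total: for a Schwartz function φ, approximate V φ by finite combinations
  -- of the eₙ. These are Schwartz functions too, so V⁻¹ can be applied to them, and it keeps the
  -- distance to φ. Schwartz functions are dense in L².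
  have hspan : ⊤ ≤ (Submodule.span ℂ
      (Set.range fun n => toL2 (V.symm (e n)))).topologicalClosure := by
    have key : ∀ φ : Wave m, toL2L m φ ∈ (Submodule.span ℂ
        (Set.range fun n => toL2 (V.symm (e n)))).topologicalClosure := by
      intro φ
      have h1 : toL2 (V φ) ∈ (Submodule.span ℂ (Set.range b)).topologicalClosure := by
        rw [b.dense_span]; trivial
      have hr : (Set.range b) = toL2L m '' Set.range e := by
        rw [← Set.range_comp]
        exact congrArg Set.range (funext hb)
      have hr' : (Set.range fun n => toL2 (V.symm (e n)))
          = toL2L m '' (V.symm.toLinearMap '' Set.range e) := by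
        rw [← Set.range_comp, ← Set.range_comp]; rfl
      rw [hr, ← Submodule.map_span] at h1
      rw [hr', ← Submodule.map_span, ← Submodule.map_span]
      rw [← SetLike.mem_coe, Submodule.topologicalClosure_coe, Metric.mem_closure_iff] at h1 ⊢
      intro ε hε
      obtain ⟨_, ⟨χ, hχ, rfl⟩, hd⟩ := h1 ε hε
      refine ⟨_, ⟨_, ⟨χ, hχ, rfl⟩, rfl⟩, ?_⟩
      rw [dist_eq_norm] at hd ⊢
      rw [← toL2L_apply, ← map_sub, toL2L_apply] at hd
      rw [← map_sub, toL2L_apply, ← hV, map_sub, LinearEquiv.coe_coe, V.apply_symm_apply]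
      exact hd
    intro x _
    have hx : x ∈ closure (Set.range (toL2L m)) := denseRange_toL2L m x
    refine closure_minimal ?_ (Submodule.isClosed_topologicalClosure _) hx
    rintro _ ⟨φ, rfl⟩
    exact key φ
  have := hA (HilbertBasis.mk horth hspan) (fun n => V.symm (e n)) (fun n => by
    rw [HilbertBasis.coe_mk])
  have hfun : (fun n => inner ℂ (toL2 (e n))
      (toL2 ((V.toLinearMap * A * V.symm.toLinearMap) (e n))))
      = fun n => inner ℂ (toL2 (V.symm (e n))) (toL2 (A (V.symm (e n)))) := by
    funext n
    rw [← hV.inner (V.symm (e n)), LinearEquiv.apply_symm_apply]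
    rfl
  rw [hfun]
  exact this

theorem HasTrace.sum_smul {m : ℕ} {ι : Type*} (s : Finset ι) (k : ι → ℂ)
    (A : ι → Module.End ℂ (Wave m)) (v : ι → ℂ) (h : ∀ i ∈ s, HasTrace (A i) (v i)) :
    HasTrace (∑ i ∈ s, k i • A i) (∑ i ∈ s, k i * v i) := by
  intro b e hb
  have h1 := hasSum_sum fun i hi => ((h i hi) b e hb).mul_left (k i)
  have hfun : (fun n => inner ℂ (toL2 (e n)) (toL2 ((∑ i ∈ s, k i • A i) (e n))))
      = fun n => ∑ i ∈ s, k i * inner ℂ (toL2 (e n)) (toL2 (A i (e n))) := by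
    funext n
    rw [LinearMap.sum_apply, ← toL2L_apply (∑ i ∈ s, _), map_sum, inner_sum]
    refine Finset.sum_congr rfl fun i _ => ?_
    rw [LinearMap.smul_apply, map_smul, inner_smul_right, toL2L_apply]
  rw [hfun]
  exact h1

/-! ## A structured language for the random access machine -/

/-- Registers of the structured language. -/
inductive Reg : Type
  | m | t | c | d | N | R | ell | b | s | a | p | r | h | hi | w | j
  deriving DecidableEq

/-- Arrays of natural numbers. -/
inductive NArr : Type
  | len | code | can
  deriving DecidableEq

/-- Arrays of scalars. -/
inductive SArr : Type
  | acc | T | T' | B | B' | G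
  deriving DecidableEq

/-- The number of a register. -/
def Reg.num : Reg → ℕ
  | m => 0 | t => 1 | c => 2 | d => 3 | N => 4 | R => 5 | ell => 6 | b => 7 | s => 8 | a => 9
  | p => 10 | r => 11 | h => 12 | hi => 13 | w => 14 | j => 15

/-- The number of an array of natural numbers. -/
def NArr.num : NArr → ℕ
  | len => 0 | code => 1 | can => 2

/-- The number of an array of scalars. -/
def SArr.num : SArr → ℕ
  | acc => 0 | T => 1 | T' => 2 | B => 3 | B' => 4 | G => 5

theorem Reg.num_inj {x y : Reg} : x.num = y.num ↔ x = y := by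
  constructor
  · cases x <;> cases y <;> simp [Reg.num]
  · rintro rfl; rfl

theorem NArr.num_inj {x y : NArr} : x.num = y.num ↔ x = y := by
  constructor
  · cases x <;> cases y <;> simp [NArr.num]
  · rintro rfl; rfl

theorem SArr.num_inj {x y : SArr} : x.num = y.num ↔ x = y := by
  constructor
  · cases x <;> cases y <;> simp [SArr.num]
  · rintro rfl; rfl

theorem NArr.num_lt (x : NArr) : x.num < 3 := by cases x <;> simp [NArr.num]

theorem SArr.num_lt (x : SArr) : x.num < 6 := by cases x <;> simp [SArr.num]

/-- A state of the structured language. -/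
structure St where
  /-- registers -/
  v : Reg → ℕ
  /-- arrays of natural numbers -/
  n : NArr → ℕ → ℕ
  /-- arrays of scalars -/
  s : SArr → ℕ → ℂ

/-- Write a register. -/
def St.setV (s : St) (x : Reg) (k : ℕ) : St := { s with v := Function.update s.v x k }

/-- Write an entry of an array of natural numbers. -/
def St.setN (s : St) (a : NArr) (i k : ℕ) : St :=
  { s with n := Function.update s.n a (Function.update (s.n a) i k) }

/-- Write an entry of an array of scalars. -/
def St.setS (s : St) (a : SArr) (i : ℕ) (z : ℂ) : St :=
  { s with s := Function.update s.s a (Function.update (s.s a) i z) }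

@[simp] theorem St.setV_v (s : St) (x y : Reg) (k : ℕ) :
    (s.setV x k).v y = if y = x then k else s.v y := by simp [St.setV, Function.update_apply]

@[simp] theorem St.setV_n (s : St) (x : Reg) (k : ℕ) : (s.setV x k).n = s.n := rfl

@[simp] theorem St.setV_s (s : St) (x : Reg) (k : ℕ) : (s.setV x k).s = s.s := rfl

@[simp] theorem St.setN_v (s : St) (a : NArr) (i k : ℕ) : (s.setN a i k).v = s.v := rfl

@[simp] theorem St.setN_s (s : St) (a : NArr) (i k : ℕ) : (s.setN a i k).s = s.s := rfl

@[simp] theorem St.setN_n (s : St) (a a' : NArr) (i i' k : ℕ) :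
    (s.setN a i k).n a' i' = if a' = a ∧ i' = i then k else s.n a' i' := by
  by_cases h : a' = a
  · subst h; simp [St.setN, Function.update_apply]
  · simp [St.setN, h]

@[simp] theorem St.setS_v (s : St) (a : SArr) (i : ℕ) (z : ℂ) : (s.setS a i z).v = s.v := rfl

@[simp] theorem St.setS_n (s : St) (a : SArr) (i : ℕ) (z : ℂ) : (s.setS a i z).n = s.n := rfl

@[simp] theorem St.setS_s (s : St) (a a' : SArr) (i i' : ℕ) (z : ℂ) :
    (s.setS a i z).s a' i' = if a' = a ∧ i' = i then z else s.s a' i' := by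
  by_cases h : a' = a
  · subst h; simp [St.setS, Function.update_apply]
  · simp [St.setS, h]

/-- Integer expressions. -/
inductive IExp : Type
  | const (n : ℕ)
  | reg (x : Reg)
  | load (a : NArr) (e : IExp)
  | add (e f : IExp)
  | sub (e f : IExp)
  | mul (e f : IExp)

/-- Scalar expressions. -/
inductive SExp : Type
  | const (z : ℤ)
  | load (a : SArr) (e : IExp)
  | input (a : ℕ) (e f : IExp)
  | add (e f : SExp)
  | sub (e f : SExp)
  | mul (e f : SExp)

instance (n : ℕ) : OfNat IExp n := ⟨IExp.const n⟩
instance : Add IExp := ⟨IExp.add⟩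
instance : Sub IExp := ⟨IExp.sub⟩
instance : Mul IExp := ⟨IExp.mul⟩
instance : Add SExp := ⟨SExp.add⟩
instance : Sub SExp := ⟨SExp.sub⟩
instance : Mul SExp := ⟨SExp.mul⟩

/-- The value of an integer expression. -/
def IExp.eval (s : St) : IExp → ℕ
  | const n => n
  | reg x => s.v x
  | load a e => s.n a (e.eval s)
  | add e f => e.eval s + f.eval s
  | sub e f => e.eval s - f.eval s
  | mul e f => e.eval s * f.eval s

/-- The value of a scalar expression. -/
def SExp.eval (inp : Input) (s : St) : SExp → ℂ
  | const z => z
  | load a e => s.s a (e.eval s)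
  | input a e f => inp a (e.eval s) (f.eval s)
  | add e f => e.eval inp s + f.eval inp s
  | sub e f => e.eval inp s - f.eval inp s
  | mul e f => e.eval inp s * f.eval inp s

@[simp] theorem IExp.eval_zero (s : St) : IExp.eval s 0 = 0 := rfl
@[simp] theorem IExp.eval_one (s : St) : IExp.eval s 1 = 1 := rfl
@[simp] theorem IExp.eval_two (s : St) : IExp.eval s 2 = 2 := rfl
@[simp] theorem IExp.eval_const (s : St) (n : ℕ) : IExp.eval s (.const n) = n := rfl
@[simp] theorem IExp.eval_reg (s : St) (x : Reg) : IExp.eval s (.reg x) = s.v x := rfl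
@[simp] theorem IExp.eval_load (s : St) (a : NArr) (e : IExp) :
    IExp.eval s (.load a e) = s.n a (e.eval s) := rfl
@[simp] theorem IExp.eval_add (s : St) (e f : IExp) : (e + f).eval s = e.eval s + f.eval s := rfl
@[simp] theorem IExp.eval_sub (s : St) (e f : IExp) : (e - f).eval s = e.eval s - f.eval s := rfl
@[simp] theorem IExp.eval_mul (s : St) (e f : IExp) : (e * f).eval s = e.eval s * f.eval s := rfl
@[simp] theorem SExp.eval_const (inp : Input) (s : St) (z : ℤ) :
    SExp.eval inp s (.const z) = z := rfl
@[simp] theorem SExp.eval_load (inp : Input) (s : St) (a : SArr) (e : IExp) :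
    SExp.eval inp s (.load a e) = s.s a (e.eval s) := rfl
@[simp] theorem SExp.eval_input (inp : Input) (s : St) (a : ℕ) (e f : IExp) :
    SExp.eval inp s (.input a e f) = inp a (e.eval s) (f.eval s) := rfl
@[simp] theorem SExp.eval_add (inp : Input) (s : St) (e f : SExp) :
    (e + f).eval inp s = e.eval inp s + f.eval inp s := rfl
@[simp] theorem SExp.eval_sub (inp : Input) (s : St) (e f : SExp) :
    (e - f).eval inp s = e.eval inp s - f.eval inp s := rfl
@[simp] theorem SExp.eval_mul (inp : Input) (s : St) (e f : SExp) :
    (e * f).eval inp s = e.eval inp s * f.eval inp s := rfl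

/-- The number of steps that it takes to evaluate an integer expression. -/
def IExp.cost : IExp → ℕ
  | const _ => 1
  | reg _ => 2
  | load _ e => e.cost + 5
  | add e f => e.cost + f.cost + 1
  | sub e f => e.cost + f.cost + 1
  | mul e f => e.cost + f.cost + 1

/-- The number of steps that it takes to evaluate a scalar expression. -/
def SExp.cost : SExp → ℕ
  | const _ => 2
  | load _ e => e.cost + 7
  | input _ e f => e.cost + f.cost + 2
  | add e f => e.cost + f.cost + 3
  | sub e f => e.cost + f.cost + 3
  | mul e f => e.cost + f.cost + 3

/-- Programs of the structured language. -/
inductive Stmt : Type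
  | skip
  | assign (x : Reg) (e : IExp)
  | storeN (a : NArr) (e f : IExp)
  | storeS (a : SArr) (e : IExp) (f : SExp)
  | seq (P Q : Stmt)
  /-- if `e < f` then `P` else `Q` -/
  | ite (e f : IExp) (P Q : Stmt)
  /-- for `x = 0, …, e - 1` do `P` -/
  | for_ (x : Reg) (e : IExp) (P : Stmt)

/-- The state before round `n` of a loop with counter `x` and body `f`. -/
def St.iter (f : St → St) (x : Reg) (s : St) : ℕ → St
  | 0 => s
  | i + 1 => f ((St.iter f x s i).setV x i)

/-- The effect of a program. -/
def Stmt.run (inp : Input) : Stmt → St → St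
  | skip, s => s
  | assign x e, s => s.setV x (e.eval s)
  | storeN a e f, s => s.setN a (e.eval s) (f.eval s)
  | storeS a e f, s => s.setS a (e.eval s) (f.eval inp s)
  | seq P Q, s => Q.run inp (P.run inp s)
  | ite e f P Q, s => if e.eval s < f.eval s then P.run inp s else Q.run inp s
  | for_ x e P, s => St.iter (P.run inp) x s (e.eval s)

/-- The number of steps of a program. -/
def Stmt.cost (inp : Input) : Stmt → St → ℕ
  | skip, _ => 1
  | assign _ e, _ => e.cost + 2
  | storeN _ e f, _ => e.cost + f.cost + 5
  | storeS _ e f, _ => e.cost + f.cost + 7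
  | seq P Q, s => P.cost inp s + Q.cost inp (P.run inp s)
  | ite e f P Q, s =>
    e.cost + f.cost + 1 + if e.eval s < f.eval s then P.cost inp s else Q.cost inp s
  | for_ x e P, s =>
    e.cost + 4 + ∑ i ∈ Finset.range (e.eval s),
      (P.cost inp ((St.iter (P.run inp) x s i).setV x i) + 5)

/-! ### Compilation -/

/-- Address of a register. -/
def adV (x : Reg) : ℕ := 4 * x.num
/-- Address of a temporary natural number. -/
def adT (k : ℕ) : ℕ := 4 * k + 1
/-- Address of a loop counter or loop bound. -/
def adH (k : ℕ) : ℕ := 4 * k + 2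
/-- Address of an entry of an array of natural numbers. -/
def adA (a : NArr) (i : ℕ) : ℕ := 12 * i + (4 * a.num + 3)
/-- Address of a temporary scalar. -/
def adU (k : ℕ) : ℕ := 9 * k + 8
/-- Address of an entry of an array of scalars. -/
def adS (a : SArr) (i : ℕ) : ℕ := 9 * i + a.num

-- The memory layout separates the kinds of cells by residues: modulo 4 for natural numbers
-- (registers, temporaries, loop cells, arrays), modulo 9 for scalars (six arrays, and the residue 8
-- for temporaries). All these facts on non-interference are therefore linear arithmetic.
@[simp] theorem adV_inj {x y : Reg} : adV x = adV y ↔ x = y := by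
  rw [← Reg.num_inj]; unfold adV; omega
@[simp] theorem adT_inj {x y : ℕ} : adT x = adT y ↔ x = y := by unfold adT; omega
@[simp] theorem adH_inj {x y : ℕ} : adH x = adH y ↔ x = y := by unfold adH; omega
@[simp] theorem adU_inj {x y : ℕ} : adU x = adU y ↔ x = y := by unfold adU; omega
@[simp] theorem adA_inj {a b : NArr} {i j : ℕ} : adA a i = adA b j ↔ a = b ∧ i = j := by
  have := a.num_lt; have := b.num_lt
  rw [← NArr.num_inj]; unfold adA; omega
@[simp] theorem adS_inj {a b : SArr} {i j : ℕ} : adS a i = adS b j ↔ a = b ∧ i = j := by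
  have := a.num_lt; have := b.num_lt
  rw [← SArr.num_inj]; unfold adS; omega
@[simp] theorem adV_ne_adT {x : Reg} {k : ℕ} : adV x ≠ adT k := by unfold adV adT; omega
@[simp] theorem adV_ne_adH {x : Reg} {k : ℕ} : adV x ≠ adH k := by unfold adV adH; omega
@[simp] theorem adH_ne_adV {x : Reg} {k : ℕ} : adH k ≠ adV x := by unfold adV adH; omega
@[simp] theorem adV_ne_adA {x : Reg} {a : NArr} {k : ℕ} : adV x ≠ adA a k := by
  unfold adV adA; omega
@[simp] theorem adA_ne_adV {x : Reg} {a : NArr} {k : ℕ} : adA a k ≠ adV x := by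
  unfold adV adA; omega
@[simp] theorem adH_ne_adT {j k : ℕ} : adH k ≠ adT j := by unfold adT adH; omega
@[simp] theorem adA_ne_adT {a : NArr} {j k : ℕ} : adA a k ≠ adT j := by unfold adT adA; omega
@[simp] theorem adH_ne_adA {a : NArr} {j k : ℕ} : adH j ≠ adA a k := by unfold adH adA; omega
@[simp] theorem adA_ne_adH {a : NArr} {j k : ℕ} : adA a k ≠ adH j := by unfold adH adA; omega
@[simp] theorem adU_ne_adS {a : SArr} {j k : ℕ} : adU j ≠ adS a k := by
  have := a.num_lt; unfold adU adS; omega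
@[simp] theorem adS_ne_adU {a : SArr} {j k : ℕ} : adS a k ≠ adU j := by
  have := a.num_lt; unfold adU adS; omega

/-- Code that evaluates an integer expression into the temporary `k`. -/
def IExp.comp : IExp → ℕ → Prog
  | const n, k => .iconst (adT k) n
  | reg x, k => .seq (.iconst (adT k) 0) (.iadd (adT k) (adV x) (adT k))
  | load a e, k => .seq (e.comp k) <| .seq (.iconst (adT (k + 1)) 12) <|
      .seq (.imul (adT k) (adT k) (adT (k + 1))) <| .seq (.iconst (adT (k + 1)) (4 * a.num + 3)) <|
      .seq (.iadd (adT k) (adT k) (adT (k + 1))) (.iload (adT k) (adT k))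
  | add e f, k => .seq (e.comp k) <| .seq (f.comp (k + 1)) (.iadd (adT k) (adT k) (adT (k + 1)))
  | sub e f, k => .seq (e.comp k) <| .seq (f.comp (k + 1)) (.isub (adT k) (adT k) (adT (k + 1)))
  | mul e f, k => .seq (e.comp k) <| .seq (f.comp (k + 1)) (.imul (adT k) (adT k) (adT (k + 1)))

/-- Code that evaluates a binary operation on temporary scalars. -/
def binComp (op : ℕ → ℕ → ℕ → Prog) (P Q : Prog) (k : ℕ) : Prog :=
  .seq P <| .seq Q <| .seq (.iconst (adT 0) (adU k)) <| .seq (.iconst (adT 1) (adU (k + 1))) <|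
    op (adT 0) (adT 0) (adT 1)

/-- Code that replaces the temporary `0`, an index, by the address in the array `a`. -/
def scaleComp (a : SArr) : Prog :=
  .seq (.iconst (adT 1) 9) <| .seq (.imul (adT 0) (adT 0) (adT 1)) <|
    .seq (.iconst (adT 1) a.num) (.iadd (adT 0) (adT 0) (adT 1))

/-- Code that evaluates a scalar expression into the temporary `k`. -/
def SExp.comp : SExp → ℕ → Prog
  | const z, k => .seq (.iconst (adT 0) (adU k)) (.sconst (adT 0) z)
  | load a e, k => .seq (e.comp 0) <| .seq (scaleComp a) <| .seq (.iconst (adT 1) (adU k)) <|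
      .seq (.sconst (adT 1) 0) (.sadd (adT 1) (adT 0) (adT 1))
  | input a e f, k => .seq (e.comp 0) <| .seq (f.comp 1) <| .seq (.iconst (adT 2) (adU k)) <|
      .read (adT 2) a (adT 0) (adT 1)
  | add e f, k => binComp .sadd (e.comp k) (f.comp (k + 1)) k
  | sub e f, k => binComp .ssub (e.comp k) (f.comp (k + 1)) k
  | mul e f, k => binComp .smul (e.comp k) (f.comp (k + 1)) k

/-- Code for a program inside of `k` loops. -/
def Stmt.comp : Stmt → ℕ → Prog
  | skip, _ => .skip
  | assign x e, _ => .seq (e.comp 0) <| .seq (.iconst (adT 1) 0) (.iadd (adV x) (adT 0) (adT 1))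
  | storeN a e f, _ => .seq (e.comp 0) <| .seq (.iconst (adT 1) 12) <|
      .seq (.imul (adT 0) (adT 0) (adT 1)) <| .seq (.iconst (adT 1) (4 * a.num + 3)) <|
      .seq (.iadd (adT 0) (adT 0) (adT 1)) <| .seq (f.comp 1) (.istore (adT 0) (adT 1))
  | storeS a e f, _ => .seq (f.comp 0) <| .seq (e.comp 0) <| .seq (scaleComp a) <|
      .seq (.iconst (adT 1) (adU 0)) <| .seq (.sconst (adT 0) 0) (.sadd (adT 0) (adT 1) (adT 0))
  | seq P Q, k => .seq (P.comp k) (Q.comp k)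
  | ite e f P Q, k => .seq (e.comp 0) <| .seq (f.comp 1) <|
      .ite (adT 0) (adT 1) (P.comp k) (Q.comp k)
  | for_ x e P, k => .seq (e.comp 0) <| .seq (.iconst (adT 1) 0) <|
      .seq (.iadd (adH (2 * k + 1)) (adT 0) (adT 1)) <| .seq (.iconst (adH (2 * k)) 0) <|
      .loop (adH (2 * k)) (adH (2 * k + 1)) <| .seq (.iconst (adT 1) 0) <|
      .seq (.iadd (adV x) (adH (2 * k)) (adT 1)) <| .seq (P.comp (k + 1)) <|
      .seq (.iconst (adT 0) 1) (.iadd (adH (2 * k)) (adH (2 * k)) (adT 0))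

/-- The memory `σ` represents the state `s`. -/
structure Rel (σ : Mem) (s : St) : Prop where
  v : ∀ x, σ.N (adV x) = s.v x
  n : ∀ a i, σ.N (adA a i) = s.n a i
  s : ∀ a i, σ.S (adS a i) = s.s a i

theorem Exec.then {inp : Input} {P Q : Prog} {σ₁ σ₂ σ₃ : Mem} {k l n : ℕ} (h₁ : Exec inp P σ₁ k σ₂)
    (h₂ : Exec inp Q σ₂ l σ₃) (h : k + l = n) : Exec inp (.seq P Q) σ₁ n σ₃ :=
  h ▸ Exec.seq _ _ _ _ _ _ _ h₁ h₂

/-- `σ'` differs from `σ` at most in the temporary natural numbers from `k` on. -/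
structure TempFrom (k : ℕ) (σ σ' : Mem) : Prop where
  N : ∀ y, (∀ j, k ≤ j → y ≠ adT j) → σ'.N y = σ.N y
  S : σ'.S = σ.S

theorem TempFrom.rel {k : ℕ} {σ σ' : Mem} {s : St} (h : TempFrom k σ σ') (hr : Rel σ s) :
    Rel σ' s where
  v x := by rw [h.N _ (by simp), hr.v]
  n a i := by rw [h.N _ (by simp), hr.n]
  s a i := by rw [h.S, hr.s]

/-- The temporaries form a stack. Code for level `k` leaves all lower levels alone, so a left
operand at level `k` survives the evaluation of the right operand at level `k + 1`. -/
theorem IExp.exec (inp : Input) (e : IExp) : ∀ (k : ℕ) {σ : Mem} {s : St}, Rel σ s →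
    ∃ σ', Exec inp (e.comp k) σ e.cost σ' ∧ σ'.N (adT k) = e.eval s ∧ TempFrom k σ σ' := by
  have bin : ∀ (op : ℕ → ℕ → ℕ → Prog) (g : ℕ → ℕ → ℕ) (e f : IExp) (n : ℕ),
      (∀ x y z σ, Exec inp (op x y z) σ 1 (σ.setN x (g (σ.N y) (σ.N z)))) →
      (n = e.cost + f.cost + 1) →
      (∀ (k : ℕ) {σ : Mem} {s : St}, Rel σ s →
        ∃ σ', Exec inp (e.comp k) σ e.cost σ' ∧ σ'.N (adT k) = e.eval s ∧ TempFrom k σ σ') →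
      (∀ (k : ℕ) {σ : Mem} {s : St}, Rel σ s →
        ∃ σ', Exec inp (f.comp k) σ f.cost σ' ∧ σ'.N (adT k) = f.eval s ∧ TempFrom k σ σ') →
      ∀ (k : ℕ) {σ : Mem} {s : St}, Rel σ s →
        ∃ σ', Exec inp (.seq (e.comp k) <| .seq (f.comp (k + 1)) (op (adT k) (adT k) (adT (k + 1))))
          σ n σ' ∧ σ'.N (adT k) = g (e.eval s) (f.eval s) ∧ TempFrom k σ σ' := by
    intro op g e f n hop hn he hf k σ s hr
    obtain ⟨σ₁, x₁, v₁, t₁⟩ := he k hr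
    obtain ⟨σ₂, x₂, v₂, t₂⟩ := hf (k + 1) (t₁.rel hr)
    refine ⟨_, x₁.then (x₂.then (hop _ _ _ _) rfl) (by omega), ?_, ?_, ?_⟩
    · have : σ₂.N (adT k) = e.eval s := by
        rw [t₂.N _ (fun j hj h => by simp at h; omega), v₁]
      simp [Mem.setN, this, v₂]
    · intro y hy
      have h0 := hy k le_rfl
      simp only [Mem.setN, Function.update_of_ne h0]
      rw [t₂.N y (fun j hj => hy j (by omega)), t₁.N y hy]
    · simp [Mem.setN, t₁.S, t₂.S]
  induction e with
  | const n =>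
    intro k σ s hr
    refine ⟨_, Exec.iconst _ _ _, by simp [Mem.setN, IExp.eval], ?_, rfl⟩
    intro y hy
    simp [Mem.setN, hy k le_rfl]
  | reg x =>
    intro k σ s hr
    refine ⟨_, (Exec.iconst _ _ _).then (Exec.iadd _ _ _ _) rfl, ?_, ?_, rfl⟩
    · simp [Mem.setN, hr.v]
    · intro y hy
      simp [Mem.setN, hy k le_rfl]
  | load a e ih =>
    intro k σ s hr
    obtain ⟨σ₁, x₁, v₁, t₁⟩ := ih k hr
    refine ⟨_, x₁.then ((Exec.iconst _ _ _).then ((Exec.imul _ _ _ _).then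
      ((Exec.iconst _ _ _).then ((Exec.iadd _ _ _ _).then (Exec.iload _ _ _) rfl) rfl) rfl) rfl)
      (by simp [IExp.cost]), ?_, ?_, ?_⟩
    · have : e.eval s * 12 + (4 * a.num + 3) = adA a (e.eval s) := by unfold adA; ring
      have h := (t₁.rel hr).n a (e.eval s)
      simp [Mem.setN, v₁, this, h]
    · intro y hy
      simp [Mem.setN, hy k le_rfl, hy (k + 1) (by omega), t₁.N y hy]
    · simp [Mem.setN, t₁.S]
  | add e f he hf => exact bin .iadd (· + ·) e f _ (fun _ _ _ _ => Exec.iadd _ _ _ _) rfl he hf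
  | sub e f he hf => exact bin .isub (· - ·) e f _ (fun _ _ _ _ => Exec.isub _ _ _ _) rfl he hf
  | mul e f he hf => exact bin .imul (· * ·) e f _ (fun _ _ _ _ => Exec.imul _ _ _ _) rfl he hf

theorem scaleComp_exec (inp : Input) (a : SArr) (σ : Mem) :
    ∃ σ', Exec inp (scaleComp a) σ 4 σ' ∧ σ'.N (adT 0) = adS a (σ.N (adT 0)) ∧
      TempFrom 0 σ σ' := by
  refine ⟨_, (Exec.iconst _ _ _).then ((Exec.imul _ _ _ _).then
    ((Exec.iconst _ _ _).then (Exec.iadd _ _ _ _) rfl) rfl) rfl, ?_, ?_, rfl⟩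
  · simp [Mem.setN, adS, mul_comm]
  · intro y hy
    simp [Mem.setN, hy 0 le_rfl, hy 1 (by omega)]

/-- `σ'` differs from `σ` at most in the temporary natural numbers and in the temporary scalars
from `k` on. -/
structure STempFrom (k : ℕ) (σ σ' : Mem) : Prop where
  N : ∀ y, (∀ j, y ≠ adT j) → σ'.N y = σ.N y
  S : ∀ y, (∀ j, k ≤ j → y ≠ adU j) → σ'.S y = σ.S y

theorem STempFrom.rel {k : ℕ} {σ σ' : Mem} {s : St} (h : STempFrom k σ σ') (hr : Rel σ s) :
    Rel σ' s where
  v x := by rw [h.N _ (by simp), hr.v]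
  n a i := by rw [h.N _ (by simp), hr.n]
  s a i := by rw [h.S _ (by simp), hr.s]

/-- Here the scalar temporaries form the stack. The temporary natural numbers only hold addresses
for the next few instructions, so none of them has to survive. -/
theorem SExp.exec (inp : Input) (e : SExp) : ∀ (k : ℕ) {σ : Mem} {s : St}, Rel σ s →
    ∃ σ', Exec inp (e.comp k) σ e.cost σ' ∧ σ'.S (adU k) = e.eval inp s ∧ STempFrom k σ σ' := by
  have bin : ∀ (op : ℕ → ℕ → ℕ → Prog) (g : ℂ → ℂ → ℂ) (e f : SExp) (n : ℕ),
      (∀ x y z σ, Exec inp (op x y z) σ 1 (σ.setS x (g (σ.getS y) (σ.getS z)))) →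
      (n = e.cost + f.cost + 3) →
      (∀ (k : ℕ) {σ : Mem} {s : St}, Rel σ s →
        ∃ σ', Exec inp (e.comp k) σ e.cost σ' ∧ σ'.S (adU k) = e.eval inp s ∧
          STempFrom k σ σ') →
      (∀ (k : ℕ) {σ : Mem} {s : St}, Rel σ s →
        ∃ σ', Exec inp (f.comp k) σ f.cost σ' ∧ σ'.S (adU k) = f.eval inp s ∧
          STempFrom k σ σ') →
      ∀ (k : ℕ) {σ : Mem} {s : St}, Rel σ s →
        ∃ σ', Exec inp (binComp op (e.comp k) (f.comp (k + 1)) k) σ n σ' ∧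
          σ'.S (adU k) = g (e.eval inp s) (f.eval inp s) ∧ STempFrom k σ σ' := by
    intro op g e f n hop hn he hf k σ s hr
    obtain ⟨σ₁, x₁, v₁, t₁⟩ := he k hr
    obtain ⟨σ₂, x₂, v₂, t₂⟩ := hf (k + 1) (t₁.rel hr)
    refine ⟨_, x₁.then (x₂.then ((Exec.iconst _ _ _).then ((Exec.iconst _ _ _).then
      (hop _ _ _ _) rfl) rfl) rfl) (by omega), ?_, ?_, ?_⟩
    · have : σ₂.S (adU k) = e.eval inp s := by
        rw [t₂.S _ (fun j hj h => by simp at h; omega), v₁]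
      simp [Mem.setN, Mem.setS, Mem.getS, this, v₂]
    · intro y hy
      simp [Mem.setN, Mem.setS, hy, t₁.N y hy, t₂.N y hy]
    · intro y hy
      simp [Mem.setN, Mem.setS, hy k le_rfl, t₁.S y hy, t₂.S y (fun j hj => hy j (by omega))]
  induction e with
  | const z =>
    intro k σ s hr
    refine ⟨_, (Exec.iconst _ _ _).then (Exec.sconst _ _ _) rfl, ?_, ?_, ?_⟩
    · simp [Mem.setN, Mem.setS]
    · intro y hy; simp [Mem.setN, Mem.setS, hy]
    · intro y hy; simp [Mem.setN, Mem.setS, hy k le_rfl]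
  | load a e =>
    intro k σ s hr
    obtain ⟨σ₁, x₁, v₁, t₁⟩ := e.exec inp 0 hr
    obtain ⟨σ₂, x₂, v₂, t₂⟩ := scaleComp_exec inp a σ₁
    refine ⟨_, x₁.then (x₂.then ((Exec.iconst _ _ _).then ((Exec.sconst _ _ _).then
      (Exec.sadd _ _ _ _) rfl) rfl) rfl) (by simp [SExp.cost]), ?_, ?_, ?_⟩
    · simp [Mem.setN, Mem.setS, Mem.getS, v₂, v₁, t₂.S, t₁.S, hr.s]
    · intro y hy
      simp [Mem.setN, Mem.setS, hy, t₁.N y (fun j _ => hy j), t₂.N y (fun j _ => hy j)]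
    · intro y hy
      simp [Mem.setN, Mem.setS, hy k le_rfl, t₁.S, t₂.S]
  | input a e f =>
    intro k σ s hr
    obtain ⟨σ₁, x₁, v₁, t₁⟩ := e.exec inp 0 hr
    obtain ⟨σ₂, x₂, v₂, t₂⟩ := f.exec inp 1 (t₁.rel hr)
    have v₃ : σ₂.N (adT 0) = e.eval s := by
      rw [t₂.N _ (fun j hj h => by simp at h; omega), v₁]
    refine ⟨_, x₁.then (x₂.then ((Exec.iconst _ _ _).then (Exec.read _ _ _ _ _) rfl) rfl)
      (by simp [SExp.cost, add_assoc]), ?_, ?_, ?_⟩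
    · simp [Mem.setN, Mem.setS, v₂, v₃]
    · intro y hy
      simp [Mem.setN, Mem.setS, hy, t₁.N y (fun j _ => hy j), t₂.N y (fun j _ => hy j)]
    · intro y hy
      simp [Mem.setN, Mem.setS, hy k le_rfl, t₁.S, t₂.S]
  | add e f he hf => exact bin .sadd (· + ·) e f _ (fun _ _ _ _ => Exec.sadd _ _ _ _) rfl he hf
  | sub e f he hf => exact bin .ssub (· - ·) e f _ (fun _ _ _ _ => Exec.ssub _ _ _ _) rfl he hf
  | mul e f he hf => exact bin .smul (· * ·) e f _ (fun _ _ _ _ => Exec.smul _ _ _ _) rfl he hf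

/-- The code of a program simulates the program, in the predicted number of steps, and keeps the
counters of the enclosing loops. -/
theorem Stmt.exec (inp : Input) (P : Stmt) : ∀ (k : ℕ) {σ : Mem} {s : St}, Rel σ s →
    ∃ σ', Exec inp (P.comp k) σ (P.cost inp s) σ' ∧ Rel σ' (P.run inp s) ∧
      ∀ i < 2 * k, σ'.N (adH i) = σ.N (adH i) := by
  induction P with
  | skip => exact fun k σ s hr => ⟨σ, Exec.skip _, hr, fun _ _ => rfl⟩
  | assign x e =>
    intro k σ s hr
    obtain ⟨σ₁, x₁, v₁, t₁⟩ := e.exec inp 0 hr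
    have h₁ := t₁.rel hr
    refine ⟨_, x₁.then ((Exec.iconst _ _ _).then (Exec.iadd _ _ _ _) rfl) rfl, ⟨?_, ?_, ?_⟩, ?_⟩
    · intro y
      simp [Mem.setN, Stmt.run, v₁, Function.update_apply, h₁.v]
    · intro a i; simp [Mem.setN, Stmt.run, h₁.n]
    · intro a i; simp [Mem.setN, Stmt.run, h₁.s]
    · intro i _; simp [Mem.setN, t₁.N]
  | storeN a e f =>
    intro k σ s hr
    obtain ⟨σ₁, x₁, v₁, t₁⟩ := e.exec inp 0 hr
    have h₁ := t₁.rel hr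
    obtain ⟨σ₂, hσ₂, x₂, v₂, t₂⟩ : ∃ σ₂, TempFrom 0 σ₁ σ₂ ∧
        (∀ {Q n σ₃}, Exec inp Q σ₂ n σ₃ → Exec inp (.seq (.iconst (adT 1) 12) <|
          .seq (.imul (adT 0) (adT 0) (adT 1)) <| .seq (.iconst (adT 1) (4 * a.num + 3)) <|
          .seq (.iadd (adT 0) (adT 0) (adT 1)) Q) σ₁ (n + 4) σ₃) ∧
        σ₂.N (adT 0) = adA a (e.eval s) ∧ Rel σ₂ s := by
      have ht : TempFrom 0 σ₁ ((((σ₁.setN (adT 1) 12).setN (adT 0) (σ₁.N (adT 0) * 12)).setN (adT 1)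
          (4 * a.num + 3)).setN (adT 0) (σ₁.N (adT 0) * 12 + (4 * a.num + 3))) :=
        ⟨fun y hy => by simp [Mem.setN, hy 0 le_rfl, hy 1 (by omega)], rfl⟩
      refine ⟨_, ht, ?_, ?_, ht.rel h₁⟩
      · intro Q n σ₃ hQ
        refine (Exec.iconst _ _ _).then ((Exec.imul _ _ _ _).then ((Exec.iconst _ _ _).then
          (Exec.then (k := 1) ?_ hQ rfl) rfl) rfl) (by omega)
        have := Exec.iadd (inp := inp) (adT 0) (adT 0) (adT 1)
          (((σ₁.setN (adT 1) 12).setN (adT 0) (σ₁.N (adT 0) * 12)).setN (adT 1) (4 * a.num + 3))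
        simpa [Mem.setN] using this
      · simp [Mem.setN, v₁, adA, mul_comm]
    obtain ⟨σ₃, x₃, v₃, t₃⟩ := f.exec inp 1 t₂
    have h₃ := t₃.rel t₂
    have v₄ : σ₃.N (adT 0) = adA a (e.eval s) := by
      rw [t₃.N _ (fun j hj h => by simp at h; omega), v₂]
    refine ⟨_, x₁.then (x₂ (x₃.then (Exec.istore _ _ _) rfl)) (by simp [Stmt.cost]; ring),
      ⟨?_, ?_, ?_⟩, ?_⟩
    · intro y; simp [Mem.setN, Stmt.run, v₄, h₃.v]
    · intro b i
      simp [Mem.setN, Stmt.run, v₄, v₃, Function.update_apply, h₃.n]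
    · intro b i; simp [Mem.setN, Stmt.run, h₃.s]
    · intro i _
      simp [Mem.setN, v₄, t₁.N, hσ₂.N, t₃.N]
  | storeS a e f =>
    intro k σ s hr
    obtain ⟨σ₁, x₁, v₁, t₁⟩ := f.exec inp 0 hr
    obtain ⟨σ₂, x₂, v₂, t₂⟩ := e.exec inp 0 (t₁.rel hr)
    obtain ⟨σ₃, x₃, v₃, t₃⟩ := scaleComp_exec inp a σ₂
    have h₃ := t₃.rel (t₂.rel (t₁.rel hr))
    refine ⟨_, x₁.then (x₂.then (x₃.then ((Exec.iconst _ _ _).then ((Exec.sconst _ _ _).then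
      (Exec.sadd _ _ _ _) rfl) rfl) rfl) rfl) (by simp [Stmt.cost]; ring), ⟨?_, ?_, ?_⟩, ?_⟩
    · intro y; simp [Mem.setN, Mem.setS, Stmt.run, h₃.v]
    · intro b i; simp [Mem.setN, Mem.setS, Stmt.run, h₃.n]
    · intro b i
      simp [Mem.setN, Mem.setS, Mem.getS, Stmt.run, v₃, v₂, t₃.S, t₂.S, v₁,
        Function.update_apply]
      rw [t₁.S _ (by simp), hr.s]
    · intro i _
      simp [Mem.setN, Mem.setS, t₁.N, t₂.N, t₃.N]
  | seq P Q hP hQ =>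
    intro k σ s hr
    obtain ⟨σ₁, x₁, r₁, t₁⟩ := hP k hr
    obtain ⟨σ₂, x₂, r₂, t₂⟩ := hQ k r₁
    exact ⟨_, x₁.then x₂ rfl, r₂, fun i hi => by rw [t₂ i hi, t₁ i hi]⟩
  | ite e f P Q hP hQ =>
    intro k σ s hr
    obtain ⟨σ₁, x₁, v₁, t₁⟩ := e.exec inp 0 hr
    obtain ⟨σ₂, x₂, v₂, t₂⟩ := f.exec inp 1 (t₁.rel hr)
    have v₃ : σ₂.N (adT 0) = e.eval s := by
      rw [t₂.N _ (fun j hj h => by simp at h; omega), v₁]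
    have h₂ := t₂.rel (t₁.rel hr)
    by_cases h : e.eval s < f.eval s
    · obtain ⟨σ₃, x₃, r₃, t₃⟩ := hP k h₂
      refine ⟨σ₃, x₁.then (x₂.then (Exec.ite_true _ _ _ _ _ _ _ (by rwa [v₂, v₃]) x₃) rfl)
        (by simp [Stmt.cost, h]; ring), by simpa [Stmt.run, h] using r₃, fun i hi => ?_⟩
      rw [t₃ i hi, t₂.N _ (by simp), t₁.N _ (by simp)]
    · obtain ⟨σ₃, x₃, r₃, t₃⟩ := hQ k h₂
      refine ⟨σ₃, x₁.then (x₂.then (Exec.ite_false _ _ _ _ _ _ _ (by rwa [v₂, v₃]) x₃) rfl)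
        (by simp [Stmt.cost, h]; ring), by simpa [Stmt.run, h] using r₃, fun i hi => ?_⟩
      rw [t₃ i hi, t₂.N _ (by simp), t₁.N _ (by simp)]
  | for_ x e P hP =>
    intro k σ s hr
    obtain ⟨σ₁, x₁, v₁, t₁⟩ := e.exec inp 0 hr
    have h₁ := t₁.rel hr
    set n := e.eval s with hn
    set body : Prog := .seq (.iconst (adT 1) 0) <|
      .seq (.iadd (adV x) (adH (2 * k)) (adT 1)) <| .seq (P.comp (k + 1)) <|
      .seq (.iconst (adT 0) 1) (.iadd (adH (2 * k)) (adH (2 * k)) (adT 0)) with hbody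
    -- Induction on the number `l` of rounds that are left. The loop is controlled by the hidden
    -- cells 2k and 2k + 1; the register `x` is only a copy of the counter, so the body may
    -- overwrite it.
    have main : ∀ l i σ, i + l = n → Rel σ (St.iter (P.run inp) x s i) →
        σ.N (adH (2 * k)) = i → σ.N (adH (2 * k + 1)) = n →
        ∃ σ', Exec inp (.loop (adH (2 * k)) (adH (2 * k + 1)) body) σ
          (1 + ∑ j ∈ Finset.Ico i n, (P.cost inp ((St.iter (P.run inp) x s j).setV x j) + 5)) σ' ∧
          Rel σ' (St.iter (P.run inp) x s n) ∧ ∀ i < 2 * k, σ'.N (adH i) = σ.N (adH i) := by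
      intro l
      induction l with
      | zero =>
        intro i σ hi hσ hc hb
        obtain rfl : i = n := by omega
        refine ⟨σ, ?_, hσ, fun _ _ => rfl⟩
        simpa using Exec.loop_done (inp := inp) (adH (2 * k)) (adH (2 * k + 1)) body σ
          (by rw [hc, hb]; exact lt_irrefl _)
      | succ l ih =>
        intro i σ hi hσ hc hb
        have hrel : Rel ((σ.setN (adT 1) 0).setN (adV x) i)
            ((St.iter (P.run inp) x s i).setV x i) := by
          refine ⟨fun y => ?_, fun a j => ?_, fun a j => ?_⟩
          · simp [Mem.setN, Function.update_apply, hσ.v]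
          · simp [Mem.setN, hσ.n]
          · simp [Mem.setN, hσ.s]
        obtain ⟨σ₂, x₂, r₂, t₂⟩ := hP (k + 1) hrel
        have ht : ∀ j < 2 * k + 2, σ₂.N (adH j) = σ.N (adH j) := fun j hj => by
          rw [t₂ j (by omega)]; simp [Mem.setN]
        -- Two instructions copy the counter to `x` and two increment it; together with the loop
        -- test this is the overhead of 5 per round in `Stmt.cost`.
        have hex : Exec inp body σ
            (P.cost inp ((St.iter (P.run inp) x s i).setV x i) + 4)
            ((σ₂.setN (adT 0) 1).setN (adH (2 * k)) (i + 1)) := by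
          refine (Exec.iconst _ _ _).then (Exec.then (k := 1) ?_ (x₂.then
            ((Exec.iconst _ _ _).then (l := 1) ?_ rfl) rfl) rfl) (by omega)
          · have := Exec.iadd (inp := inp) (adV x) (adH (2 * k)) (adT 1) (σ.setN (adT 1) 0)
            simpa [Mem.setN, hc] using this
          · have := Exec.iadd (inp := inp) (adH (2 * k)) (adH (2 * k)) (adT 0)
              (σ₂.setN (adT 0) 1)
            simpa [Mem.setN, ht, hc] using this
        obtain ⟨σ₃, x₃, r₃, t₃⟩ := ih (i + 1) ((σ₂.setN (adT 0) 1).setN (adH (2 * k)) (i + 1))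
          (by omega)
          ⟨fun y => by simp [Mem.setN, r₂.v, St.iter], fun a j => by simp [Mem.setN, r₂.n, St.iter],
            fun a j => by simp [Mem.setN, r₂.s, St.iter]⟩
          (by simp [Mem.setN]) (by simp [Mem.setN, ht, hb])
        refine ⟨σ₃, ?_, r₃, fun j hj => ?_⟩
        · have := Exec.loop_step _ _ _ _ _ _ _ _ (by rw [hc, hb]; omega) hex x₃
          rw [Finset.sum_eq_sum_Ico_succ_bot (by omega : i < n)]
          convert this using 1
          ring
        · rw [t₃ j hj]
          have : j ≠ 2 * k := by omega
          simp [Mem.setN, this, ht j (by omega)]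
    obtain ⟨σ₃, x₃, r₃, t₃⟩ := main n 0
      (((σ₁.setN (adT 1) 0).setN (adH (2 * k + 1)) n).setN (adH (2 * k)) 0) (by omega)
      ⟨fun y => by simp [Mem.setN, h₁.v, St.iter], fun a j => by simp [Mem.setN, h₁.n, St.iter],
        fun a j => by simp [Mem.setN, h₁.s, St.iter]⟩ (by simp [Mem.setN]) (by simp [Mem.setN])
    refine ⟨σ₃, x₁.then ((Exec.iconst _ _ _).then (Exec.then (k := 1) ?_
      ((Exec.iconst _ _ _).then x₃ rfl) rfl) rfl) ?_, r₃, fun i hi => ?_⟩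
    · have := Exec.iadd (inp := inp) (adH (2 * k + 1)) (adT 0) (adT 1) (σ₁.setN (adT 1) 0)
      simpa [Mem.setN, v₁] using this
    · simp only [Stmt.cost, Finset.range_eq_Ico]
      ring
    · rw [t₃ i hi]
      have h1 : i ≠ 2 * k := by omega
      have h2 : i ≠ 2 * k + 1 := by omega
      simp [Mem.setN, h1, h2, t₁.N]

/-! ### Reasoning about programs -/

/-- Whether the program may write a register. -/
def Stmt.wv : Stmt → Reg → Bool
  | skip, _ => false
  | assign x _, y => decide (y = x)
  | storeN _ _ _, _ => false
  | storeS _ _ _, _ => false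
  | seq P Q, y => P.wv y || Q.wv y
  | ite _ _ P Q, y => P.wv y || Q.wv y
  | for_ x _ P, y => decide (y = x) || P.wv y

/-- Whether the program may write an array of natural numbers. -/
def Stmt.wn : Stmt → NArr → Bool
  | skip, _ => false
  | assign _ _, _ => false
  | storeN a _ _, y => decide (y = a)
  | storeS _ _ _, _ => false
  | seq P Q, y => P.wn y || Q.wn y
  | ite _ _ P Q, y => P.wn y || Q.wn y
  | for_ _ _ P, y => P.wn y

/-- Whether the program may write an array of scalars. -/
def Stmt.ws : Stmt → SArr → Bool
  | skip, _ => false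
  | assign _ _, _ => false
  | storeN _ _ _, _ => false
  | storeS a _ _, y => decide (y = a)
  | seq P Q, y => P.ws y || Q.ws y
  | ite _ _ P Q, y => P.ws y || Q.ws y
  | for_ _ _ P, y => P.ws y

/-- `s'` differs from `s` at most in the variables that `P` may write. -/
structure Stmt.Frame (P : Stmt) (s s' : St) : Prop where
  v : ∀ x, P.wv x = false → s'.v x = s.v x
  n : ∀ a, P.wn a = false → s'.n a = s.n a
  s : ∀ a, P.ws a = false → s'.s a = s.s a

theorem Stmt.Frame.refl (P : Stmt) (s : St) : P.Frame s s :=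
  ⟨fun _ _ => rfl, fun _ _ => rfl, fun _ _ => rfl⟩

theorem Stmt.Frame.trans {P : Stmt} {s₁ s₂ s₃ : St} (h : P.Frame s₁ s₂) (h' : P.Frame s₂ s₃) :
    P.Frame s₁ s₃ :=
  ⟨fun x hx => (h'.v x hx).trans (h.v x hx), fun x hx => (h'.n x hx).trans (h.n x hx),
    fun x hx => (h'.s x hx).trans (h.s x hx)⟩

theorem Stmt.frame (inp : Input) (P : Stmt) : ∀ s, P.Frame s (P.run inp s) := by
  induction P with
  | skip => exact fun s => Frame.refl _ _
  | assign x e =>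
    exact fun s => ⟨fun y hy => by simp [wv] at hy; simp [run, hy], fun _ _ => rfl, fun _ _ => rfl⟩
  | storeN a e f =>
    refine fun s => ⟨fun _ _ => rfl, fun y hy => ?_, fun _ _ => rfl⟩
    simp [wn] at hy; funext i; simp [run, hy]
  | storeS a e f =>
    refine fun s => ⟨fun _ _ => rfl, fun _ _ => rfl, fun y hy => ?_⟩
    simp [ws] at hy; funext i; simp [run, hy]
  | seq P Q hP hQ =>
    intro s
    have h1 := hP s
    have h2 := hQ (P.run inp s)
    refine ⟨fun y hy => ?_, fun y hy => ?_, fun y hy => ?_⟩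
    · simp [wv] at hy; rw [run, h2.v y hy.2, h1.v y hy.1]
    · simp [wn] at hy; rw [run, h2.n y hy.2, h1.n y hy.1]
    · simp [ws] at hy; rw [run, h2.s y hy.2, h1.s y hy.1]
  | ite e f P Q hP hQ =>
    intro s
    have h1 := hP s
    have h2 := hQ s
    refine ⟨fun y hy => ?_, fun y hy => ?_, fun y hy => ?_⟩
    · simp [wv] at hy; rw [run]; split_ifs; exacts [h1.v y hy.1, h2.v y hy.2]
    · simp [wn] at hy; rw [run]; split_ifs; exacts [h1.n y hy.1, h2.n y hy.2]
    · simp [ws] at hy; rw [run]; split_ifs; exacts [h1.s y hy.1, h2.s y hy.2]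
  | for_ x e P hP =>
    intro s
    rw [run]
    induction e.eval s with
    | zero => exact Frame.refl _ _
    | succ n ih =>
      refine ih.trans ?_
      have h := hP ((St.iter (P.run inp) x s n).setV x n)
      refine ⟨fun y hy => ?_, fun y hy => ?_, fun y hy => ?_⟩
      · simp [wv] at hy; rw [St.iter, h.v y hy.2]; simp [hy.1]
      · rw [St.iter, h.n y hy]; rfl
      · rw [St.iter, h.s y hy]; rfl

/-- The set of written variables does not depend on the bound of a loop, so `n` rounds can be
regarded as a complete loop with constant bound. -/
theorem Stmt.iter_frame (inp : Input) (x : Reg) (e : IExp) (P : Stmt) (s : St) (n : ℕ) :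
    (for_ x e P).Frame s (St.iter (P.run inp) x s n) := by
  have h := frame inp (for_ x (.const n) P) s
  exact ⟨h.v, h.n, h.s⟩

/-- The rule for loops: an invariant that may use that only the variables written by the loop have
changed. -/
theorem Stmt.iter_inv {inp : Input} {x : Reg} {e : IExp} {P : Stmt} {s : St}
    (I : ℕ → St → Prop) (n : ℕ) (h0 : I 0 s)
    (hs : ∀ i < n, ∀ s', (for_ x e P).Frame s s' → I i s' → I (i + 1) (P.run inp (s'.setV x i))) :
    ∀ k ≤ n, I k (St.iter (P.run inp) x s k) := by
  intro k
  induction k with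
  | zero => exact fun _ => h0
  | succ k ih => exact fun hk => hs k hk _ (iter_frame inp x e P s k) (ih (by omega))

theorem Stmt.run_for {inp : Input} {x : Reg} {e : IExp} {P : Stmt} {s : St} (I : ℕ → St → Prop)
    (n : ℕ) (hn : e.eval s = n) (h0 : I 0 s)
    (hs : ∀ i < n, ∀ s', (for_ x e P).Frame s s' → I i s' → I (i + 1) (P.run inp (s'.setV x i))) :
    I n ((for_ x e P).run inp s) := by
  rw [run, hn]
  exact iter_inv (e := e) I n h0 hs n le_rfl

theorem Stmt.cost_for_le_inv {inp : Input} {x : Reg} {e : IExp} {P : Stmt} {s : St}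
    (I : ℕ → St → Prop) (n : ℕ) (hn : e.eval s = n) (K : ℕ) (h0 : I 0 s)
    (hs : ∀ i < n, ∀ s', (for_ x e P).Frame s s' → I i s' → I (i + 1) (P.run inp (s'.setV x i)) ∧
      P.cost inp (s'.setV x i) ≤ K) :
    (for_ x e P).cost inp s ≤ e.cost + 4 + n * (K + 5) := by
  rw [cost, hn]
  have h1 := iter_inv (e := e) I n h0 (fun i hi s' hf h => (hs i hi s' hf h).1)
  gcongr
  refine (Finset.sum_le_card_nsmul _ _ (K + 5) fun i hi => ?_).trans (by simp)
  rw [Finset.mem_range] at hi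
  exact Nat.add_le_add_right (hs i hi _ (iter_frame inp x e P s i) (h1 i hi.le)).2 5

theorem Stmt.cost_for_le {inp : Input} {x : Reg} {e : IExp} {P : Stmt} {s : St}
    (n : ℕ) (hn : e.eval s = n) (K : ℕ)
    (hs : ∀ i < n, ∀ s', (for_ x e P).Frame s s' → P.cost inp (s'.setV x i) ≤ K) :
    (for_ x e P).cost inp s ≤ e.cost + 4 + n * (K + 5) :=
  cost_for_le_inv (fun _ _ => True) n hn K trivial fun i hi s' hf _ => ⟨trivial, hs i hi s' hf⟩

@[simp] theorem Stmt.run_skip (inp : Input) (s : St) : skip.run inp s = s := rfl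
@[simp] theorem Stmt.run_assign (inp : Input) (x : Reg) (e : IExp) (s : St) :
    (assign x e).run inp s = s.setV x (e.eval s) := rfl
@[simp] theorem Stmt.run_storeN (inp : Input) (a : NArr) (e f : IExp) (s : St) :
    (storeN a e f).run inp s = s.setN a (e.eval s) (f.eval s) := rfl
@[simp] theorem Stmt.run_storeS (inp : Input) (a : SArr) (e : IExp) (f : SExp) (s : St) :
    (storeS a e f).run inp s = s.setS a (e.eval s) (f.eval inp s) := rfl
@[simp] theorem Stmt.run_seq (inp : Input) (P Q : Stmt) (s : St) :
    (seq P Q).run inp s = Q.run inp (P.run inp s) := rfl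
theorem Stmt.run_ite (inp : Input) (e f : IExp) (P Q : Stmt) (s : St) :
    (ite e f P Q).run inp s = if e.eval s < f.eval s then P.run inp s else Q.run inp s := rfl

/-! ## The simulation program -/

namespace Sim

abbrev rm : IExp := .reg .m
abbrev rt : IExp := .reg .t
abbrev rc : IExp := .reg .c
abbrev rd : IExp := .reg .d
abbrev rN : IExp := .reg .N
abbrev rR : IExp := .reg .R
abbrev rell : IExp := .reg .ell
abbrev rb : IExp := .reg .b
abbrev rs : IExp := .reg .s
abbrev ra : IExp := .reg .a
abbrev rp : IExp := .reg .p
abbrev rr : IExp := .reg .r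
abbrev rh : IExp := .reg .h
abbrev rhi : IExp := .reg .hi
abbrev rw' : IExp := .reg .w
abbrev rj : IExp := .reg .j

open Stmt SExp

/-- `acc[0] := ∑_{r < h} A[p N + r] B[a N + r]`. -/
def dotProd (A : SArr) : Stmt :=
  seq (storeS .acc 0 (.const 0)) <|
    for_ .r rh (storeS .acc 0 (load .acc 0 + load A (rp * rN + rr) * load .B (ra * rN + rr)))

/-- `O[a x + p] := ∑_r A[p N + r] B[a N + r]` for `a < N²`, `p < x`, where `r < N` if `a < N`
and `r < hi` otherwise. -/
def contract (A O : SArr) (x : Reg) : Stmt :=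
  for_ .a (rN * rN) <| seq (ite ra rN (assign .h rN) (assign .h rhi)) <|
    for_ .p (.reg x) <| seq (dotProd A) (storeS O (ra * .reg x + rp) (load .acc 0))

/-- Copy the `N² x` first entries of `O` to `A`. -/
def copy (O A : SArr) (x : Reg) : Stmt :=
  for_ .p (rN * rN * .reg x) (storeS A rp (load O rp))

/-- The letterwise substitution of the identity. -/
def initB : Stmt :=
  for_ .a (rN * rN) <| for_ .r rN <|
    ite ((ra - rr) + (rr - ra)) 1 (storeS .B (ra * rN + rr) (.const 1))
      (storeS .B (ra * rN + rr) (.const 0))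

/-- Compose the substitution with a cubic phase gate. -/
def cubic : Stmt :=
  for_ .a rN <| for_ .p rN <|
    storeS .B ((ra * rN + rp) * rN + (rm + 1)) (load .B ((ra * rN + rp) * rN + (rm + 1)) +
      .const 6 * input 4 (rc - rb) rs * (load .B (ra * rN + 1) * load .B (rp * rN + 1)))

/-- The matrix of a displaced orthogonal gate. -/
def fillG : Stmt :=
  for_ .a rN <| for_ .r rN <|
    ite ra 1
      (ite rr 1 (storeS .G (ra * rN + rr) (.const 1)) (storeS .G (ra * rN + rr) (.const 0))) <|
    ite rr 1 (storeS .G (ra * rN + rr) (input 3 ((rc - rb) * (rt + 1) + rs) (ra - 1))) <|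
    ite ra (rm + 1)
      (ite rr (rm + 1) (storeS .G (ra * rN + rr)
          (input 2 ((rc - rb) * (rt + 1) + rs) ((ra - 1) * rm + (rr - 1))))
        (storeS .G (ra * rN + rr) (.const 0))) <|
    ite rr (rm + 1) (storeS .G (ra * rN + rr) (.const 0)) <|
      storeS .G (ra * rN + rr)
        (input 2 ((rc - rb) * (rt + 1) + rs) ((ra - 1 - rm) * rm + (rr - 1 - rm)))

/-- Compose the substitution with a rotation gate. -/
def rot : Stmt :=
  for_ .a (rN * rN) <| seq (storeS .acc 0 (load .B (ra * rN + 1))) <|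
    seq (storeS .acc 1 (load .B (ra * rN + (rm + 1)))) <|
    seq (storeS .B (ra * rN + 1) (input 5 (rc - rb + 1) 0 * load .acc 0 +
      input 5 (rc - rb + 1) 1 * load .acc 1)) <|
    storeS .B (ra * rN + (rm + 1)) (input 5 (rc - rb + 1) 0 * load .acc 1 -
      input 5 (rc - rb + 1) 1 * load .acc 0)

/-- Length and number of the word with index `w N + r`, and whether it is in standard form. -/
def entry : Stmt :=
  ite rr 1
    (seq (storeN .len (rw' * rN + rr) (.load .len rw')) <|
      seq (storeN .code (rw' * rN + rr) (.load .code rw')) <|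
      storeN .can (rw' * rN + rr) (1 - rw'))
    (seq (storeN .len (rw' * rN + rr) (.load .len rw' + 1)) <|
      seq (storeN .code (rw' * rN + rr) (.load .code rw' * (2 * rm) + (rr - 1))) <|
      storeN .can (rw' * rN + rr) (.load .can rw'))

/-- The empty word. -/
def initWords : Stmt :=
  seq (storeN .len 0 0) <| seq (storeN .code 0 0) (storeN .can 0 1)

/-- Load the coefficients of the polynomial. -/
def loadH : Stmt :=
  seq initWords <| for_ .w rR <| for_ .r rN <| seq entry <|
    ite 0 (.load .can (rw' * rN + rr))
      (storeS .T (rw' * rN + rr)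
        (input 0 (.load .len (rw' * rN + rr)) (.load .code (rw' * rN + rr))))
      (storeS .T (rw' * rN + rr) (.const 0))

/-- Pair the coefficients with the moments. -/
def readout : Stmt :=
  seq initWords <| seq (storeS .acc 0 (.const 0)) <| for_ .w rR <| for_ .r rN <| seq entry <|
    storeS .acc 0 (load .acc 0 + load .T (rw' * rN + rr) *
      input 1 (.load .len (rw' * rN + rr)) (.load .code (rw' * rN + rr)))

/-- Set up the alphabet size `N = 2 m + 1` and `R = N^(d - 1)`. -/
def powers : Stmt :=
  seq (assign .N (2 * rm + 1)) <| seq (assign .R 1) <| for_ .j (rd - 1) (assign .R (rR * rN))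

/-- Compose the substitution with the gates number `s` of a block. -/
def gateStep : Stmt :=
  seq (ite 0 rs cubic skip) <| seq fillG <| seq (contract .G .B' .N) (copy .B' .B .N)

/-- The substitution that describes a block and the rotation gate after it. -/
def blockSubst : Stmt :=
  seq initB <| seq (assign .hi rN) <| seq (for_ .s (rt + 1) gateStep) (ite 0 rb rot skip)

/-- Substitute for one letter of every word. -/
def letterStep : Stmt :=
  seq (ite ((rc - rb) + (rell - 1 - rj)) 1 (ite 0 rb (assign .hi 2) (assign .hi rN))
    (assign .hi rN)) <|
  seq (contract .T .T' .R) <| seq (copy .T' .T .R) (assign .R (rR * rN))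

/-- Substitute for all letters. -/
def block : Stmt :=
  seq blockSubst <| seq (for_ .j rell letterStep) (assign .ell (rell + rell))

/-- The algorithm. -/
def main : Stmt :=
  ite 0 rd
    (seq powers <| seq loadH <| seq (assign .ell rd) <| seq (for_ .b (rc + 1) block) readout)
    (storeS .acc 0 (input 0 0 0 * input 1 0 0))

/-! ### Effect of the parts of the program -/

theorem dotProd_acc (inp : Input) (A : SArr) (hA : A ≠ .acc) (s : St) :
    ((dotProd A).run inp s).s .acc 0 = ∑ r ∈ Finset.range (s.v .h),
      s.s A (s.v .p * s.v .N + r) * s.s .B (s.v .a * s.v .N + r) := by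
  unfold dotProd
  rw [run_seq]
  refine run_for (fun i s' => s'.s .acc 0 = ∑ r ∈ Finset.range i,
    s.s A (s.v .p * s.v .N + r) * s.s .B (s.v .a * s.v .N + r)) _ (by simp) (by simp) ?_
  intro i hi s' hf ih
  have h1 := hf.s A (by simp [ws, hA])
  have h2 := hf.s .B rfl
  have h3 := hf.v .p rfl
  have h4 := hf.v .a rfl
  have h5 := hf.v .N rfl
  simp only [run_storeS, St.setS_v] at h1 h2 h3 h4 h5
  rw [Finset.sum_range_succ, ← ih]
  simp [h1, h2, h3, h4, h5, hA]

/-- The entries of the result of a contraction. -/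
def contractVal (N R hi : ℕ) (A B : ℕ → ℂ) (i : ℕ) : ℂ :=
  ∑ r ∈ Finset.range (if i / R < N then N else hi), A (i % R * N + r) * B (i / R * N + r)

/-- The two loops fill `O` in increasing order of the flattened index. The invariant is that all
entries below the current index are final; the conditions on the arrays ensure that the operands are
not overwritten meanwhile. -/
theorem contract_run (inp : Input) (A O : SArr) (x : Reg) (hx : x = .N ∨ x = .R) (hA : A ≠ .acc)
    (hO : O ≠ .acc) (hAO : A ≠ O) (hB : O ≠ .B) (s : St) (i : ℕ)
    (hi : i < s.v .N * s.v .N * s.v x) :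
    ((contract A O x).run inp s).s O i
      = contractVal (s.v .N) (s.v x) (s.v .hi) (s.s A) (s.s .B) i := by
  unfold contract
  have hwx : ∀ y : Reg, y = .N ∨ y = .R ∨ y = .hi → (contract A O x).wv y = false := by
    rintro y (rfl | rfl | rfl) <;> rfl
  have hxa : x ≠ .a := by rcases hx with rfl | rfl <;> simp
  have hxh : x ≠ .h := by rcases hx with rfl | rfl <;> simp
  have hxp : x ≠ .p := by rcases hx with rfl | rfl <;> simp
  have hxr : x ≠ .r := by rcases hx with rfl | rfl <;> simp
  have hwx' : x = .N ∨ x = .R ∨ x = .hi := by tauto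
  refine run_for (fun k s' => ∀ i < k * s.v x, s'.s O i
    = contractVal (s.v .N) (s.v x) (s.v .hi) (s.s A) (s.s .B) i) _ (by simp) (by simp) ?_ i hi
  intro k hk s' hf ih
  rw [run_seq]
  set s₁ := (ite ra rN (assign .h rN) (assign .h rhi)).run inp (s'.setV .a k) with hs₁
  have hf₁ := frame inp (ite ra rN (assign .h rN) (assign .h rhi)) (s'.setV .a k)
  rw [← hs₁] at hf₁
  have eN : s'.v .N = s.v .N := hf.v _ (hwx _ (by simp))
  have ehi : s'.v .hi = s.v .hi := hf.v _ (hwx _ (by simp))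
  have ex : s'.v x = s.v x := hf.v _ (hwx _ hwx')
  have eA : s'.s A = s.s A := hf.s _ (by simp [ws, dotProd, hA, hAO])
  have eB : s'.s .B = s.s .B := hf.s _ (by simp [ws, dotProd, hB.symm])
  have eN₁ : s₁.v .N = s.v .N := (hf₁.v _ rfl).trans (by simp [eN])
  have ea₁ : s₁.v .a = k := (hf₁.v _ rfl).trans (by simp)
  have ex₁ : s₁.v x = s.v x := (hf₁.v _ (by simp [wv, hxh])).trans (by simp [hxa, ex])
  have eS₁ : s₁.s = s'.s := funext fun y => hf₁.s y rfl
  have eh₁ : s₁.v .h = if k < s.v .N then s.v .N else s.v .hi := by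
    simp only [hs₁, run_ite]
    simp only [IExp.eval_reg, St.setV_v, if_true, reduceCtorEq, if_false, run_assign, eN]
    split_ifs <;> simp [ehi]
  refine fun i hi => run_for (fun q s' => ∀ i < k * s.v x + q, s'.s O i
    = contractVal (s.v .N) (s.v x) (s.v .hi) (s.s A) (s.s .B) i) (s.v x) (by simp [ex₁])
    (by simpa [eS₁] using ih) ?_ i (by rw [add_one_mul] at hi; exact hi)
  intro q hq s₂ hf₂ ih₂ i hi
  rw [run_seq]
  have hf₃ := frame inp (dotProd A) (s₂.setV .p q)
  have hdot := dotProd_acc inp A hA (s₂.setV .p q)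
  set s₃ := (dotProd A).run inp (s₂.setV .p q) with hs₃
  have e1 : s₃.v .a = k := (hf₃.v _ rfl).trans ((hf₂.v _ rfl).trans ea₁)
  have e2 : s₃.v x = s.v x := (hf₃.v _ (by simp [dotProd, wv, hxr])).trans
    (by simpa [hxp] using (hf₂.v _ (by simp [dotProd, wv, hxr, hxp])).trans ex₁)
  have e3 : s₃.v .p = q := (hf₃.v _ rfl).trans (by simp)
  have e4 : s₃.s O = s₂.s O := hf₃.s _ (by simp [dotProd, ws, hO])
  have f1 : s₂.s A = s.s A := (hf₂.s _ (by simp [ws, dotProd, hA, hAO])).trans (by rw [eS₁, eA])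
  have f2 : s₂.s .B = s.s .B :=
    (hf₂.s _ (by simp [ws, dotProd, hB.symm])).trans (by rw [eS₁, eB])
  have f3 : s₂.v .N = s.v .N := (hf₂.v _ rfl).trans eN₁
  have f4 : s₂.v .h = s₁.v .h := hf₂.v _ rfl
  have f5 : s₂.v .a = k := (hf₂.v _ rfl).trans ea₁
  have hpos : 0 < s.v x := by omega
  by_cases hlt : i < k * s.v x + q
  · have hne : i ≠ k * s.v x + q := hlt.ne
    simp [e1, e2, e3, e4, hne, ih₂ i hlt]
  · obtain rfl : i = k * s.v x + q := by omega
    have d1 : (k * s.v x + q) / s.v x = k := by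
      rw [mul_comm, Nat.mul_add_div hpos, Nat.div_eq_of_lt hq, add_zero]
    have d2 : (k * s.v x + q) % s.v x = q := by
      rw [mul_comm, Nat.mul_add_mod, Nat.mod_eq_of_lt hq]
    simp [e1, e2, e3, hdot, f1, f2, f3, f4, f5, eh₁, contractVal, d1, d2]

theorem copy_run (inp : Input) (O A : SArr) (x : Reg) (hAO : O ≠ A) (s : St)
    (i : ℕ) (hi : i < s.v .N * s.v .N * s.v x) : ((copy O A x).run inp s).s A i = s.s O i := by
  unfold copy
  refine run_for (fun k s' => ∀ i < k, s'.s A i = s.s O i) _ (by simp) (by simp) ?_ i hi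
  intro k hk s' hf ih i hi
  have e1 : s'.s O = s.s O := hf.s _ (by simp [ws, hAO])
  by_cases h : i < k
  · simp [h.ne, ih i h]
  · obtain rfl : i = k := by omega
    simp [e1]

end Sim

/-- Two nested loops are treated as one loop over the flattened index i k + q. The last hypothesis
lets the invariant pass the assignment of the outer counter. -/
theorem Stmt.run_for_for {inp : Input} {x y : Reg} {e f : IExp} {P : Stmt} {s : St}
    (I : ℕ → St → Prop) (n k : ℕ) (hn : e.eval s = n)
    (hk : ∀ i s', (for_ x e (for_ y f P)).Frame s s' → f.eval (s'.setV x i) = k)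
    (hxy : x ≠ y) (hP : P.wv x = false) (h0 : I 0 s)
    (hs : ∀ i < n, ∀ q < k, ∀ s', (for_ x e (for_ y f P)).Frame s s' → s'.v x = i →
      I (i * k + q) s' → I (i * k + q + 1) (P.run inp (s'.setV y q)))
    (hV : ∀ i q s', I q s' → I q (s'.setV x i)) :
    I (n * k) ((for_ x e (for_ y f P)).run inp s) := by
  refine run_for (fun i => I (i * k)) n hn (by simpa using h0) fun i hi s' hf ih => ?_
  rw [add_one_mul]
  refine run_for (fun q => I (i * k + q)) k (hk i s' hf) (hV _ _ _ ih) fun q hq s'' hf' ih' => ?_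
  have hf'' : (for_ x e (for_ y f P)).Frame s s'' := by
    refine hf.trans ⟨fun z hz => ?_, fun z hz => hf'.n z hz, fun z hz => hf'.s z hz⟩
    simp only [wv, Bool.or_eq_false_iff] at hz
    rw [hf'.v z (by simp [wv, hz])]
    simp [of_decide_eq_false hz.1]
  refine hs i hi q hq s'' hf'' ?_ ih'
  rw [hf'.v x (by simp [wv, hxy, hP])]
  simp

theorem Stmt.cost_for_for_le {inp : Input} {x y : Reg} {e f : IExp} {P : Stmt} {s : St}
    (n k K : ℕ) (hn : e.eval s = n)
    (hk : ∀ i s', (for_ x e (for_ y f P)).Frame s s' → f.eval (s'.setV x i) = k)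
    (hs : ∀ s', P.cost inp s' ≤ K) :
    (for_ x e (for_ y f P)).cost inp s ≤ e.cost + 4 + n * (f.cost + 4 + k * (K + 5) + 5) :=
  cost_for_le n hn _ fun i _ s' hf => cost_for_le k (hk i s' hf) _ fun _ _ _ _ => hs _

namespace Sim

open Stmt SExp

theorem mul_add_div_mod {N q : ℕ} (k : ℕ) (hq : q < N) :
    (k * N + q) / N = k ∧ (k * N + q) % N = q := by
  constructor
  · rw [mul_comm, Nat.mul_add_div (by omega), Nat.div_eq_of_lt hq, add_zero]
  · rw [mul_comm, Nat.mul_add_mod, Nat.mod_eq_of_lt hq]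

theorem initB_run (inp : Input) (s : St) (i : ℕ) (hi : i < s.v .N * s.v .N * s.v .N) :
    (initB.run inp s).s .B i = if i / s.v .N = i % s.v .N then 1 else 0 := by
  refine run_for_for (fun k s' => ∀ i < k, s'.s .B i
    = if i / s.v .N = i % s.v .N then 1 else 0) _ (s.v .N) (by simp)
    (fun i s' hf => by simpa using hf.v .N rfl) (by simp) rfl (by simp) ?_ (by simp) i hi
  intro k _ q hq s' hf ha ih i hi
  have e1 : s'.v .N = s.v .N := hf.v .N rfl
  obtain ⟨d1, d2⟩ := mul_add_div_mod k hq
  rw [run_ite]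
  by_cases hkq : k = q
  · by_cases h : i < k * s.v .N + q
    · simp [ha, e1, hkq, ih i h, hkq ▸ h.ne]
    · obtain rfl : i = k * s.v .N + q := by omega
      simp [ha, e1, hkq, hkq ▸ d1, hkq ▸ d2]
  · rw [if_neg (by simp [ha]; omega)]
    by_cases h : i < k * s.v .N + q
    · simp [ha, e1, ih i h, h.ne]
    · obtain rfl : i = k * s.v .N + q := by omega
      simp [ha, e1, d1, d2, hkq]

/-- The entries of the substitution after a cubic phase gate. -/
def cubicVal (N m : ℕ) (γ : ℂ) (B : ℕ → ℂ) (i : ℕ) : ℂ :=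
  if i % N = m + 1 then B i + 6 * γ * (B (i / N / N * N + 1) * B (i / N % N * N + 1)) else B i

/-- The update in place is safe: it writes only column m + 1, while the quadratic term reads only
column 1, which is a different column because m > 0. Each entry of column m + 1 is read just before
it is overwritten. -/
theorem cubic_run (inp : Input) (s : St) (hm : 0 < s.v .m) (hN : s.v .m + 1 < s.v .N) (i : ℕ)
    (hi : i < s.v .N * s.v .N * s.v .N) :
    (cubic.run inp s).s .B i
      = cubicVal (s.v .N) (s.v .m) (inp 4 (s.v .c - s.v .b) (s.v .s)) (s.s .B) i := by
  have key := run_for_for (inp := inp) (s := s) (x := .a) (y := .p) (e := rN) (f := rN)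
    (P := storeS .B ((ra * rN + rp) * rN + (rm + 1)) (load .B ((ra * rN + rp) * rN + (rm + 1)) +
      .const 6 * input 4 (rc - rb) rs * (load .B (ra * rN + 1) * load .B (rp * rN + 1))))
    (fun k s' => ∀ i, s'.s .B i = if i / s.v .N < k then
      cubicVal (s.v .N) (s.v .m) (inp 4 (s.v .c - s.v .b) (s.v .s)) (s.s .B) i else s.s .B i)
    (s.v .N) (s.v .N) (by simp) (fun i s' hf => by simpa using hf.v .N rfl) (by simp) rfl
    (by simp) ?_ (by simp)
  · have := key i
    rw [if_pos] at this
    · exact this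
    · exact Nat.div_lt_of_lt_mul (by rwa [mul_comm])
  · intro k _ q hq s' hf ha ih i
    have e1 : s'.v .N = s.v .N := hf.v .N rfl
    have e2 : s'.v .m = s.v .m := hf.v .m rfl
    have e3 : s'.v .c = s.v .c := hf.v .c rfl
    have e4 : s'.v .b = s.v .b := hf.v .b rfl
    have e5 : s'.v .s = s.v .s := hf.v .s rfl
    obtain ⟨d1, d2⟩ := mul_add_div_mod (k * s.v .N + q) hN
    obtain ⟨d3, d4⟩ := mul_add_div_mod k hq
    have hrow : ∀ x, s'.s .B (x * s.v .N + 1) = s.s .B (x * s.v .N + 1) := by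
      intro x
      obtain ⟨_, d6⟩ := mul_add_div_mod x (show 1 < s.v .N by omega)
      have d7 : ¬ (x * s.v .N + 1) % s.v .N = s.v .m + 1 := by omega
      rw [ih, cubicVal, if_neg d7]
      split_ifs <;> rfl
    have hcur : s'.s .B ((k * s.v .N + q) * s.v .N + (s.v .m + 1))
        = s.s .B ((k * s.v .N + q) * s.v .N + (s.v .m + 1)) := by
      rw [ih, d1, if_neg (lt_irrefl _)]
    by_cases h : i = (k * s.v .N + q) * s.v .N + (s.v .m + 1)
    · subst h
      simp [ha, e1, e2, e3, e4, e5, d1, d2, d3, d4, hrow, hcur, cubicVal]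
    · have hset : (run inp (storeS .B ((ra * rN + rp) * rN + (rm + 1))
        (load .B ((ra * rN + rp) * rN + (rm + 1)) + .const 6 * input 4 (rc - rb) rs *
          (load .B (ra * rN + 1) * load .B (rp * rN + 1)))) (s'.setV .p q)).s .B i = s'.s .B i := by
        simp [ha, e1, e2, h]
      rw [hset, ih]
      by_cases h1 : i / s.v .N < k * s.v .N + q
      · rw [if_pos h1, if_pos (by omega)]
      · rw [if_neg h1]
        split_ifs with h2
        · have h3 : i / s.v .N = k * s.v .N + q := by omega
          have h4 : i % s.v .N ≠ s.v .m + 1 := by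
            intro h4
            apply h
            rw [← h3, ← h4, Nat.div_add_mod']
          rw [cubicVal, if_neg h4]
        · rfl

/-- The matrix of the displaced orthogonal gate number `g`: the letter `x` becomes
`∑_y gateEntry inp g m x y • y`. -/
def gateEntry (inp : Input) (g m x y : ℕ) : ℂ :=
  if x < 1 then if y < 1 then 1 else 0
  else if y < 1 then inp 3 g (x - 1)
  else if x < m + 1 then if y < m + 1 then inp 2 g ((x - 1) * m + (y - 1)) else 0
  else if y < m + 1 then 0 else inp 2 g ((x - 1 - m) * m + (y - 1 - m))

theorem fillG_run (inp : Input) (s : St) (i : ℕ) (hi : i < s.v .N * s.v .N) :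
    (fillG.run inp s).s .G i = gateEntry inp ((s.v .c - s.v .b) * (s.v .t + 1) + s.v .s) (s.v .m)
      (i / s.v .N) (i % s.v .N) := by
  refine run_for_for (fun k s' => ∀ i < k, s'.s .G i
    = gateEntry inp ((s.v .c - s.v .b) * (s.v .t + 1) + s.v .s) (s.v .m)
      (i / s.v .N) (i % s.v .N)) (s.v .N) (s.v .N) (by simp)
    (fun i s' hf => by simpa using hf.v .N rfl) (by simp) rfl (by simp) ?_ (by simp) i hi
  intro k _ q hq s' hf ha ih i hi
  have e1 : s'.v .N = s.v .N := hf.v .N rfl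
  have e2 : s'.v .m = s.v .m := hf.v .m rfl
  have e3 : s'.v .c = s.v .c := hf.v .c rfl
  have e4 : s'.v .b = s.v .b := hf.v .b rfl
  have e5 : s'.v .s = s.v .s := hf.v .s rfl
  have e6 : s'.v .t = s.v .t := hf.v .t rfl
  obtain ⟨d1, d2⟩ := mul_add_div_mod k hq
  simp only [run_ite, IExp.eval_reg, IExp.eval_one, IExp.eval_add, St.setV_v, ha, e2, reduceCtorEq,
    if_false, if_true]
  by_cases h : i < k * s.v .N + q
  · rw [← ih i h]
    split_ifs <;> simp [ha, e1, h.ne]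
  · obtain rfl : i = k * s.v .N + q := by omega
    rw [d1, d2, gateEntry]
    split_ifs <;> simp [ha, e1, e2, e3, e4, e5, e6]

/-- The entries of the substitution after a rotation gate. -/
def rotVal (N m : ℕ) (u v : ℂ) (B : ℕ → ℂ) (i : ℕ) : ℂ :=
  if i % N = 1 then u * B (i / N * N + 1) + v * B (i / N * N + (m + 1))
  else if i % N = m + 1 then u * B (i / N * N + (m + 1)) - v * B (i / N * N + 1) else B i

/-- Every row is rotated independently of the others. Both old entries of a row are saved in `acc`
before either is replaced. -/
theorem rot_run (inp : Input) (s : St) (hm : 0 < s.v .m) (hN : s.v .m + 1 < s.v .N) (i : ℕ)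
    (hi : i < s.v .N * s.v .N * s.v .N) :
    (rot.run inp s).s .B i = rotVal (s.v .N) (s.v .m) (inp 5 (s.v .c - s.v .b + 1) 0)
      (inp 5 (s.v .c - s.v .b + 1) 1) (s.s .B) i := by
  have key : ∀ i, (rot.run inp s).s .B i = if i / s.v .N < s.v .N * s.v .N then
      rotVal (s.v .N) (s.v .m) (inp 5 (s.v .c - s.v .b + 1) 0)
      (inp 5 (s.v .c - s.v .b + 1) 1) (s.s .B) i else s.s .B i := by
    refine run_for (fun k s' => ∀ i, s'.s .B i = if i / s.v .N < k then
      rotVal (s.v .N) (s.v .m) (inp 5 (s.v .c - s.v .b + 1) 0)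
      (inp 5 (s.v .c - s.v .b + 1) 1) (s.s .B) i else s.s .B i) _ (by simp) (by simp) ?_
    intro k _ s' hf ih i
    have e1 : s'.v .N = s.v .N := hf.v .N rfl
    have e2 : s'.v .m = s.v .m := hf.v .m rfl
    have e3 : s'.v .c = s.v .c := hf.v .c rfl
    have e4 : s'.v .b = s.v .b := hf.v .b rfl
    obtain ⟨d1, d2⟩ := mul_add_div_mod k hN
    obtain ⟨d3, d4⟩ := mul_add_div_mod k (show 1 < s.v .N by omega)
    have c1 : s'.s .B (k * s.v .N + 1) = s.s .B (k * s.v .N + 1) := by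
      rw [ih, d3, if_neg (lt_irrefl _)]
    have c2 : s'.s .B (k * s.v .N + (s.v .m + 1)) = s.s .B (k * s.v .N + (s.v .m + 1)) := by
      rw [ih, d1, if_neg (lt_irrefl _)]
    have hne : s.v .m ≠ 0 := hm.ne'
    by_cases h1 : i = k * s.v .N + (s.v .m + 1)
    · subst h1
      simp [e1, e2, e3, e4, d1, d2, c1, c2, rotVal, hne]
    by_cases h2 : i = k * s.v .N + 1
    · subst h2
      simp [e1, e2, e3, e4, d3, d4, c1, c2, rotVal, hne]
    have hu : ∀ i, i ≠ k * s.v .N + (s.v .m + 1) → i ≠ k * s.v .N + 1 →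
        (run inp (seq (storeS .acc 0 (load .B (ra * rN + 1))) <|
    seq (storeS .acc 1 (load .B (ra * rN + (rm + 1)))) <|
    seq (storeS .B (ra * rN + 1) (input 5 (rc - rb + 1) 0 * load .acc 0 +
      input 5 (rc - rb + 1) 1 * load .acc 1)) <|
    storeS .B (ra * rN + (rm + 1)) (input 5 (rc - rb + 1) 0 * load .acc 1 -
      input 5 (rc - rb + 1) 1 * load .acc 0)) (s'.setV .a k)).s .B i = s'.s .B i := by
      intro i h1 h2
      simp [e1, e2, h1, h2]
    rw [hu i h1 h2, ih]
    by_cases h3 : i / s.v .N < k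
    · rw [if_pos h3, if_pos (by omega)]
    · rw [if_neg h3]
      split_ifs with h4
      · have h5 : i / s.v .N = k := by omega
        have h6 : i % s.v .N ≠ s.v .m + 1 := by
          intro h6; apply h1; rw [← h5, ← h6, Nat.div_add_mod']
        have h7 : i % s.v .N ≠ 1 := by
          intro h6; apply h2; rw [← h5, ← h6, Nat.div_add_mod']
        rw [rotVal, if_neg h7, if_neg h6]
      · rfl
  rw [key i, if_pos]
  exact Nat.div_lt_of_lt_mul (by rwa [mul_comm])

/-- The length of the word with index `i`: its letters are the nonzero digits of `i`. -/
def wLen (N i : ℕ) : ℕ := (Nat.digits N i).foldr (fun r n => if r = 0 then n else n + 1) 0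

/-- The number of the word with index `i`. -/
def wCode (m N i : ℕ) : ℕ :=
  (Nat.digits N i).foldr (fun r n => if r = 0 then n else n * (2 * m) + (r - 1)) 0

/-- One if no digit of `i` vanishes, otherwise zero. -/
def wCan (N i : ℕ) : ℕ := (Nat.digits N i).foldr (fun r n => if r = 0 then 0 else n) 1

theorem digits_mul_add {N : ℕ} (hN : 1 < N) (w : ℕ) {r : ℕ} (hr : r < N) (h : w ≠ 0 ∨ r ≠ 0) :
    Nat.digits N (w * N + r) = r :: Nat.digits N w := by
  rw [add_comm, mul_comm]
  exact Nat.digits_add N hN r w hr h.symm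

/-- The tables of words are correct below `P`. -/
structure Words (N m P : ℕ) (s : St) : Prop where
  len : ∀ i < P, s.n .len i = wLen N i
  code : ∀ i < P, s.n .code i = wCode m N i
  can : ∀ i < P, s.n .can i = wCan N i

/-- The word with index w N + r is that of w followed by the letter r, and w is smaller than w N + r
unless both vanish. So the tables can be filled in increasing order. Index 0 refers to itself and
has to be initialized beforehand, which is the reason for `max 1`. -/
theorem entry_run (inp : Input) {N m : ℕ} (s : St) (hN : s.v .N = N) (hm : s.v .m = m)
    (hN2 : 1 < N) {w r : ℕ} (hw : s.v .w = w) (hr : s.v .r = r) (hrN : r < N)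
    (h : Words N m (max 1 (w * N + r)) s) : Words N m (w * N + r + 1) (entry.run inp s) := by
  by_cases h0 : w = 0 ∧ r = 0
  · obtain ⟨rfl, rfl⟩ := h0
    have h1 := h.len 0 (by simp)
    have h2 := h.code 0 (by simp)
    simp only [entry, run_ite]
    refine ⟨fun i hi => ?_, fun i hi => ?_, fun i hi => ?_⟩ <;>
    · obtain rfl : i = 0 := by omega
      simp [hN, hw, hr, h1, h2, wLen, wCode, wCan]
  · have hne : w ≠ 0 ∨ r ≠ 0 := by tauto
    have hwlt : w < max 1 (w * N + r) := by
      rcases Nat.eq_zero_or_pos w with rfl | h1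
      · simp
      · refine lt_max_of_lt_right ?_
        nlinarith
    have hd := digits_mul_add hN2 w hrN hne
    have h1 := h.len w hwlt
    have h2 := h.code w hwlt
    have h3 := h.can w hwlt
    simp only [entry, run_ite]
    refine ⟨fun i hi => ?_, fun i hi => ?_, fun i hi => ?_⟩ <;>
    · by_cases hlt : i < w * N + r
      · have e1 := h.len i (lt_max_of_lt_right hlt)
        have e2 := h.code i (lt_max_of_lt_right hlt)
        have e3 := h.can i (lt_max_of_lt_right hlt)
        split_ifs <;> simp [hN, hw, hr, hlt.ne, e1, e2, e3]
      · obtain rfl : i = w * N + r := by omega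
        have hself : w ≠ w * N + r := by
          intro h4
          have := h.len
          rcases Nat.eq_zero_or_pos w with rfl | h5
          · omega
          · nlinarith
        by_cases hr0 : r = 0
        · have hw0 : w ≠ 0 := by tauto
          have : 1 - w = 0 := by omega
          subst hr0
          rw [add_zero] at hd
          simp [hN, hw, hr, h1, h2, wLen, wCode, wCan, hd, this]
        · simp [hN, hw, hr, h1, h2, h3, wLen, wCode, wCan, hd, hr0, hm]

theorem initWords_run (inp : Input) (s : St) (N m : ℕ) : Words N m 1 (initWords.run inp s) := by
  refine ⟨fun i hi => ?_, fun i hi => ?_, fun i hi => ?_⟩ <;>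
  · obtain rfl : i = 0 := by omega
    simp [initWords, wLen, wCode, wCan]

/-- The coefficient array of the polynomial. -/
def coeffVal (inp : Input) (N m i : ℕ) : ℂ :=
  if 0 < wCan N i then inp 0 (wLen N i) (wCode m N i) else 0

theorem loadH_run (inp : Input) (s : St) (hN : 1 < s.v .N) (i : ℕ) (hi : i < s.v .R * s.v .N) :
    (loadH.run inp s).s .T i = coeffVal inp (s.v .N) (s.v .m) i := by
  have hf0 := frame inp initWords s
  have hw0 := initWords_run inp s (s.v .N) (s.v .m)
  rw [loadH, run_seq]
  set s₀ := initWords.run inp s with hs₀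
  have e1 : s₀.v .N = s.v .N := hf0.v .N rfl
  have e2 : s₀.v .m = s.v .m := hf0.v .m rfl
  have e3 : s₀.v .R = s.v .R := hf0.v .R rfl
  refine (run_for_for (fun k s' => Words (s.v .N) (s.v .m) (max 1 k) s' ∧
    ∀ i < k, s'.s .T i = coeffVal inp (s.v .N) (s.v .m) i) (s.v .R) (s.v .N) (by simp [e3])
    (fun i s' hf => by simpa [e1] using hf.v .N rfl) (by simp) rfl ⟨by simpa using hw0, by simp⟩ ?_
    (fun i q s' h => ⟨⟨h.1.len, h.1.code, h.1.can⟩, h.2⟩)).2 i hi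
  intro w _ r hr s' hf hw ⟨ih1, ih2⟩
  have g1 : s'.v .N = s.v .N := (hf.v .N rfl).trans e1
  have g2 : s'.v .m = s.v .m := (hf.v .m rfl).trans e2
  have hent := entry_run inp (N := s.v .N) (m := s.v .m) (s'.setV .r r) (by simpa using g1)
    (by simpa using g2) hN (w := w) (r := r) (by simpa using hw) (by simp) hr
    ⟨ih1.len, ih1.code, ih1.can⟩
  have hf1 := frame inp entry (s'.setV .r r)
  rw [run_seq]
  set s₁ := entry.run inp (s'.setV .r r) with hs₁
  have k1 : s₁.v .N = s.v .N := (hf1.v .N rfl).trans (by simpa using g1)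
  have k2 : s₁.v .w = w := (hf1.v .w rfl).trans (by simpa using hw)
  have k3 : s₁.v .r = r := (hf1.v .r rfl).trans (by simp)
  have k4 : s₁.s .T = s'.s .T := hf1.s .T rfl
  have hmax : max 1 (w * s.v .N + r + 1) = w * s.v .N + r + 1 := max_eq_right (by omega)
  rw [hmax, run_ite]
  refine ⟨?_, fun i hi => ?_⟩
  · split_ifs <;> exact ⟨hent.len, hent.code, hent.can⟩
  · have c1 := hent.len _ (Nat.lt_succ_self _)
    have c2 := hent.code _ (Nat.lt_succ_self _)
    have c3 := hent.can _ (Nat.lt_succ_self _)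
    by_cases hlt : i < w * s.v .N + r
    · rw [← ih2 i hlt]
      split_ifs <;> simp [k1, k2, k3, k4, hlt.ne]
    · obtain rfl : i = w * s.v .N + r := by omega
      simp only [IExp.eval_load, IExp.eval_add, IExp.eval_mul, IExp.eval_reg, IExp.eval_zero,
        k1, k2, k3, c3, coeffVal]
      split_ifs <;> simp [k1, k2, k3, c1, c2]

theorem readout_run (inp : Input) (s : St) (hN : 1 < s.v .N) :
    (readout.run inp s).s .acc 0 = ∑ i ∈ Finset.range (s.v .R * s.v .N),
      s.s .T i * inp 1 (wLen (s.v .N) i) (wCode (s.v .m) (s.v .N) i) := by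
  have hf0 := frame inp initWords s
  have hw0 := initWords_run inp s (s.v .N) (s.v .m)
  rw [readout, run_seq, run_seq]
  set s₀ := initWords.run inp s with hs₀
  have e1 : s₀.v .N = s.v .N := hf0.v .N rfl
  have e2 : s₀.v .m = s.v .m := hf0.v .m rfl
  have e3 : s₀.v .R = s.v .R := hf0.v .R rfl
  have e4 : s₀.s .T = s.s .T := hf0.s .T rfl
  refine (run_for_for (fun k s' => Words (s.v .N) (s.v .m) (max 1 k) s' ∧
    s'.s .acc 0 = ∑ i ∈ Finset.range k,
      s.s .T i * inp 1 (wLen (s.v .N) i) (wCode (s.v .m) (s.v .N) i)) (s.v .R) (s.v .N)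
    (by simp [e3]) (fun i s' hf => by simpa [e1] using hf.v .N rfl) (by simp) rfl
    ⟨by simpa using ⟨hw0.len, hw0.code, hw0.can⟩, by simp⟩ ?_
    (fun i q s' h => ⟨⟨h.1.len, h.1.code, h.1.can⟩, h.2⟩)).2
  intro w _ r hr s' hf hw ⟨ih1, ih2⟩
  have g1 : s'.v .N = s.v .N := (hf.v .N rfl).trans e1
  have g2 : s'.v .m = s.v .m := (hf.v .m rfl).trans e2
  have g3 : s'.s .T = s.s .T := (hf.s .T rfl).trans e4
  have hent := entry_run inp (N := s.v .N) (m := s.v .m) (s'.setV .r r) (by simpa using g1)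
    (by simpa using g2) hN (w := w) (r := r) (by simpa using hw) (by simp) hr
    ⟨ih1.len, ih1.code, ih1.can⟩
  have hf1 := frame inp entry (s'.setV .r r)
  rw [run_seq]
  set s₁ := entry.run inp (s'.setV .r r) with hs₁
  have k1 : s₁.v .N = s.v .N := (hf1.v .N rfl).trans (by simpa using g1)
  have k2 : s₁.v .w = w := (hf1.v .w rfl).trans (by simpa using hw)
  have k3 : s₁.v .r = r := (hf1.v .r rfl).trans (by simp)
  have k4 : s₁.s .T = s.s .T := (hf1.s .T rfl).trans g3
  have k5 : s₁.s .acc = s'.s .acc := hf1.s .acc rfl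
  have hmax : max 1 (w * s.v .N + r + 1) = w * s.v .N + r + 1 := max_eq_right (by omega)
  rw [hmax]
  refine ⟨⟨hent.len, hent.code, hent.can⟩, ?_⟩
  have c1 := hent.len _ (Nat.lt_succ_self _)
  have c2 := hent.code _ (Nat.lt_succ_self _)
  rw [Finset.sum_range_succ, ← ih2]
  simp [k1, k2, k3, k4, k5, c1, c2]

end Sim

/-! ## Tensors of coefficients -/

theorem sum_range_mul_eq {M : Type*} [AddCommMonoid M] (f : ℕ → M) (n k : ℕ) :
    ∑ i ∈ Finset.range (n * k), f i
      = ∑ a ∈ Finset.range n, ∑ b ∈ Finset.range k, f (a * k + b) := by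
  induction n with
  | zero => simp
  | succ n ih => rw [add_one_mul, Finset.sum_range_add, ih, Finset.sum_range_succ]

theorem mul_add_lt_mul {a n k P : ℕ} (ha : a < n) (hk : k < P) : a * P + k < n * P := by
  have := Nat.mul_le_mul_right P (Nat.succ_le_of_lt ha)
  rw [Nat.succ_mul] at this
  omega

section Tensor

variable {A : Type*} [Ring A] [Algebra ℂ A]

/-- The product of the `l` letters of `X` that are given by the digits of `i` in base `N`, the
leading digit coming first. -/
def wd (N : ℕ) (X : ℕ → A) : ℕ → ℕ → A
  | 0, _ => 1
  | l + 1, i => wd N X l (i / N) * X (i % N)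

omit [Algebra ℂ A] in
theorem wd_succ_mul_add {N : ℕ} (X : ℕ → A) (l k : ℕ) {r : ℕ} (hr : r < N) :
    wd N X (l + 1) (k * N + r) = wd N X l k * X r := by
  obtain ⟨h1, h2⟩ := Sim.mul_add_div_mod k hr
  rw [wd, h1, h2]

omit [Algebra ℂ A] in
theorem wd_add {N : ℕ} (X : ℕ → A) (p q u : ℕ) {w : ℕ} (hw : w < N ^ q) :
    wd N X (p + q) (u * N ^ q + w) = wd N X p u * wd N X q w := by
  induction q generalizing w with
  | zero =>
    obtain rfl : w = 0 := by simpa using hw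
    simp [wd]
  | succ q ih =>
    have hN : 0 < N := by
      rcases Nat.eq_zero_or_pos N with rfl | h
      · simp at hw
      · exact h
    have h1 : (u * N ^ (q + 1) + w) / N = u * N ^ q + w / N := by
      rw [pow_succ, ← mul_assoc, mul_comm _ N, Nat.mul_add_div hN]
    have h2 : (u * N ^ (q + 1) + w) % N = w % N := by
      rw [pow_succ, ← mul_assoc, mul_comm _ N, Nat.mul_add_mod]
    rw [← add_assoc, wd, h1, h2, ih (Nat.div_lt_of_lt_mul (by rwa [pow_succ'] at hw)), wd, mul_assoc]

omit [Algebra ℂ A] in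
theorem wd_two {N : ℕ} (X : ℕ → A) (x : ℕ) {y : ℕ} (hx : x < N) (hy : y < N) :
    wd N X 2 (x * N + y) = X x * X y := by
  rw [wd_succ_mul_add X 1 x hy, wd, wd, one_mul, Nat.mod_eq_of_lt hx]

/-- The value of a tensor whose first `p` indices are letters of `X` and whose last `l` indices
are letters of `Y`, the letters of `Y` coming first in every product. -/
def tensorVal (N : ℕ) (X Y : ℕ → A) (p l : ℕ) (T : ℕ → ℂ) : A :=
  ∑ u ∈ Finset.range (N ^ p), ∑ w ∈ Finset.range (N ^ l),
    T (u * N ^ l + w) • (wd N Y l w * wd N X p u)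

theorem tensorVal_zero_left (N : ℕ) (X Y : ℕ → A) (l : ℕ) (T : ℕ → ℂ) :
    tensorVal N X Y 0 l T = ∑ i ∈ Finset.range (N ^ l), T i • wd N Y l i := by
  simp [tensorVal, wd]

theorem tensorVal_zero_right (N : ℕ) (X Y : ℕ → A) (l : ℕ) (T : ℕ → ℂ) :
    tensorVal N X Y l 0 T = ∑ i ∈ Finset.range (N ^ l), T i • wd N X l i := by
  simp [tensorVal, wd]

open Sim in
/-- One step of the letterwise substitution. -/
theorem tensorVal_contract {N hi : ℕ} {X Y : ℕ → A} {p q : ℕ} {T T' B : ℕ → ℂ}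
    (hY : ∀ r < N, Y r = ∑ a ∈ Finset.range (N * N), B (a * N + r) • wd N X 2 a)
    (hhi : hi ≤ N)
    (hz : ∀ a, N ≤ a → a < N * N → ∀ r, hi ≤ r → r < N → ∀ k < N ^ p * N ^ q,
      T (k * N + r) * B (a * N + r) = 0)
    (hT : ∀ i < N * N * (N ^ p * N ^ q), T' i = contractVal N (N ^ p * N ^ q) hi T B i) :
    tensorVal N X Y (2 + p) q T' = tensorVal N X Y p (q + 1) T := by
  -- The truncated sum of the program may be replaced by the full sum over r < N, since `hz` makes
  -- the omitted terms vanish.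
  have hT' : ∀ a < N * N, ∀ u < N ^ p, ∀ w < N ^ q, T' ((a * N ^ p + u) * N ^ q + w)
      = ∑ r ∈ Finset.range N, T ((u * N ^ q + w) * N + r) * B (a * N + r) := by
    intro a ha u hu w hw
    have hk : u * N ^ q + w < N ^ p * N ^ q := mul_add_lt_mul hu hw
    have hi' : (a * N ^ p + u) * N ^ q + w = a * (N ^ p * N ^ q) + (u * N ^ q + w) := by ring
    obtain ⟨h1, h2⟩ := mul_add_div_mod a hk
    rw [hi', hT _ (mul_add_lt_mul ha hk), contractVal, h1, h2]
    split_ifs with h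
    · rfl
    · refine Finset.sum_subset (by simpa using hhi) fun r hr hr' => ?_
      simp only [Finset.mem_range, not_lt] at hr hr'
      exact hz a (by omega) ha r hr' hr _ hk
  have lhs : tensorVal N X Y (2 + p) q T' = ∑ a ∈ Finset.range (N * N),
      ∑ u ∈ Finset.range (N ^ p), ∑ w ∈ Finset.range (N ^ q), ∑ r ∈ Finset.range N,
        (T ((u * N ^ q + w) * N + r) * B (a * N + r)) •
          (wd N Y q w * (wd N X 2 a * wd N X p u)) := by
    rw [tensorVal, pow_add, pow_two, sum_range_mul_eq]
    refine Finset.sum_congr rfl fun a ha => Finset.sum_congr rfl fun u hu =>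
      Finset.sum_congr rfl fun w hw => ?_
    rw [Finset.mem_range] at ha hu hw
    rw [hT' a ha u hu w hw, wd_add X 2 p a hu, Finset.sum_smul]
  have rhs : tensorVal N X Y p (q + 1) T = ∑ u ∈ Finset.range (N ^ p),
      ∑ w ∈ Finset.range (N ^ q), ∑ r ∈ Finset.range N, ∑ a ∈ Finset.range (N * N),
        (T ((u * N ^ q + w) * N + r) * B (a * N + r)) •
          (wd N Y q w * (wd N X 2 a * wd N X p u)) := by
    rw [tensorVal]
    refine Finset.sum_congr rfl fun u _ => ?_
    rw [pow_succ, sum_range_mul_eq]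
    refine Finset.sum_congr rfl fun w _ => Finset.sum_congr rfl fun r hr => ?_
    rw [Finset.mem_range] at hr
    rw [wd_succ_mul_add Y q w hr, hY r hr, Finset.mul_sum, Finset.sum_mul, Finset.smul_sum]
    refine Finset.sum_congr rfl fun a _ => ?_
    rw [show u * (N ^ q * N) + (w * N + r) = (u * N ^ q + w) * N + r by ring, mul_smul_comm,
      smul_mul_assoc, smul_smul, mul_assoc]
  -- Both sides are now the same fourfold sum; only the place of the index `a` differs, and it is
  -- moved inwards past u, w and r.
  rw [lhs, rhs, Finset.sum_comm]
  refine Finset.sum_congr rfl fun u _ => ?_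
  rw [Finset.sum_comm]
  refine Finset.sum_congr rfl fun w _ => ?_
  rw [Finset.sum_comm]

end Tensor

/-! ## Letterwise substitutions -/

/-- The operator with a given letter: the identity for `0`, the quadrature number `r - 1` for
`1 ≤ r ≤ 2m`. -/
def letter (m r : ℕ) : Module.End ℂ (Wave m) :=
  if h : 1 ≤ r ∧ r - 1 < m then position ⟨r - 1, h.2⟩
  else if h : m + 1 ≤ r ∧ r - (m + 1) < m then momentum ⟨r - (m + 1), h.2⟩ else 1

theorem letter_zero (m : ℕ) : letter m 0 = 1 := by simp [letter]

theorem letter_position {m : ℕ} (i : Fin m) : letter m (i + 1) = position i := by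
  simp [letter]

theorem letter_momentum {m : ℕ} (i : Fin m) : letter m (m + 1 + i) = momentum i := by
  have h1 : ¬ (1 ≤ m + 1 + (i : ℕ) ∧ m + 1 + (i : ℕ) - 1 < m) := by omega
  have h2 : m + 1 ≤ m + 1 + (i : ℕ) ∧ m + 1 + (i : ℕ) - (m + 1) < m := by omega
  rw [letter, dif_neg h1, dif_pos h2]
  congr 1
  ext
  simp

theorem letter_one {m : ℕ} [NeZero m] : letter m 1 = position 0 := by
  simpa using letter_position (0 : Fin m)

theorem letter_succ {m : ℕ} [NeZero m] : letter m (m + 1) = momentum 0 := by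
  simpa using letter_momentum (0 : Fin m)

theorem letter_cases {m x : ℕ} (hx : x < 2 * m + 1) :
    x = 0 ∨ (∃ i : Fin m, x = i + 1) ∨ ∃ i : Fin m, x = m + 1 + i := by
  by_cases h0 : x = 0
  · exact Or.inl h0
  by_cases h : x < m + 1
  · exact Or.inr (Or.inl ⟨⟨x - 1, by omega⟩, by simp; omega⟩)
  · exact Or.inr (Or.inr ⟨⟨x - (m + 1), by omega⟩, by simp; omega⟩)

theorem sum_range_letters {M : Type*} [AddCommMonoid M] (m : ℕ) (f : ℕ → M) :
    ∑ y ∈ Finset.range (2 * m + 1), f y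
      = f 0 + (∑ i : Fin m, f (i + 1) + ∑ i : Fin m, f (m + 1 + i)) := by
  rw [Finset.sum_range_succ', add_comm, two_mul, Finset.sum_range_add, Finset.sum_range,
    Finset.sum_range]
  simp only [add_right_comm]

/-- The array `B` describes the Heisenberg evolution of the letters. -/
def IsSubst (m : ℕ) (V : Wave m ≃ₗ[ℂ] Wave m) (B : ℕ → ℂ) : Prop :=
  ∀ r < 2 * m + 1, heis V (letter m r) = ∑ a ∈ Finset.range ((2 * m + 1) * (2 * m + 1)),
    B (a * (2 * m + 1) + r) • wd (2 * m + 1) (letter m) 2 a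

/-- The first letter of every pair that occurs in `B` is not a momentum. -/
def FirstSupp (m : ℕ) (B : ℕ → ℂ) : Prop :=
  ∀ a < (2 * m + 1) * (2 * m + 1), (m + 1) * (2 * m + 1) ≤ a → ∀ r < 2 * m + 1,
    B (a * (2 * m + 1) + r) = 0

/-- The identity and the positions become linear combinations of the identity and the
positions. -/
def PosSupp (m : ℕ) (B : ℕ → ℂ) : Prop :=
  ∀ a < (2 * m + 1) * (2 * m + 1), m < a → ∀ r ≤ m, B (a * (2 * m + 1) + r) = 0

/-- A single letter r is encoded as the pair (0, r), whose index is r itself, so the identity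
substitution is the array with entry 1 exactly at a = r. -/
theorem IsSubst.init {m : ℕ} {B : ℕ → ℂ}
    (hB : ∀ i < (2 * m + 1) * (2 * m + 1) * (2 * m + 1),
      B i = if i / (2 * m + 1) = i % (2 * m + 1) then 1 else 0) :
    IsSubst m (LinearEquiv.refl ℂ _) B ∧ FirstSupp m B ∧ PosSupp m B := by
  have hB' : ∀ a < (2 * m + 1) * (2 * m + 1), ∀ r < 2 * m + 1,
      B (a * (2 * m + 1) + r) = if a = r then 1 else 0 := by
    intro a ha r hr
    obtain ⟨h1, h2⟩ := Sim.mul_add_div_mod a hr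
    rw [hB _ (by nlinarith), h1, h2]
  refine ⟨fun r hr => ?_, fun a ha h r hr => ?_, fun a ha h r hr => ?_⟩
  · rw [heis_refl, Finset.sum_eq_single r]
    · have := wd_two (letter m) 0 (show 0 < 2 * m + 1 by omega) hr
      rw [hB' r (by nlinarith) r hr, if_pos rfl, one_smul]
      simpa [letter_zero] using this.symm
    · intro a ha hne
      rw [hB' a (Finset.mem_range.1 ha) r hr, if_neg hne, zero_smul]
    · intro h
      exact absurd (Finset.mem_range.2 (by nlinarith)) h
  · rw [hB' a ha r hr, if_neg]
    nlinarith
  · rw [hB' a ha r (by omega), if_neg (by omega)]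

theorem heis_dispOrth_letter {m : ℕ} {inp : Input} {g : ℕ} {D : DispOrth m}
    (ho : ∀ j k : Fin m, inp 2 g (j * m + k) = ((D.entry j k : ℝ) : ℂ))
    (hq : ∀ j : Fin m, inp 3 g j = ((D.dq j : ℝ) : ℂ))
    (hp : ∀ j : Fin m, inp 3 g (m + j) = ((D.dp j : ℝ) : ℂ)) {x : ℕ} (hx : x < 2 * m + 1) :
    heis D.gate (letter m x)
      = ∑ y ∈ Finset.range (2 * m + 1), Sim.gateEntry inp g m x y • letter m y := by
  rw [sum_range_letters]
  rcases letter_cases hx with rfl | ⟨i, rfl⟩ | ⟨i, rfl⟩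
  · simp [letter_zero, Sim.gateEntry]
  · rw [letter_position, heis_dispOrth_position, add_comm]
    have h1 : ∀ j : ℕ, ¬ (m + 1 + j ≤ m) := fun j => by omega
    simp [h1, letter_zero, letter_position, Sim.gateEntry, ho, hq]
  · rw [letter_momentum, heis_dispOrth_momentum, add_comm]
    have h1 : ∀ j : ℕ, m + 1 + j - 1 = m + j := fun j => by omega
    have h2 : ¬ (m + 1 + (i : ℕ) < 1) := by omega
    have h3 : ∀ j : ℕ, m + j - m = j := fun j => by omega
    have h4 : ∀ j : ℕ, ¬ (m + 1 + j ≤ m) := fun j => by omega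
    simp [letter_zero, letter_momentum, Sim.gateEntry, ho, hp, h1, h3, h4]

/-- The new gate acts on the letters first, linearly, and its result is then evolved by `V`: the
columns of `B` are recombined with the matrix of the gate. Conditions on the rows survive any
recombination. For `PosSupp` the block form of the matrix is needed: the identity and the positions
involve no momentum. -/
theorem IsSubst.gate {m : ℕ} {V : Wave m ≃ₗ[ℂ] Wave m} {inp : Input} {g : ℕ} {D : DispOrth m}
    {B B' G : ℕ → ℂ}
    (ho : ∀ j k : Fin m, inp 2 g (j * m + k) = ((D.entry j k : ℝ) : ℂ))
    (hq : ∀ j : Fin m, inp 3 g j = ((D.dq j : ℝ) : ℂ))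
    (hp : ∀ j : Fin m, inp 3 g (m + j) = ((D.dp j : ℝ) : ℂ))
    (hG : ∀ i < (2 * m + 1) * (2 * m + 1),
      G i = Sim.gateEntry inp g m (i / (2 * m + 1)) (i % (2 * m + 1)))
    (hB' : ∀ i < (2 * m + 1) * (2 * m + 1) * (2 * m + 1),
      B' i = Sim.contractVal (2 * m + 1) (2 * m + 1) (2 * m + 1) G B i)
    (hB : IsSubst m V B ∧ FirstSupp m B ∧ PosSupp m B) :
    IsSubst m (V.trans D.gate) B' ∧ FirstSupp m B' ∧ PosSupp m B' := by
  obtain ⟨h1, h2, h3⟩ := hB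
  have key : ∀ a < (2 * m + 1) * (2 * m + 1), ∀ x < 2 * m + 1, B' (a * (2 * m + 1) + x)
      = ∑ r ∈ Finset.range (2 * m + 1),
        Sim.gateEntry inp g m x r * B (a * (2 * m + 1) + r) := by
    intro a ha x hx
    obtain ⟨d1, d2⟩ := Sim.mul_add_div_mod a hx
    rw [hB' _ (by nlinarith), Sim.contractVal, d1, d2, ite_self]
    refine Finset.sum_congr rfl fun r hr => ?_
    rw [Finset.mem_range] at hr
    obtain ⟨d3, d4⟩ := Sim.mul_add_div_mod x hr
    rw [hG _ (by nlinarith), d3, d4]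
  refine ⟨fun x hx => ?_, fun a ha h x hx => ?_, fun a ha h x hx => ?_⟩
  · rw [heis_trans, heis_dispOrth_letter ho hq hp hx, map_sum]
    have e : ∀ a ∈ Finset.range ((2 * m + 1) * (2 * m + 1)),
        B' (a * (2 * m + 1) + x) • wd (2 * m + 1) (letter m) 2 a
        = ∑ r ∈ Finset.range (2 * m + 1), Sim.gateEntry inp g m x r •
          B (a * (2 * m + 1) + r) • wd (2 * m + 1) (letter m) 2 a := by
      intro a ha
      rw [key a (Finset.mem_range.1 ha) x hx, Finset.sum_smul]
      simp only [mul_smul]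
    rw [Finset.sum_congr rfl e, Finset.sum_comm]
    refine Finset.sum_congr rfl fun r hr => ?_
    rw [map_smul, h1 r (Finset.mem_range.1 hr), Finset.smul_sum]
  · rw [key a ha x hx]
    refine Finset.sum_eq_zero fun r hr => ?_
    rw [h2 a ha h r (Finset.mem_range.1 hr), mul_zero]
  · rw [key a ha x (by omega)]
    refine Finset.sum_eq_zero fun r hr => ?_
    by_cases hr' : r ≤ m
    · rw [h3 a ha h r hr', mul_zero]
    · have : Sim.gateEntry inp g m x r = 0 := by
        have c1 : ¬ r < 1 := by omega
        have c2 : ¬ r < m + 1 := by omega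
        simp only [Sim.gateEntry, c1, c2, if_false, show x < m + 1 by omega, if_true]
        split_ifs <;> rfl
      rw [this, zero_mul]

/-- Only the column of p₁ changes; it gains 6γ times the square of the evolved q₁. By `PosSupp` the
evolved q₁ is affine in the positions, so its square is again a combination of pairs, with no
momentum in either place. This is why the degree does not grow with the number of cubic gates in a
block. -/
theorem IsSubst.cubic {m : ℕ} [NeZero m] {V : Wave m ≃ₗ[ℂ] Wave m} {γ : ℝ} {B B' : ℕ → ℂ}
    (hB' : ∀ i < (2 * m + 1) * (2 * m + 1) * (2 * m + 1),
      B' i = Sim.cubicVal (2 * m + 1) m (γ : ℂ) B i)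
    (hB : IsSubst m V B ∧ FirstSupp m B ∧ PosSupp m B) :
    IsSubst m (V.trans (cubicGate γ)) B' ∧ FirstSupp m B' ∧ PosSupp m B' := by
  obtain ⟨h1, h2, h3⟩ := hB
  have hm : 0 < m := Nat.pos_of_ne_zero (NeZero.ne m)
  have key : ∀ x < 2 * m + 1, ∀ y < 2 * m + 1, ∀ r < 2 * m + 1,
      B' ((x * (2 * m + 1) + y) * (2 * m + 1) + r) = B ((x * (2 * m + 1) + y) * (2 * m + 1) + r)
        + if r = m + 1 then 6 * γ * (B (x * (2 * m + 1) + 1) * B (y * (2 * m + 1) + 1)) else 0 := by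
    intro x hx y hy r hr
    obtain ⟨d1, d2⟩ := Sim.mul_add_div_mod (x * (2 * m + 1) + y) hr
    obtain ⟨d3, d4⟩ := Sim.mul_add_div_mod x hy
    have : x * (2 * m + 1) + y < (2 * m + 1) * (2 * m + 1) := by nlinarith
    rw [hB' _ (by nlinarith), Sim.cubicVal, d1, d2, d3, d4]
    split_ifs <;> simp
  -- By `PosSupp` only rows a ≤ m contribute to column 1, and such a row is the pair (0, a), that
  -- is, a single letter.
  have hpos : heis V (position 0)
      = ∑ y ∈ Finset.range (2 * m + 1), B (y * (2 * m + 1) + 1) • letter m y := by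
    rw [← letter_one, h1 1 (by omega)]
    symm
    have hsub : Finset.range (2 * m + 1) ⊆ Finset.range ((2 * m + 1) * (2 * m + 1)) := by
      intro y hy
      rw [Finset.mem_range] at hy ⊢
      nlinarith
    rw [← Finset.sum_subset hsub]
    · refine Finset.sum_congr rfl fun y hy => ?_
      have := wd_two (letter m) 0 (show 0 < 2 * m + 1 by omega) (Finset.mem_range.1 hy)
      rw [zero_mul, zero_add, letter_zero, one_mul] at this
      rw [this]
    · intro a ha ha'
      rw [Finset.mem_range] at ha ha'
      rw [h3 a ha (by omega) 1 (by omega), zero_smul]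
  have hquad : heis V (position 0 * position 0)
      = ∑ a ∈ Finset.range ((2 * m + 1) * (2 * m + 1)),
        (B (a / (2 * m + 1) * (2 * m + 1) + 1) * B (a % (2 * m + 1) * (2 * m + 1) + 1)) •
          wd (2 * m + 1) (letter m) 2 a := by
    rw [map_mul, hpos, sum_range_mul_eq, Finset.sum_mul_sum]
    refine Finset.sum_congr rfl fun x hx => Finset.sum_congr rfl fun y hy => ?_
    rw [Finset.mem_range] at hx hy
    obtain ⟨d3, d4⟩ := Sim.mul_add_div_mod x hy
    rw [wd_two _ x hx hy, d3, d4, smul_mul_smul_comm]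
  refine ⟨fun r hr => ?_, fun a ha h r hr => ?_, fun a ha h r hr => ?_⟩
  · have e1 : heis (cubicGate γ) (letter m r)
        = letter m r + (if r = m + 1 then (6 * γ : ℂ) else 0) • (position 0 * position 0) := by
      rcases letter_cases hr with rfl | ⟨i, rfl⟩ | ⟨i, rfl⟩
      · simp [letter_zero]
      · have : ¬ (i : ℕ) = m := by omega
        simp [letter_position, heis_cubicGate_position, this]
      · have : m + 1 + (i : ℕ) = m + 1 ↔ i = 0 := by
          rw [← Fin.val_eq_zero_iff]; omega
        simp only [letter_momentum, heis_cubicGate_momentum, this]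
    have e2 : ∀ a ∈ Finset.range ((2 * m + 1) * (2 * m + 1)), B' (a * (2 * m + 1) + r)
        = B (a * (2 * m + 1) + r) + (if r = m + 1 then (6 * γ : ℂ) else 0) *
          (B (a / (2 * m + 1) * (2 * m + 1) + 1) * B (a % (2 * m + 1) * (2 * m + 1) + 1)) := by
      intro a ha
      rw [Finset.mem_range] at ha
      have := key (a / (2 * m + 1)) (Nat.div_lt_of_lt_mul ha) (a % (2 * m + 1))
        (Nat.mod_lt _ (by omega)) r hr
      rw [Nat.div_add_mod'] at this
      rw [this]
      split_ifs <;> simp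
    rw [heis_trans, e1, map_add, map_smul, h1 r hr, hquad, Finset.smul_sum,
      ← Finset.sum_add_distrib]
    refine Finset.sum_congr rfl fun a ha => ?_
    rw [e2 a ha]
    simp only [add_smul, mul_smul]
  · have := key (a / (2 * m + 1)) (Nat.div_lt_of_lt_mul ha) (a % (2 * m + 1))
      (Nat.mod_lt _ (by omega)) r hr
    have hx : m < a / (2 * m + 1) :=
      (Nat.le_div_iff_mul_le (by omega)).2 (by simpa using h)
    have hx2 : a / (2 * m + 1) < 2 * m + 1 := Nat.div_lt_of_lt_mul ha
    rw [Nat.div_add_mod', h2 a ha h r hr,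
      h3 (a / (2 * m + 1)) (by nlinarith) hx 1 (by omega)] at this
    simpa using this
  · have := key (a / (2 * m + 1)) (Nat.div_lt_of_lt_mul ha) (a % (2 * m + 1))
      (Nat.mod_lt _ (by omega)) r (by omega)
    rw [Nat.div_add_mod', h3 a ha h r hr, if_neg (by omega), add_zero] at this
    exact this

/-- Among the identity and the positions, only the first position becomes a polynomial of degree
more than one. -/
def LinSupp (m : ℕ) (B : ℕ → ℂ) : Prop :=
  ∀ a < (2 * m + 1) * (2 * m + 1), 2 * m + 1 ≤ a → ∀ r ≤ m, r ≠ 1 → B (a * (2 * m + 1) + r) = 0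

/-- The rotation mixes columns 1 and m + 1 only. Column 1 may inherit the quadratic terms of p₁,
whereas the other columns r ≤ m are untouched; so `PosSupp` weakens to `LinSupp`, and `FirstSupp`, a
condition on rows, is kept. -/
theorem IsSubst.rotation {m : ℕ} [NeZero m] {V : Wave m ≃ₗ[ℂ] Wave m} {θ : ℝ} {B B' : ℕ → ℂ}
    (hB' : ∀ i < (2 * m + 1) * (2 * m + 1) * (2 * m + 1),
      B' i = Sim.rotVal (2 * m + 1) m (Real.cos θ : ℂ) (Real.sin θ : ℂ) B i)
    (hB : IsSubst m V B ∧ FirstSupp m B ∧ PosSupp m B) :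
    IsSubst m (V.trans (rotationGate θ)) B' ∧ FirstSupp m B' ∧ LinSupp m B' := by
  obtain ⟨h1, h2, h3⟩ := hB
  have hm : 0 < m := Nat.pos_of_ne_zero (NeZero.ne m)
  obtain ⟨r1, r2, r3⟩ := heis_rotationGate (m := m) θ
  have key : ∀ a < (2 * m + 1) * (2 * m + 1), ∀ r < 2 * m + 1, B' (a * (2 * m + 1) + r)
      = if r = 1 then (Real.cos θ : ℂ) * B (a * (2 * m + 1) + 1)
          + (Real.sin θ : ℂ) * B (a * (2 * m + 1) + (m + 1))
        else if r = m + 1 then (Real.cos θ : ℂ) * B (a * (2 * m + 1) + (m + 1))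
          - (Real.sin θ : ℂ) * B (a * (2 * m + 1) + 1)
        else B (a * (2 * m + 1) + r) := by
    intro a ha r hr
    obtain ⟨d1, d2⟩ := Sim.mul_add_div_mod a hr
    rw [hB' _ (by nlinarith), Sim.rotVal, d1, d2]
  refine ⟨fun r hr => ?_, fun a ha h r hr => ?_, fun a ha h r hr hne => ?_⟩
  · rw [Finset.sum_congr rfl fun a ha => by rw [key a (Finset.mem_range.1 ha) r hr], heis_trans]
    by_cases c1 : r = 1
    · subst c1
      simp only [if_true]
      rw [letter_one, r1, ← letter_one, ← letter_succ, map_add, map_smul, map_smul,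
        h1 1 hr, h1 (m + 1) (by omega), Finset.smul_sum, Finset.smul_sum,
        ← Finset.sum_add_distrib]
      refine Finset.sum_congr rfl fun a _ => ?_
      rw [add_smul, mul_smul, mul_smul]
    by_cases c2 : r = m + 1
    · subst c2
      simp only [c1, if_true, if_false]
      rw [letter_succ, r2, ← letter_one, ← letter_succ, map_add, map_smul, map_smul,
        h1 1 (by omega), h1 (m + 1) (by omega), Finset.smul_sum, Finset.smul_sum,
        ← Finset.sum_add_distrib]
      refine Finset.sum_congr rfl fun a _ => ?_
      rw [sub_smul, mul_smul, mul_smul, neg_smul, add_comm, sub_eq_add_neg]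
    · simp only [c1, c2, if_false]
      rw [← h1 r hr]
      congr 1
      rcases letter_cases hr with rfl | ⟨i, rfl⟩ | ⟨i, rfl⟩
      · simp [letter_zero]
      · rw [letter_position]
        refine (r3 i fun h => c1 ?_).1
        simp [h]
      · rw [letter_momentum]
        refine (r3 i fun h => c2 ?_).2
        simp [h]
  · rw [key a ha r hr, h2 a ha h r hr, h2 a ha h 1 (by omega), h2 a ha h (m + 1) (by omega)]
    simp
  · rw [key a ha r (by omega), if_neg hne, if_neg (by omega), h3 a ha (by omega) r hr]

theorem PosSupp.linSupp {m : ℕ} {B : ℕ → ℂ} (h : PosSupp m B) : LinSupp m B :=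
  fun a ha hle r hr _ => h a ha (by omega) r hr

/-! ## Words and indices -/

namespace Sim

/-- The number 0 has an empty list of digits, so leading zeros are invisible. The recursion holds
without exception only if the digit 0 fixes the initial value, which is `h0`. -/
theorem digits_foldr_mul_add {α : Type*} (f : ℕ → α → α) (z : α) {N : ℕ} (hN : 1 < N) (w : ℕ)
    {r : ℕ} (hr : r < N) (h0 : f 0 z = z) :
    (Nat.digits N (w * N + r)).foldr f z = f r ((Nat.digits N w).foldr f z) := by
  by_cases h : w ≠ 0 ∨ r ≠ 0
  · rw [digits_mul_add hN w hr h, List.foldr_cons]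
  · obtain ⟨rfl, rfl⟩ : w = 0 ∧ r = 0 := by tauto
    simp [h0]

/-- The quadratures that are denoted by a letter. -/
def letterQuads (m r : ℕ) : List (Quad m) :=
  if h : 1 ≤ r ∧ r - 1 < m then [Sum.inl ⟨r - 1, h.2⟩]
  else if h : m + 1 ≤ r ∧ r - (m + 1) < m then [Sum.inr ⟨r - (m + 1), h.2⟩] else []

theorem letterQuads_zero (m : ℕ) : letterQuads m 0 = [] := by simp [letterQuads]

theorem letterQuads_position {m : ℕ} (i : Fin m) : letterQuads m (i + 1) = [Sum.inl i] := by
  simp [letterQuads]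

theorem letterQuads_momentum {m : ℕ} (i : Fin m) : letterQuads m (m + 1 + i) = [Sum.inr i] := by
  have h1 : ¬ (1 ≤ m + 1 + (i : ℕ) ∧ m + 1 + (i : ℕ) - 1 < m) := by omega
  have h2 : m + 1 ≤ m + 1 + (i : ℕ) ∧ m + 1 + (i : ℕ) - (m + 1) < m := by omega
  rw [letterQuads, dif_neg h1, dif_pos h2]
  simp

/-- The word with index `i`. -/
def wQuads (m i : ℕ) : List (Quad m) :=
  (Nat.digits (2 * m + 1) i).foldr (fun r l => l ++ letterQuads m r) []

theorem wQuads_mul_add {m : ℕ} (hm : 0 < m) (w : ℕ) {r : ℕ} (hr : r < 2 * m + 1) :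
    wQuads m (w * (2 * m + 1) + r) = wQuads m w ++ letterQuads m r :=
  digits_foldr_mul_add _ _ (by omega) w hr (by simp [letterQuads_zero])

theorem wLen_mul_add {N : ℕ} (hN : 1 < N) (w : ℕ) {r : ℕ} (hr : r < N) :
    wLen N (w * N + r) = if r = 0 then wLen N w else wLen N w + 1 :=
  digits_foldr_mul_add _ _ hN w hr (by simp)

theorem wCode_mul_add (m : ℕ) {N : ℕ} (hN : 1 < N) (w : ℕ) {r : ℕ} (hr : r < N) :
    wCode m N (w * N + r) = if r = 0 then wCode m N w else wCode m N w * (2 * m) + (r - 1) :=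
  digits_foldr_mul_add _ _ hN w hr (by simp)

/-- The digit 0 does not fix the initial value 1 of this fold, so the index 0, the empty word, is a
separate case: it is in standard form, although a zero appended to any other index destroys the
standard form. -/
theorem wCan_mul_add {N : ℕ} (hN : 1 < N) (w : ℕ) {r : ℕ} (hr : r < N) :
    wCan N (w * N + r)
      = if r = 0 then (if w = 0 then 1 else 0) else wCan N w := by
  by_cases h : w ≠ 0 ∨ r ≠ 0
  · rw [wCan, digits_mul_add hN w hr h, List.foldr_cons]
    by_cases hr0 : r = 0
    · have : w ≠ 0 := by tauto
      simp [hr0, this]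
    · simp [hr0, wCan]
  · obtain ⟨rfl, rfl⟩ : w = 0 ∧ r = 0 := by tauto
    simp [wCan]

theorem wordCode_append_singleton {m : ℕ} (l : List (Quad m)) (q : Quad m) :
    wordCode (l ++ [q]) = wordCode l * (2 * m) + quadCode q := by
  induction l with
  | nil => simp [wordCode]
  | cons r l ih =>
    simp only [List.cons_append, wordCode, ih, List.length_append, List.length_singleton]
    ring

theorem wordOp_append {m : ℕ} (l l' : List (Quad m)) :
    wordOp (l ++ l') = wordOp l * wordOp l' := by
  simp [wordOp]

/-- The index of a word determines the word, its length, its number and its operator. -/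
theorem wQuads_spec {m : ℕ} (hm : 0 < m) (l : ℕ) : ∀ i < (2 * m + 1) ^ l,
    (wQuads m i).length = wLen (2 * m + 1) i ∧ wordCode (wQuads m i) = wCode m (2 * m + 1) i ∧
      wordOp (wQuads m i) = wd (2 * m + 1) (letter m) l i ∧ (wQuads m i).length ≤ l := by
  have hN : 1 < 2 * m + 1 := by omega
  induction l with
  | zero =>
    intro i hi
    obtain rfl : i = 0 := by simpa using hi
    simp [wQuads, wLen, wCode, wordCode, wordOp, wd]
  | succ l ih =>
    intro i hi
    obtain ⟨w, r, hr, rfl⟩ : ∃ w r, r < 2 * m + 1 ∧ i = w * (2 * m + 1) + r :=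
      ⟨i / (2 * m + 1), i % (2 * m + 1), Nat.mod_lt _ (by omega), (Nat.div_add_mod' _ _).symm⟩
    have hw : w < (2 * m + 1) ^ l := by
      have := Nat.div_lt_of_lt_mul (by rwa [pow_succ'] at hi)
      rwa [(mul_add_div_mod w hr).1] at this
    obtain ⟨h1, h2, h3, h4⟩ := ih w hw
    rw [wd_succ_mul_add _ l w hr, wQuads_mul_add hm w hr, wLen_mul_add hN w hr,
      wCode_mul_add m hN w hr, wordOp_append, h3]
    rcases letter_cases hr with rfl | ⟨i, rfl⟩ | ⟨i, rfl⟩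
    · simp only [letterQuads_zero, List.append_nil, letter_zero, if_true]
      exact ⟨h1, h2, by simp [wordOp], by omega⟩
    · simp [letterQuads_position, letter_position, wordCode_append_singleton, h2, wordOp,
        quadrature, quadCode, h4, ← h1]
    · have e1 : m + 1 + (i : ℕ) - 1 = m + i := by omega
      simp [letterQuads_momentum, letter_momentum, wordCode_append_singleton, h2, wordOp,
        quadrature, quadCode, h4, ← h1, e1]

/-- A word of length at most l is spelled by many indices, with identity letters inserted anywhere,
but by exactly one whose only zeros are leading ones. Restricting to these counts every word once.
In the induction the last digit is split off: if it is zero, only the empty word remains; otherwise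
it extends a word in standard form by one quadrature. -/
theorem sum_words {M : Type*} [AddCommMonoid M] {m : ℕ} (hm : 0 < m) (l : ℕ) :
    ∀ F : List (Quad m) → M, ∑ i ∈ Finset.range ((2 * m + 1) ^ l),
      (if 0 < wCan (2 * m + 1) i then F (wQuads m i) else 0)
      = ∑ k ∈ Finset.range (l + 1), ∑ v : Fin k → Quad m, F (List.ofFn v) := by
  have hN : 1 < 2 * m + 1 := by omega
  induction l with
  | zero => intro F; simp [wCan, wQuads]
  | succ l ih =>
    intro F
    have e : ∀ w, ∑ r ∈ Finset.range (2 * m + 1),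
        (if 0 < wCan (2 * m + 1) (w * (2 * m + 1) + r) then
          F (wQuads m (w * (2 * m + 1) + r)) else 0)
        = (if w = 0 then F [] else 0) + if 0 < wCan (2 * m + 1) w then
          ∑ q, F (wQuads m w ++ [q]) else 0 := by
      intro w
      have hp : ∀ i : Fin m, (if 0 < wCan (2 * m + 1) (w * (2 * m + 1) + (i + 1)) then
          F (wQuads m (w * (2 * m + 1) + (i + 1))) else 0)
          = if 0 < wCan (2 * m + 1) w then F (wQuads m w ++ [Sum.inl i]) else 0 := by
        intro i
        rw [wCan_mul_add hN w (by omega), wQuads_mul_add hm w (by omega), letterQuads_position,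
          if_neg (show ¬ (i : ℕ) + 1 = 0 by omega)]
      have hq : ∀ i : Fin m, (if 0 < wCan (2 * m + 1) (w * (2 * m + 1) + (m + 1 + i)) then
          F (wQuads m (w * (2 * m + 1) + (m + 1 + i))) else 0)
          = if 0 < wCan (2 * m + 1) w then F (wQuads m w ++ [Sum.inr i]) else 0 := by
        intro i
        rw [wCan_mul_add hN w (by omega), wQuads_mul_add hm w (by omega), letterQuads_momentum,
          if_neg (show ¬ m + 1 + (i : ℕ) = 0 by omega)]
      rw [sum_range_letters, Fintype.sum_sum_type]
      congr 1
      · rw [wCan_mul_add hN w (by omega), wQuads_mul_add hm w (by omega), letterQuads_zero]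
        by_cases hw : w = 0
        · simp [hw, wQuads]
        · simp [hw]
      · simp only [hp, hq]
        split_ifs <;> simp
    rw [pow_succ, sum_range_mul_eq]
    simp only [e]
    rw [Finset.sum_add_distrib, ih fun u => ∑ q, F (u ++ [q]), Finset.sum_ite_eq', if_pos (by simp),
      Finset.sum_range_succ' _ (l + 1), add_comm]
    congr 1
    · refine Finset.sum_congr rfl fun k _ => ?_
      rw [← (Fin.snocEquiv fun _ : Fin (k + 1) => Quad m).sum_comp, Fintype.sum_prod_type_right]
      refine Finset.sum_congr rfl fun v _ => Finset.sum_congr rfl fun q _ => ?_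
      rw [List.ofFn_succ_last]
      simp [Fin.snocEquiv]
    · simp

theorem sum_coeffVal {m : ℕ} (hm : 0 < m) {inp : Input} {h : List (Quad m) → ℂ} {d : ℕ}
    (hc : ∀ w : List (Quad m), w.length ≤ d → inp 0 w.length (wordCode w) = h w) :
    ∑ i ∈ Finset.range ((2 * m + 1) ^ d),
      coeffVal inp (2 * m + 1) m i • wd (2 * m + 1) (letter m) d i = polyOp d h := by
  rw [polyOp, ← sum_words hm d fun w => h w • wordOp w]
  refine Finset.sum_congr rfl fun i hi => ?_
  obtain ⟨h1, h2, h3, h4⟩ := wQuads_spec hm d i (Finset.mem_range.1 hi)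
  rw [coeffVal, ← h1, ← h2, ← h3, hc _ h4, ite_smul, zero_smul]

theorem wd_map {m : ℕ} (V : Wave m ≃ₗ[ℂ] Wave m) (N : ℕ) (l : ℕ) : ∀ i,
    heis V (wd N (letter m) l i) = wd N (fun r => heis V (letter m r)) l i := by
  induction l with
  | zero => intro i; simp [wd]
  | succ l ih => intro i; rw [wd, wd, map_mul, ih]

end Sim

/-! ## Correctness of the program -/

theorem Stmt.run_ite_pos {inp : Input} {e f : IExp} {P Q : Stmt} {s : St}
    (h : e.eval s < f.eval s) : (ite e f P Q).run inp s = P.run inp s := if_pos h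

theorem Stmt.run_ite_neg {inp : Input} {e f : IExp} {P Q : Stmt} {s : St}
    (h : ¬ e.eval s < f.eval s) : (ite e f P Q).run inp s = Q.run inp s := if_neg h

namespace Sim

open Stmt SExp

/-! ### The substitution of one block and its effect on the tensor. -/

theorem contract_copy_run (inp : Input) (A O D : SArr) (x : Reg) (hx : x = .N ∨ x = .R)
    (hA : A ≠ .acc) (hO : O ≠ .acc) (hAO : A ≠ O) (hB : O ≠ .B) (hOD : O ≠ D) (s : St) (i : ℕ)
    (hi : i < s.v .N * s.v .N * s.v x) :
    ((copy O D x).run inp ((contract A O x).run inp s)).s D i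
      = contractVal (s.v .N) (s.v x) (s.v .hi) (s.s A) (s.s .B) i := by
  have hf := frame inp (contract A O x) s
  have hN : ((contract A O x).run inp s).v .N = s.v .N := hf.v .N rfl
  have hx' : ((contract A O x).run inp s).v x = s.v x :=
    hf.v x (by rcases hx with rfl | rfl <;> rfl)
  rw [copy_run inp O D x hOD _ i (by rwa [hN, hx']), contract_run inp A O x hx hA hO hAO hB s i hi]

theorem gateStep_run {m : ℕ} [NeZero m] (inp : Input) {V : Wave m ≃ₗ[ℂ] Wave m} {g : DispOrth m}
    {γ : ℝ} (s : St) {i : ℕ} (hm : s.v .m = m) (hN : s.v .N = 2 * m + 1) (hhi : s.v .hi = 2 * m + 1)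
    (hi : i = (s.v .c - s.v .b) * (s.v .t + 1) + s.v .s)
    (hγ : 0 < s.v .s → inp 4 (s.v .c - s.v .b) (s.v .s) = (γ : ℂ))
    (ho : ∀ j k : Fin m, inp 2 i (j * m + k) = ((g.entry j k : ℝ) : ℂ))
    (hq : ∀ j : Fin m, inp 3 i j = ((g.dq j : ℝ) : ℂ))
    (hp : ∀ j : Fin m, inp 3 i (m + j) = ((g.dp j : ℝ) : ℂ))
    (hB : IsSubst m V (s.s .B) ∧ FirstSupp m (s.s .B) ∧ PosSupp m (s.s .B)) :
    let s' := gateStep.run inp s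
    IsSubst m ((if 0 < s.v .s then V.trans (cubicGate γ) else V).trans g.gate) (s'.s .B) ∧
      FirstSupp m (s'.s .B) ∧ PosSupp m (s'.s .B) := by
  have hm0 : 0 < m := Nat.pos_of_ne_zero (NeZero.ne m)
  have hf1 := frame inp (ite 0 rs cubic skip) s
  have hB1 : IsSubst m (if 0 < s.v .s then V.trans (cubicGate γ) else V)
        (((ite 0 rs cubic skip).run inp s).s .B) ∧
      FirstSupp m (((ite 0 rs cubic skip).run inp s).s .B) ∧
      PosSupp m (((ite 0 rs cubic skip).run inp s).s .B) := by
    by_cases h : 0 < s.v .s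
    · rw [run_ite_pos (show IExp.eval s 0 < rs.eval s from h), if_pos h]
      refine IsSubst.cubic (fun i hi => ?_) hB
      have := cubic_run inp s (by omega) (by omega) i (by rwa [hN])
      rw [this, hN, hm, hγ h]
    · rw [run_ite_neg (show ¬ IExp.eval s 0 < rs.eval s from h), if_neg h]
      exact hB
  intro s'
  rw [show s' = (copy .B' .B .N).run inp ((contract .G .B' .N).run inp
    (fillG.run inp ((ite 0 rs cubic skip).run inp s))) from rfl]
  set s₁ := (ite 0 rs cubic skip).run inp s with hs₁
  have hf2 := frame inp fillG s₁
  have hG := fillG_run inp s₁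
  set s₂ := fillG.run inp s₁ with hs₂
  have n1 : s₁.v .N = 2 * m + 1 := (hf1.v .N rfl).trans hN
  have n2 : s₁.v .m = m := (hf1.v .m rfl).trans hm
  have n3 : s₁.v .c = s.v .c := hf1.v .c rfl
  have n4 : s₁.v .b = s.v .b := hf1.v .b rfl
  have n5 : s₁.v .t = s.v .t := hf1.v .t rfl
  have n6 : s₁.v .s = s.v .s := hf1.v .s rfl
  have k1 : s₂.v .N = 2 * m + 1 := (hf2.v .N rfl).trans n1
  have k2 : s₂.v .hi = 2 * m + 1 := (hf2.v .hi rfl).trans ((hf1.v .hi rfl).trans hhi)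
  have k3 : s₂.s .B = s₁.s .B := hf2.s .B rfl
  have hcc := contract_copy_run inp .G .B' .B .N (Or.inl rfl) (by simp) (by simp) (by simp)
    (by simp) (by simp) s₂
  rw [k1, k2, k3] at hcc
  refine IsSubst.gate ho hq hp (G := s₂.s .G) (fun i' hi' => ?_) hcc hB1
  rw [hG i' (by rwa [n1]), n1, n2, n3, n4, n5, n6, hi]

theorem blockSubst_run {m t c d : ℕ} [NeZero m] {inp : Input} {h : List (Quad m) → ℂ}
    {ρ : Module.End ℂ (Wave m)} {D : Circuit m} (hD : Describes t c d inp h ρ D) (s : St)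
    (hm : s.v .m = m) (hN : s.v .N = 2 * m + 1) (ht : s.v .t = t) (hc : s.v .c = c)
    (hb : s.v .b ≤ c) :
    let s' := blockSubst.run inp s
    IsSubst m ((blockOp (D.gate (c - s.v .b)) (D.cubicity (c - s.v .b)) t).trans
        (if 0 < s.v .b then rotationGate (D.angle (c - s.v .b + 1)) else LinearEquiv.refl ℂ _))
        (s'.s .B) ∧
      FirstSupp m (s'.s .B) ∧ LinSupp m (s'.s .B) := by
  have hm0 : 0 < m := Nat.pos_of_ne_zero (NeZero.ne m)
  intro s'
  rw [show s' = (ite 0 rb rot skip).run inp ((for_ .s (rt + 1) gateStep).run inp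
    ((initB.run inp s).setV .hi ((initB.run inp s).v .N))) from rfl]
  have hf0 := frame inp initB s
  have hinit := initB_run inp s
  set s₁ := (initB.run inp s).setV .hi ((initB.run inp s).v .N) with hs₁
  have n1 : s₁.v .N = 2 * m + 1 := (hf0.v .N rfl).trans hN
  have n2 : s₁.v .m = m := (hf0.v .m rfl).trans hm
  have n3 : s₁.v .c = c := (hf0.v .c rfl).trans hc
  have n4 : s₁.v .b = s.v .b := hf0.v .b rfl
  have n5 : s₁.v .t = t := (hf0.v .t rfl).trans ht
  have n6 : s₁.v .hi = 2 * m + 1 := (hf0.v .N rfl).trans hN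
  have hB₁ : IsSubst m (LinearEquiv.refl ℂ _) (s₁.s .B) ∧ FirstSupp m (s₁.s .B) ∧
      PosSupp m (s₁.s .B) :=
    IsSubst.init fun i hi => by rw [← hN] at hi ⊢; exact hinit i hi
  have hf2 := frame inp (for_ .s (rt + 1) gateStep) s₁
  have hloop : IsSubst m (blockOp (D.gate (c - s.v .b)) (D.cubicity (c - s.v .b)) t)
        (((for_ .s (rt + 1) gateStep).run inp s₁).s .B) ∧
      FirstSupp m (((for_ .s (rt + 1) gateStep).run inp s₁).s .B) ∧
      PosSupp m (((for_ .s (rt + 1) gateStep).run inp s₁).s .B) := by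
    -- Round k applies the gate number k, preceded by a cubic phase gate if k > 0. Hence k completed
    -- rounds give the block with k - 1 cubic gates, and the identity for k = 0.
    refine run_for (fun k s' => IsSubst m (match k with
        | 0 => LinearEquiv.refl ℂ _
        | k + 1 => blockOp (D.gate (c - s.v .b)) (D.cubicity (c - s.v .b)) k) (s'.s .B) ∧
      FirstSupp m (s'.s .B) ∧ PosSupp m (s'.s .B)) (t + 1) (by simp [n5]) hB₁ ?_
    intro k hk s' hf ih
    have e1 : s'.v .N = 2 * m + 1 := (hf.v .N rfl).trans n1
    have e2 : s'.v .m = m := (hf.v .m rfl).trans n2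
    have e3 : s'.v .c = c := (hf.v .c rfl).trans n3
    have e4 : s'.v .b = s.v .b := (hf.v .b rfl).trans n4
    have e5 : s'.v .t = t := (hf.v .t rfl).trans n5
    have e6 : s'.v .hi = 2 * m + 1 := (hf.v .hi rfl).trans n6
    have hle : c - s.v .b ≤ c := Nat.sub_le _ _
    have key := gateStep_run (m := m) inp (g := D.gate (c - s.v .b) k)
      (γ := D.cubicity (c - s.v .b) k) (s'.setV .s k) (i := (c - s.v .b) * (t + 1) + k)
      (by simpa using e2) (by simpa using e1) (by simpa using e6) (by simp [e3, e4, e5])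
      (fun h0 => by
        have h0' : 1 ≤ k := Nat.succ_le_of_lt (by simpa using h0)
        simpa [e3, e4] using hD.cubic _ hle k h0' (by omega))
      (hD.orth _ hle k (by omega)) (hD.dispq _ hle k (by omega)) (hD.dispp _ hle k (by omega)) ih
    cases k with
    | zero => simpa [blockOp] using key
    | succ k => simpa [blockOp] using key
  set s₂ := (for_ .s (rt + 1) gateStep).run inp s₁ with hs₂
  have k1 : s₂.v .N = 2 * m + 1 := (hf2.v .N rfl).trans n1
  have k2 : s₂.v .m = m := (hf2.v .m rfl).trans n2
  have k3 : s₂.v .c = c := (hf2.v .c rfl).trans n3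
  have k4 : s₂.v .b = s.v .b := (hf2.v .b rfl).trans n4
  rw [run_ite]
  simp only [IExp.eval_zero, IExp.eval_reg, k4]
  split_ifs with h0
  · refine IsSubst.rotation (fun i hi => ?_) hloop
    have := rot_run inp s₂ (by omega) (by omega) i (by rwa [k1])
    rw [this, k1, k2, k3, k4, hD.rotCos _ (by omega) (by omega), hD.rotSin _ (by omega) (by omega)]
  · exact ⟨hloop.1, hloop.2.1, hloop.2.2.linSupp⟩

/-- Within the loops b ≤ c and j < ell, and then the sum of truncated differences vanishes only for
the last letter of the last round. The condition 0 < b excludes c = 0, where no earlier round has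
cleared the leading index of momenta. -/
theorem hi_run (inp : Input) (s : St) :
    ((ite ((rc - rb) + (rell - 1 - rj)) 1 (ite 0 rb (assign .hi 2) (assign .hi rN))
      (assign .hi rN)).run inp s).v .hi
      = if s.v .c - s.v .b + (s.v .ell - 1 - s.v .j) < 1 ∧ 0 < s.v .b then 2 else s.v .N := by
  by_cases h1 : s.v .c - s.v .b + (s.v .ell - 1 - s.v .j) < 1
  · rw [run_ite_pos (show IExp.eval s ((rc - rb) + (rell - 1 - rj)) < IExp.eval s 1 from h1)]
    by_cases h2 : 0 < s.v .b
    · rw [if_pos ⟨h1, h2⟩, run_ite_pos (show IExp.eval s 0 < rb.eval s from h2)]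
      simp
    · rw [if_neg fun h => h2 h.2, run_ite_neg (show ¬ IExp.eval s 0 < rb.eval s from h2)]
      simp
  · rw [run_ite_neg (show ¬ IExp.eval s ((rc - rb) + (rell - 1 - rj)) < IExp.eval s 1 from h1),
       if_neg fun h => h1 h.1]
    simp

theorem letterStep_run (inp : Input) (s : St) :
    let s' := letterStep.run inp s
    s'.v .R = s.v .R * s.v .N ∧ ∀ i < s.v .N * s.v .N * s.v .R, s'.s .T i
      = contractVal (s.v .N) (s.v .R)
        (if s.v .c - s.v .b + (s.v .ell - 1 - s.v .j) < 1 ∧ 0 < s.v .b then 2 else s.v .N)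
        (s.s .T) (s.s .B) i := by
  intro s'
  set P : Stmt := ite ((rc - rb) + (rell - 1 - rj)) 1
    (ite 0 rb (assign .hi 2) (assign .hi rN)) (assign .hi rN) with hP
  have hf1 := frame inp P s
  have hhi := hi_run inp s
  rw [← hP] at hhi
  set s₁ := P.run inp s with hs₁
  have hcc := contract_copy_run inp .T .T' .T .R (Or.inr rfl) (by simp) (by simp) (by simp)
    (by simp) (by simp) s₁
  have n1 : s₁.v .N = s.v .N := hf1.v .N rfl
  have n2 : s₁.v .R = s.v .R := hf1.v .R rfl
  have n3 : s₁.s .T = s.s .T := hf1.s .T rfl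
  have n4 : s₁.s .B = s.s .B := hf1.s .B rfl
  rw [hhi, n1, n2, n3, n4] at hcc
  have hf2 := frame inp (contract .T .T' .R) s₁
  have hf3 := frame inp (copy .T' .T .R) ((contract .T .T' .R).run inp s₁)
  refine ⟨?_, hcc⟩
  rw [show s' = ((copy .T' .T .R).run inp ((contract .T .T' .R).run inp s₁)).setV .R
    (((copy .T' .T .R).run inp ((contract .T .T' .R).run inp s₁)).v .R *
      ((copy .T' .T .R).run inp ((contract .T .T' .R).run inp s₁)).v .N) from rfl]
  rw [hf3.v .R rfl, hf2.v .R rfl, hf3.v .N rfl, hf2.v .N rfl, n1, n2]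
  simp


/-- In a tensor with `l` indices that are to be substituted, the first one is never a momentum. -/
def LeadSupp (m p l : ℕ) (T : ℕ → ℂ) : Prop :=
  ∀ u < (2 * m + 1) ^ p, ∀ w < (2 * m + 1) ^ l, (m + 1) * (2 * m + 1) ^ (l - 1) ≤ w →
    T (u * (2 * m + 1) ^ l + w) = 0

section Contract

variable {m N p q hi : ℕ} {T T' B : ℕ → ℂ}

theorem contractVal_block (hT : ∀ i < N * N * (N ^ p * N ^ q),
      T' i = contractVal N (N ^ p * N ^ q) hi T B i) {a k : ℕ} (ha : a < N * N)
    (hk : k < N ^ p * N ^ q) :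
    T' (a * (N ^ p * N ^ q) + k) = ∑ r ∈ Finset.range (if a < N then N else hi),
      T (k * N + r) * B (a * N + r) := by
  obtain ⟨d1, d2⟩ := mul_add_div_mod a hk
  rw [hT _ (mul_add_lt_mul ha hk), contractVal, d1, d2]

/-- The freshly inserted pair forms the two leading digits of the new index, so the support of the
rows of `B` is inherited by the leading letter of the tensor. -/
theorem contract_leading (hhi : hi ≤ N) (hN : 0 < N)
    (hB : ∀ a < N * N, (m + 1) * N ≤ a → ∀ r < N, B (a * N + r) = 0)
    (hT : ∀ i < N * N * (N ^ p * N ^ q), T' i = contractVal N (N ^ p * N ^ q) hi T B i) {i : ℕ}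
    (hi1 : i < N * N * (N ^ p * N ^ q)) (hi2 : (m + 1) * N * (N ^ p * N ^ q) ≤ i) :
    T' i = 0 := by
  have hpos : 0 < N ^ p * N ^ q := by positivity
  rw [hT i hi1, contractVal]
  refine Finset.sum_eq_zero fun r hr => ?_
  have hrN : r < N := by
    rw [Finset.mem_range] at hr
    split_ifs at hr <;> omega
  rw [hB _ (Nat.div_lt_of_lt_mul (by rwa [mul_comm])) ((Nat.le_div_iff_mul_le hpos).2 hi2) r hrN,
    mul_zero]

/-- A step consumes the last of the pending indices. As long as another one remains (q > 0), the
first pending index is merely carried along. -/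
theorem LeadSupp.contract (hN : N = 2 * m + 1) (hhi : hi ≤ N) (hq : 0 < q)
    (hT : ∀ i < N * N * (N ^ p * N ^ q), T' i = contractVal N (N ^ p * N ^ q) hi T B i)
    (h : LeadSupp m p (q + 1) T) : LeadSupp m (2 + p) q T' := by
  unfold LeadSupp at h ⊢
  rw [← hN] at h ⊢
  intro v hv w hw hmw
  have hNpos : 0 < N := by omega
  rw [pow_add, pow_two] at hv
  have hu : v % N ^ p < N ^ p := Nat.mod_lt _ (by positivity)
  have ha : v / N ^ p < N * N := Nat.div_lt_of_lt_mul (by rwa [mul_comm (N ^ p)])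
  have hveq : v = v / N ^ p * N ^ p + v % N ^ p := (Nat.div_add_mod' _ _).symm
  generalize v / N ^ p = a at ha hveq
  generalize v % N ^ p = u at hu hveq
  subst hveq
  rw [show (a * N ^ p + u) * N ^ q + w = a * (N ^ p * N ^ q) + (u * N ^ q + w) by ring,
    contractVal_block hT ha (mul_add_lt_mul hu hw)]
  refine Finset.sum_eq_zero fun r hr => ?_
  have hrN : r < N := by
    rw [Finset.mem_range] at hr
    split_ifs at hr <;> omega
  have h1 : w * N + r < N ^ (q + 1) := by
    rw [pow_succ]; exact mul_add_lt_mul hw hrN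
  have h2 : (m + 1) * N ^ q ≤ w * N + r := by
    obtain ⟨q, rfl⟩ : ∃ q', q = q' + 1 := ⟨q - 1, by omega⟩
    rw [Nat.add_sub_cancel] at hmw
    have := Nat.mul_le_mul_right N hmw
    rw [pow_succ, ← mul_assoc]
    omega
  have := h u hu _ h1 h2
  rw [show (u * N ^ q + w) * N + r = u * N ^ (q + 1) + (w * N + r) by ring, this, zero_mul]

/-- This justifies the saved factor N. When one index is pending, rows a ≥ N need only r < 2: for 2
≤ r ≤ m the array `B` vanishes by `LinSupp`, and for r > m the tensor vanishes because its leading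
letter is not a momentum. -/
theorem tensorVal_contract_lead {A : Type*} [Ring A] [Algebra ℂ A] {X Y : ℕ → A}
    (hm : 0 < m) (hN : N = 2 * m + 1)
    (hY : ∀ r < N, Y r = ∑ a ∈ Finset.range (N * N), B (a * N + r) • wd N X 2 a)
    (hB : LinSupp m B) (hhi : hi = N ∨ hi = 2 ∧ q = 0 ∧ LeadSupp m p 1 T)
    (hT : ∀ i < N * N * (N ^ p * N ^ q), T' i = contractVal N (N ^ p * N ^ q) hi T B i) :
    tensorVal N X Y (2 + p) q T' = tensorVal N X Y p (q + 1) T := by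
  have hhiN : hi ≤ N := by omega
  refine tensorVal_contract hY hhiN ?_ hT
  intro a ha1 ha2 r hr1 hr2 k hk
  -- For hi = N there is no r with hi ≤ r < N, so only the truncated case has to be considered.
  obtain ⟨h2, rfl, hl⟩ := hhi.resolve_left (by omega)
  subst hN
  by_cases hrm : r ≤ m
  · rw [hB a ha2 ha1 r hrm (by omega), mul_zero]
  · have := hl k (by simpa using hk) r (by simpa using hr2) (by simp; omega)
    rw [pow_one] at this
    rw [this, zero_mul]

end Contract

/-- The mixed value `tensorVal`, with new letters at the indices already treated and evolved letters
at the pending ones, does not change during the loop. It starts as the evolved polynomial and ends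
as the same operator written in plain letters. -/
theorem block_run {m : ℕ} [NeZero m] (inp : Input) {V : Wave m ≃ₗ[ℂ] Wave m} (s : St) {l N : ℕ}
    (hNm : N = 2 * m + 1) (hN : s.v .N = N) (hl : 0 < l) (hell : s.v .ell = l)
    (hR : s.v .R = N ^ (l - 1))
    (hB : IsSubst m V ((blockSubst.run inp s).s .B) ∧ FirstSupp m ((blockSubst.run inp s).s .B) ∧
      LinSupp m ((blockSubst.run inp s).s .B))
    (hlead : 0 < s.v .b → LeadSupp m 0 l (s.s .T)) :
    let s' := block.run inp s
    s'.v .ell = 2 * l ∧ s'.v .R = N ^ (2 * l - 1) ∧ LeadSupp m 0 (2 * l) (s'.s .T) ∧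
      ∑ i ∈ Finset.range (N ^ (2 * l)), s'.s .T i • wd N (letter m) (2 * l) i
      = heis V (∑ i ∈ Finset.range (N ^ l), s.s .T i • wd N (letter m) l i) := by
  have hm0 : 0 < m := Nat.pos_of_ne_zero (NeZero.ne m)
  obtain ⟨hB1, hB2, hB3⟩ := hB
  unfold IsSubst at hB1
  unfold FirstSupp at hB2
  rw [← hNm] at hB1 hB2
  have hf0 := frame inp blockSubst s
  intro s'
  have es' : s' = (assign .ell (rell + rell)).run inp
    ((for_ .j rell letterStep).run inp (blockSubst.run inp s)) := rfl
  set s₁ := blockSubst.run inp s with hs₁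
  set Y : ℕ → Module.End ℂ (Wave m) := fun r => heis V (letter m r) with hY
  have n1 : s₁.v .N = N := (hf0.v .N rfl).trans hN
  have n2 : s₁.v .R = N ^ (l - 1) := (hf0.v .R rfl).trans hR
  have n3 : s₁.v .ell = l := (hf0.v .ell rfl).trans hell
  have n4 : s₁.v .b = s.v .b := hf0.v .b rfl
  have n5 : s₁.s .T = s.s .T := hf0.s .T rfl
  have hf2 := frame inp (for_ .j rell letterStep) s₁
  clear_value s' s₁
  have hN1 : 1 ≤ N := by omega
  -- This is the loop invariant below at j = l. Its third clause concerns the pending indices and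
  -- permits the truncated last step; its fourth clause becomes available after the first step and
  -- provides `LeadSupp` for the next block.
  have main : ∀ s₂, s₂ = (for_ .j rell letterStep).run inp s₁ →
      s₂.v .R = N ^ (l - 1 + l) ∧
      tensorVal N (letter m) Y (2 * l) (l - l) (s₂.s .T) = tensorVal N (letter m) Y 0 l (s.s .T) ∧
      (0 < s.v .b → l < l → LeadSupp m (2 * l) (l - l) (s₂.s .T)) ∧
      (1 ≤ l → ∀ i < N * N ^ (l - 1 + l), (m + 1) * N ^ (l - 1 + l) ≤ i → s₂.s .T i = 0) := by
    rintro _ rfl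
    refine run_for (fun j s' => s'.v .R = N ^ (l - 1 + j) ∧
      tensorVal N (letter m) Y (2 * j) (l - j) (s'.s .T) = tensorVal N (letter m) Y 0 l (s.s .T) ∧
      (0 < s.v .b → j < l → LeadSupp m (2 * j) (l - j) (s'.s .T)) ∧
      (1 ≤ j → ∀ i < N * N ^ (l - 1 + j), (m + 1) * N ^ (l - 1 + j) ≤ i → s'.s .T i = 0)) l
      (by simp [n3]) ⟨by simpa using n2, by simp [n5], fun hb _ => by simpa [n5] using hlead hb,
        fun h => absurd h (by omega)⟩ ?_
    rintro j hj s' hf ⟨ih1, ih2, ih3, -⟩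
    obtain ⟨q, rfl⟩ : ∃ q, l = q + 1 + j := ⟨l - 1 - j, by omega⟩
    have e1 : s'.v .N = N := (hf.v .N rfl).trans n1
    have e2 : s'.v .ell = q + 1 + j := (hf.v .ell rfl).trans n3
    have e3 : s'.v .b = s.v .b := (hf.v .b rfl).trans n4
    have e4 : s'.s .B = s₁.s .B := hf.s .B rfl
    have hRpow : N ^ (q + 1 + j - 1 + j) = N ^ (2 * j) * N ^ q := by
      rw [← pow_add]; congr 1; omega
    have hRpow' : N ^ (q + 1 + j - 1 + (j + 1)) = N * (N ^ (2 * j) * N ^ q) := by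
      rw [← pow_add, ← pow_succ']; congr 1; omega
    have hl1 : q + 1 + j - j = q + 1 := by omega
    have hl2 : q + 1 + j - (j + 1) = q := by omega
    rw [hRpow] at ih1
    rw [hl1] at ih2 ih3
    rw [hl2, hRpow']
    obtain ⟨r1, r2⟩ := letterStep_run inp (s'.setV .j j)
    simp only [St.setV_v, St.setV_s, reduceCtorEq, if_false, if_true, e1, ih1, e3, e2, e4] at r1 r2
    have hhi : (if s'.v .c - s.v .b + (q + 1 + j - 1 - j) < 1 ∧ 0 < s.v .b then 2 else N) = N ∨
        (if s'.v .c - s.v .b + (q + 1 + j - 1 - j) < 1 ∧ 0 < s.v .b then 2 else N) = 2 ∧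
          q = 0 ∧ LeadSupp m (2 * j) 1 (s'.s .T) := by
      split_ifs with h
      · obtain rfl : q = 0 := by omega
        exact Or.inr ⟨rfl, rfl, ih3 h.2 hj⟩
      · exact Or.inl rfl
    generalize (if s'.v .c - s.v .b + (q + 1 + j - 1 - j) < 1 ∧ 0 < s.v .b then 2 else N)
      = hi at r2 hhi
    generalize (letterStep.run inp (s'.setV .j j)) = s'' at r1 r2
    have hhiN : hi ≤ N := by omega
    have h2j : 2 * (j + 1) = 2 + 2 * j := by ring
    rw [h2j]
    refine ⟨?_, ?_, fun hb hjl => ?_, fun _ i hi1 hi2 => ?_⟩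
    · rw [r1, mul_comm]
    · rw [← ih2]
      exact tensorVal_contract_lead hm0 hNm hB1 hB3 hhi r2
    · exact LeadSupp.contract hNm hhiN (by omega) r2 (ih3 hb hj)
    · exact contract_leading hhiN hN1 hB2 r2 (by rwa [mul_assoc]) (by rwa [mul_assoc])
  obtain ⟨m1, m2, -, m4⟩ := main _ rfl
  set s₂ := (for_ .j rell letterStep).run inp s₁ with hs₂
  have hT : s'.s .T = s₂.s .T := by rw [es']; rfl
  have h2l : l - 1 + l = 2 * l - 1 := by omega
  rw [h2l] at m1 m4
  refine ⟨?_, ?_, ?_, ?_⟩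
  · have : s₂.v .ell = l := (hf2.v .ell rfl).trans n3
    rw [es']
    simp [this]; ring
  · rw [es']
    simpa using m1
  · intro u hu w hw hmw
    obtain rfl : u = 0 := by simpa using hu
    rw [hT, zero_mul, zero_add]
    rw [← hNm] at hw hmw
    refine m4 hl w ?_ hmw
    rwa [← pow_succ', show 2 * l - 1 + 1 = 2 * l by omega]
  · rw [hT, ← tensorVal_zero_right N (letter m) Y, ← Nat.sub_self l, m2, tensorVal_zero_left,
      map_sum]
    refine Finset.sum_congr rfl fun i _ => ?_
    rw [map_smul, wd_map]


/-- The first part of a circuit, up to and including the rotation gate number `i`. -/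
def prefixOp {m : ℕ} [NeZero m] (D : Circuit m) (t : ℕ) : ℕ → (Wave m ≃ₗ[ℂ] Wave m)
  | 0 => LinearEquiv.refl ℂ _
  | i + 1 => (circuitOp D t i).trans (rotationGate (D.angle (i + 1)))

theorem circuitOp_eq {m : ℕ} [NeZero m] (D : Circuit m) (t i : ℕ) :
    circuitOp D t i = (prefixOp D t i).trans (blockOp (D.gate i) (D.cubicity i) t) := by
  cases i <;> rfl

/-- The part of the circuit that remains to be applied after `b` blocks have been applied to the
observable. -/
def remOp {m : ℕ} [NeZero m] (D : Circuit m) (t c : ℕ) : ℕ → (Wave m ≃ₗ[ℂ] Wave m)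
  | 0 => circuitOp D t c
  | b + 1 => prefixOp D t (c - b)

/-- The circuit is peeled off from its end. Round b removes the block number c - b together with the
rotation that follows it, which exists only for b > 0. -/
theorem remOp_succ {m : ℕ} [NeZero m] (D : Circuit m) (t : ℕ) {c b : ℕ} (hb : b ≤ c) :
    (remOp D t c (b + 1)).trans ((blockOp (D.gate (c - b)) (D.cubicity (c - b)) t).trans
      (if 0 < b then rotationGate (D.angle (c - b + 1)) else LinearEquiv.refl ℂ _))
      = remOp D t c b := by
  rw [← LinearEquiv.trans_assoc, remOp, ← circuitOp_eq]
  cases b with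
  | zero => rfl
  | succ b =>
    rw [if_pos (Nat.succ_pos b), remOp, show c - b = c - (b + 1) + 1 by omega, prefixOp]

theorem remOp_last {m : ℕ} [NeZero m] (D : Circuit m) (t c : ℕ) :
    remOp D t c (c + 1) = LinearEquiv.refl ℂ _ := by
  rw [remOp, Nat.sub_self, prefixOp]

/-! ### The loop over the blocks and the pairing with the moments. -/

theorem powers_run (inp : Input) (s : St) :
    (powers.run inp s).v .N = 2 * s.v .m + 1 ∧
      (powers.run inp s).v .R = (2 * s.v .m + 1) ^ (s.v .d - 1) := by
  rw [powers, run_seq, run_seq]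
  set s₁ := (assign .R 1).run inp ((assign .N (2 * rm + 1)).run inp s) with hs₁
  have n1 : s₁.v .N = 2 * s.v .m + 1 := by simp [hs₁]
  have n2 : s₁.v .d = s.v .d := by simp [hs₁]
  have hf := frame inp (for_ .j (rd - 1) (assign .R (rR * rN))) s₁
  refine ⟨(hf.v .N rfl).trans n1, ?_⟩
  refine run_for (fun j s' => s'.v .R = (2 * s.v .m + 1) ^ j) _ (by simp [n2]) (by simp [hs₁]) ?_
  intro i _ s' hf ih
  have e1 : s'.v .N = 2 * s.v .m + 1 := (hf.v .N rfl).trans n1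
  simp [e1, ih, pow_succ]

/-- The state in which the loop over the blocks is started. -/
def startSt (inp : Input) (s : St) : St :=
  (assign .ell rd).run inp (loadH.run inp (powers.run inp s))

theorem main_run_pos (inp : Input) {s : St} (hd : 0 < s.v .d) : main.run inp s
    = readout.run inp ((for_ .b (rc + 1) block).run inp (startSt inp s)) := by
  rw [main, run_ite_pos (show IExp.eval s 0 < rd.eval s from hd)]
  rfl

/-- The values of the registers after `b` rounds of the loop over the blocks. -/
structure LoopRegs (m t c d b : ℕ) (s : St) : Prop where
  hm : s.v .m = m
  ht : s.v .t = t
  hc : s.v .c = c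
  hN : s.v .N = 2 * m + 1
  hell : s.v .ell = d * 2 ^ b
  hR : s.v .R = (2 * m + 1) ^ (d * 2 ^ b - 1)

theorem startSt_regs (inp : Input) (s : St) :
    LoopRegs (s.v .m) (s.v .t) (s.v .c) (s.v .d) 0 (startSt inp s) := by
  obtain ⟨h1, h2⟩ := powers_run inp s
  have hf1 := frame inp powers s
  have hf2 := frame inp loadH (powers.run inp s)
  have hf3 := frame inp (assign .ell rd) (loadH.run inp (powers.run inp s))
  refine ⟨(hf3.v .m rfl).trans ((hf2.v .m rfl).trans (hf1.v .m rfl)),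
    (hf3.v .t rfl).trans ((hf2.v .t rfl).trans (hf1.v .t rfl)),
    (hf3.v .c rfl).trans ((hf2.v .c rfl).trans (hf1.v .c rfl)),
    (hf3.v .N rfl).trans ((hf2.v .N rfl).trans h1), ?_,
    (hf3.v .R rfl).trans ((hf2.v .R rfl).trans (by simpa using h2))⟩
  have : (loadH.run inp (powers.run inp s)).v .d = s.v .d :=
    (hf2.v .d rfl).trans (hf1.v .d rfl)
  simp [startSt, this]

/-- The invariant of the main loop: the current polynomial, evolved by the part of the circuit that
is still to come, is always the same operator. -/
theorem loop_step {m t c d : ℕ} [NeZero m] (hd : 0 < d) {inp : Input} {h : List (Quad m) → ℂ}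
    {ρ : Module.End ℂ (Wave m)} {D : Circuit m} (hD : Describes t c d inp h ρ D) {b : ℕ}
    (hb : b ≤ c) {s : St} (hr : LoopRegs m t c d b s)
    (hlead : 0 < b → LeadSupp m 0 (d * 2 ^ b) (s.s .T)) :
    let s' := block.run inp (s.setV .b b)
    LoopRegs m t c d (b + 1) s' ∧ LeadSupp m 0 (d * 2 ^ (b + 1)) (s'.s .T) ∧
      heis (remOp D t c (b + 1)) (∑ i ∈ Finset.range ((2 * m + 1) ^ (d * 2 ^ (b + 1))),
        s'.s .T i • wd (2 * m + 1) (letter m) (d * 2 ^ (b + 1)) i)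
      = heis (remOp D t c b) (∑ i ∈ Finset.range ((2 * m + 1) ^ (d * 2 ^ b)),
        s.s .T i • wd (2 * m + 1) (letter m) (d * 2 ^ b) i) := by
  have hsub := blockSubst_run hD (s.setV .b b) (by simpa using hr.hm) (by simpa using hr.hN)
    (by simpa using hr.ht) (by simpa using hr.hc) (by simpa using hb)
  have hblock := block_run inp (s.setV .b b) (l := d * 2 ^ b) rfl (by simpa using hr.hN)
    (by positivity) (by simpa using hr.hell) (by simpa using hr.hR) hsub (by simpa using hlead)
  have hf := frame inp block (s.setV .b b)
  intro s'
  change s'.v .ell = _ ∧ s'.v .R = _ ∧ LeadSupp m 0 _ (s'.s .T) ∧ _ = _ at hblock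
  rw [show 2 * (d * 2 ^ b) = d * 2 ^ (b + 1) by ring] at hblock
  obtain ⟨k1, k2, k3, k4⟩ := hblock
  refine ⟨⟨(hf.v .m rfl).trans (by simpa using hr.hm), (hf.v .t rfl).trans (by simpa using hr.ht),
    (hf.v .c rfl).trans (by simpa using hr.hc), (hf.v .N rfl).trans (by simpa using hr.hN), k1, k2⟩,
    k3, ?_⟩
  change ∑ i ∈ Finset.range ((2 * m + 1) ^ (d * 2 ^ (b + 1))),
        s'.s .T i • wd (2 * m + 1) (letter m) (d * 2 ^ (b + 1)) i = _ at k4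
  rw [k4, ← heis_trans, ← remOp_succ D t hb]
  simp

/-- At the end no gate is left, so the tensor lists the coefficients of U† H U itself, and linearity
reduces its expectation value to the moments. -/
theorem main_run {m t c d : ℕ} [NeZero m] (hd : 0 < d) {inp : Input} {h : List (Quad m) → ℂ}
    {ρ : Module.End ℂ (Wave m)} {D : Circuit m} (hD : Describes t c d inp h ρ D) {s : St}
    (hm : s.v .m = m) (ht : s.v .t = t) (hc : s.v .c = c) (hd' : s.v .d = d) :
    HasTrace (ρ * heis (circuitOp D t c) (polyOp d h)) ((main.run inp s).s .acc 0) := by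
  have hm0 : 0 < m := Nat.pos_of_ne_zero (NeZero.ne m)
  have hstart := startSt_regs inp s
  rw [hm, ht, hc, hd'] at hstart
  have hT0 : ∑ i ∈ Finset.range ((2 * m + 1) ^ d),
      (startSt inp s).s .T i • wd (2 * m + 1) (letter m) d i = polyOp d h := by
    rw [← sum_coeffVal hm0 hD.coeff]
    refine Finset.sum_congr rfl fun i hi => ?_
    obtain ⟨h1, h2⟩ := powers_run inp s
    have hm' : (powers.run inp s).v .m = m := ((frame inp powers s).v .m rfl).trans hm
    have := loadH_run inp (powers.run inp s) (by omega) i (by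
      rw [h1, h2, hm, hd', ← pow_succ, Nat.sub_add_cancel hd]
      exact Finset.mem_range.1 hi)
    rw [h1, hm, hm'] at this
    rw [show (startSt inp s).s .T i = (loadH.run inp (powers.run inp s)).s .T i from rfl, this]
  have hloop := run_for (inp := inp) (x := .b) (e := rc + 1) (P := block) (s := startSt inp s)
    (fun b s' => LoopRegs m t c d b s' ∧ (0 < b → LeadSupp m 0 (d * 2 ^ b) (s'.s .T)) ∧
      heis (remOp D t c b) (∑ i ∈ Finset.range ((2 * m + 1) ^ (d * 2 ^ b)),
        s'.s .T i • wd (2 * m + 1) (letter m) (d * 2 ^ b) i)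
      = heis (circuitOp D t c) (polyOp d h)) (c + 1) (by simp [hstart.hc])
    ⟨hstart, by simp, by simp [hT0, remOp]⟩ (by
      rintro b hb s' - ⟨i1, i2, i3⟩
      obtain ⟨k1, k2, k3⟩ := loop_step hd hD (by omega) i1 i2
      exact ⟨k1, fun _ => k2, k3.trans i3⟩)
  rw [main_run_pos inp (by omega)]
  generalize (for_ .b (rc + 1) block).run inp (startSt inp s) = s₂ at hloop
  obtain ⟨hr, -, hval⟩ := hloop
  have hexp : d * 2 ^ (c + 1) - 1 + 1 = d * 2 ^ (c + 1) :=
    Nat.sub_add_cancel (Nat.succ_le_of_lt (by positivity))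
  rw [readout_run inp s₂ (by rw [hr.hN]; omega), hr.hN, hr.hR, hr.hm, ← pow_succ, hexp, ← hval,
    remOp_last, heis_refl, Finset.mul_sum]
  simp only [mul_smul_comm]
  refine HasTrace.sum_smul _ _ _ _ fun i hi => ?_
  -- Indices with zero digits contribute here as well: deleting the identity letters leaves a word
  -- of length at most d 2^(c+1), whose moment is in the table.
  obtain ⟨q1, q2, q3, q4⟩ := wQuads_spec hm0 (d * 2 ^ (c + 1)) i (Finset.mem_range.1 hi)
  rw [← q1, ← q2, ← q3]
  exact hD.moment _ q4

theorem main_run_zero {m t c : ℕ} [NeZero m] {inp : Input} {h : List (Quad m) → ℂ}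
    {ρ : Module.End ℂ (Wave m)} {D : Circuit m} (hD : Describes t c 0 inp h ρ D) {s : St}
    (hd' : s.v .d = 0) :
    HasTrace (ρ * heis (circuitOp D t c) (polyOp 0 h)) ((main.run inp s).s .acc 0) := by
  rw [main, run_ite_neg (by simp [hd'])]
  have h1 : inp 0 0 0 = h [] := hD.coeff [] (by simp)
  have h2 : HasTrace (ρ * 1) (inp 1 0 0) := hD.moment [] (by simp)
  have := HasTrace.sum_smul {()} (fun _ => inp 0 0 0) _ (fun _ => inp 1 0 0) fun _ _ => h2
  simpa [polyOp, wordOp, h1] using this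

/-- Conjugating ρ U† H U by the unitary U gives U ρ U† H U U† = U ρ U† H, so both traces have the
same value. -/
theorem main_correct {m t c d : ℕ} [NeZero m] {inp : Input} {h : List (Quad m) → ℂ}
    {ρ : Module.End ℂ (Wave m)} {D : Circuit m} (hD : Describes t c d inp h ρ D) {s : St}
    (hm : s.v .m = m) (ht : s.v .t = t) (hc : s.v .c = c) (hd : s.v .d = d) :
    HasTrace ((circuitOp D t c).toLinearMap * ρ * (circuitOp D t c).symm.toLinearMap * polyOp d h)
        ((main.run inp s).s .acc 0) ∧
      HasTrace (ρ * (circuitOp D t c).symm.toLinearMap * polyOp d h * (circuitOp D t c).toLinearMap)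
        ((main.run inp s).s .acc 0) := by
  have key : HasTrace (ρ * heis (circuitOp D t c) (polyOp d h)) ((main.run inp s).s .acc 0) := by
    rcases Nat.eq_zero_or_pos d with rfl | hd0
    · exact main_run_zero hD hd
    · exact main_run hd0 hD hm ht hc hd
  rw [heis_eq_mul] at key
  have hinv : (circuitOp D t c).toLinearMap * (circuitOp D t c).symm.toLinearMap = 1 := by
    ext; simp
  constructor
  · have := HasTrace.conj (normPreserving_circuitOp D t c) key
    simp only [mul_assoc] at this ⊢
    rwa [hinv, mul_one] at this
  · simpa only [mul_assoc] using key

end Sim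

/-! ## Running time -/

/-- A program without loops. -/
def Stmt.loopFree : Stmt → Bool
  | seq P Q => P.loopFree && Q.loopFree
  | ite _ _ P Q => P.loopFree && Q.loopFree
  | for_ _ _ _ => false
  | _ => true

/-- A bound on the number of steps of a program without loops. -/
def Stmt.bd : Stmt → ℕ
  | skip => 1
  | assign _ e => e.cost + 2
  | storeN _ e f => e.cost + f.cost + 5
  | storeS _ e f => e.cost + f.cost + 7
  | seq P Q => P.bd + Q.bd
  | ite e f P Q => e.cost + f.cost + 1 + (P.bd + Q.bd)
  | for_ _ _ _ => 0

theorem Stmt.cost_le_bd (inp : Input) (P : Stmt) (h : P.loopFree = true) :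
    ∀ s, P.cost inp s ≤ P.bd := by
  induction P with
  | seq P Q hP hQ =>
    intro s
    simp only [loopFree, Bool.and_eq_true] at h
    exact Nat.add_le_add (hP h.1 s) (hQ h.2 _)
  | ite e f P Q hP hQ =>
    intro s
    simp only [loopFree, Bool.and_eq_true] at h
    have h1 := hP h.1 s
    have h2 := hQ h.2 s
    simp only [cost, bd]
    split_ifs <;> omega
  | for_ x e P _ => simp [loopFree] at h
  | _ => intro s; exact le_rfl

/-- For a concrete loop-free program both hypotheses are closed Boolean computations, so numerical
bounds are proved by `rfl`. -/
theorem Stmt.cost_le (inp : Input) {P : Stmt} {n : ℕ} (h : P.loopFree = true)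
    (hn : Nat.ble P.bd n = true) (s : St) : P.cost inp s ≤ n :=
  (cost_le_bd inp P h s).trans (Nat.le_of_ble_eq_true hn)

theorem Stmt.cost_for_le_sum {inp : Input} {x : Reg} {e : IExp} {P : Stmt} {s : St}
    (n : ℕ) (hn : e.eval s = n) (K : ℕ → ℕ)
    (hs : ∀ i < n, ∀ s', (for_ x e P).Frame s s' → P.cost inp (s'.setV x i) ≤ K i) :
    (for_ x e P).cost inp s ≤ e.cost + 4 + ∑ i ∈ Finset.range n, (K i + 5) := by
  rw [cost, hn]
  gcongr with i hi
  exact hs i (Finset.mem_range.1 hi) _ (iter_frame inp x e P s i)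

theorem Stmt.cost_seq (inp : Input) (P Q : Stmt) (s : St) :
    (seq P Q).cost inp s = P.cost inp s + Q.cost inp (P.run inp s) := rfl

namespace Sim

open Stmt SExp

/-! ### Step counts of the parts of the program. -/

theorem dotProd_cost (inp : Input) (A : SArr) (s : St) :
    (dotProd A).cost inp s ≤ 16 + 57 * s.v .h := by
  have h1 : (storeS .acc 0 (.const 0)).cost inp s ≤ 10 := cost_le inp rfl rfl s
  have h2 := cost_for_le (inp := inp) (x := .r) (e := rh) (s := (s.setS .acc 0 (0 : ℤ)))
    (P := storeS .acc 0 (load .acc 0 + load A (rp * rN + rr) * load .B (ra * rN + rr)))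
    (s.v .h) (by simp) 52 (fun i _ s' _ => cost_le inp rfl rfl _)
  have h3 : (dotProd A).cost inp s = (storeS .acc 0 (.const 0)).cost inp s
    + (for_ .r rh (storeS .acc 0 (load .acc 0 + load A (rp * rN + rr) *
      load .B (ra * rN + rr)))).cost inp (s.setS .acc 0 (0 : ℤ)) := rfl
  have h4 : rh.cost = 2 := rfl
  omega

theorem sum_range_mul_self_ite (N hi : ℕ) :
    ∑ a ∈ Finset.range (N * N), (if a < N then N else hi) ≤ N * N + N * N * hi := by
  calc ∑ a ∈ Finset.range (N * N), (if a < N then N else hi)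
      ≤ ∑ a ∈ Finset.range (N * N), ((if a < N then N else 0) + hi) := by
        refine Finset.sum_le_sum fun a _ => ?_
        split_ifs <;> omega
    _ = ((Finset.range (N * N)).filter (· < N)).card * N + N * N * hi := by
        rw [Finset.sum_add_distrib, ← Finset.sum_filter]
        simp
    _ ≤ N * N + N * N * hi := by
        gcongr
        calc ((Finset.range (N * N)).filter (· < N)).card ≤ (Finset.range N).card :=
              Finset.card_le_card fun a ha => by simpa using (Finset.mem_filter.1 ha).2
          _ = N := Finset.card_range N

/-- Only the N rows a < N use the full summation range N; together they cost about as much as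
summing one term in each of the N² rows. Hence the factor `hi` instead of N. -/
theorem contract_cost (inp : Input) (A O : SArr) (x : Reg) (hx : x = .N ∨ x = .R) (s : St)
    (hN : 0 < s.v .N) (hR : 0 < s.v x) (hhi : 0 < s.v .hi) :
    (contract A O x).cost inp s ≤ 200 * (s.v .N * s.v .N * s.v x * s.v .hi) := by
  have hxa : x ≠ .a := by rcases hx with rfl | rfl <;> simp
  have hxh : x ≠ .h := by rcases hx with rfl | rfl <;> simp
  have hxp : x ≠ .p := by rcases hx with rfl | rfl <;> simp
  have hxr : x ≠ .r := by rcases hx with rfl | rfl <;> simp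
  have key := cost_for_le_sum (inp := inp) (x := .a) (e := rN * rN) (s := s)
    (P := seq (ite ra rN (assign .h rN) (assign .h rhi)) <|
      for_ .p (.reg x) <| seq (dotProd A) (storeS O (ra * .reg x + rp) (load .acc 0)))
    (s.v .N * s.v .N) (by simp)
    (fun a => 19 + s.v x * (44 + 57 * if a < s.v .N then s.v .N else s.v .hi)) (by
      intro a ha s' hf
      have n1 : s'.v .N = s.v .N := hf.v .N rfl
      have n2 : s'.v .hi = s.v .hi := hf.v .hi rfl
      have n3 : s'.v x = s.v x := hf.v x (by simp [wv, dotProd, hxa, hxh, hxp, hxr])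
      set P := ite ra rN (assign .h rN) (assign .h rhi) with hP
      have hf1 := frame inp P (s'.setV .a a)
      have c1 : P.cost inp (s'.setV .a a) ≤ 13 := cost_le inp rfl rfl _
      have e1 : (P.run inp (s'.setV .a a)).v x = s.v x := by
        rw [hf1.v x (by simp [wv, hP, hxh])]
        simp [hxa, n3]
      have e2 : (P.run inp (s'.setV .a a)).v .h = if a < s.v .N then s.v .N else s.v .hi := by
        simp only [hP, run_ite]
        simp only [IExp.eval_reg, St.setV_v, if_true, reduceCtorEq, if_false, run_assign, n1]
        split_ifs <;> simp [n2]
      rw [cost_seq]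
      generalize P.run inp (s'.setV .a a) = s₁ at e1 e2 ⊢
      have c2 := cost_for_le (inp := inp) (x := .p) (e := .reg x) (s := s₁)
        (P := seq (dotProd A) (storeS O (ra * .reg x + rp) (load .acc 0)))
        (s.v x) (by simp [e1]) (16 + 57 * (if a < s.v .N then s.v .N else s.v .hi) + 23) (by
          intro p _ s₂ hf2
          have d1 := dotProd_cost inp A (s₂.setV .p p)
          have d2 : (storeS O (ra * .reg x + rp) (load .acc 0)).cost inp
            ((dotProd A).run inp (s₂.setV .p p)) ≤ 23 := cost_le inp rfl rfl _
          have d3 : (s₂.setV .p p).v .h = if a < s.v .N then s.v .N else s.v .hi := by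
            rw [← e2, ← hf2.v .h rfl]
            simp
          rw [d3] at d1
          exact Nat.add_le_add d1 d2)
      have c3 : (IExp.reg x).cost = 2 := rfl
      generalize (if a < s.v .N then s.v .N else s.v .hi) = k at c2 ⊢
      have : s.v x * (16 + 57 * k + 23 + 5) = s.v x * (44 + 57 * k) := by ring
      omega)
  refine key.trans ?_
  have hsum : ∑ a ∈ Finset.range (s.v .N * s.v .N),
      (19 + s.v x * (44 + 57 * if a < s.v .N then s.v .N else s.v .hi) + 5)
      ≤ s.v .N * s.v .N * (24 + 44 * s.v x)
        + s.v x * 57 * (s.v .N * s.v .N + s.v .N * s.v .N * s.v .hi) := by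
    calc _ = s.v .N * s.v .N * (24 + 44 * s.v x) + s.v x * 57 *
          ∑ a ∈ Finset.range (s.v .N * s.v .N), (if a < s.v .N then s.v .N else s.v .hi) := by
          rw [Finset.mul_sum, show s.v .N * s.v .N * (24 + 44 * s.v x)
              = ∑ _a ∈ Finset.range (s.v .N * s.v .N), (24 + 44 * s.v x) by simp,
            ← Finset.sum_add_distrib]
          exact Finset.sum_congr rfl fun a _ => by ring
      _ ≤ _ := by gcongr; exact sum_range_mul_self_ite _ _
  have c4 : (rN * rN : IExp).cost = 5 := rfl
  rw [c4]
  have g1 : s.v .N * s.v .N ≤ s.v .N * s.v .N * s.v x := Nat.le_mul_of_pos_right _ hR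
  have g2 : s.v .N * s.v .N * s.v x ≤ s.v .N * s.v .N * s.v x * s.v .hi :=
    Nat.le_mul_of_pos_right _ hhi
  have g3 : 1 ≤ s.v .N * s.v .N := Nat.mul_pos hN hN
  have g4 : s.v .N * s.v .N * (24 + 44 * s.v x)
        + s.v x * 57 * (s.v .N * s.v .N + s.v .N * s.v .N * s.v .hi)
      = 24 * (s.v .N * s.v .N) + 101 * (s.v .N * s.v .N * s.v x)
        + 57 * (s.v .N * s.v .N * s.v x * s.v .hi) := by ring
  omega

theorem copy_cost (inp : Input) (O A : SArr) (x : Reg) (s : St) :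
    (copy O A x).cost inp s ≤ 12 + 23 * (s.v .N * s.v .N * s.v x) := by
  have := cost_for_le (inp := inp) (x := .p) (e := rN * rN * .reg x) (s := s)
    (P := storeS A rp (load O rp)) (s.v .N * s.v .N * s.v x) (by simp) 18
    (fun _ _ _ _ => cost_le inp rfl rfl _)
  have c : (rN * rN * .reg x : IExp).cost = 8 := rfl
  rw [c] at this
  exact this.trans (by omega)

theorem letterStep_cost (inp : Input) (s : St) (hN : 0 < s.v .N) (hR : 0 < s.v .R) :
    letterStep.cost inp s ≤ 300 * (s.v .N * s.v .N * s.v .R *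
      if s.v .c - s.v .b + (s.v .ell - 1 - s.v .j) < 1 ∧ 0 < s.v .b then 2 else s.v .N) := by
  have hhi := hi_run inp s
  set P : Stmt := ite ((rc - rb) + (rell - 1 - rj)) 1
    (ite 0 rb (assign .hi 2) (assign .hi rN)) (assign .hi rN) with hP
  have hf1 := frame inp P s
  have c1 : P.cost inp s ≤ 40 := cost_le inp rfl rfl _
  have e1 : (P.run inp s).v .N = s.v .N := hf1.v .N rfl
  have e2 : (P.run inp s).v .R = s.v .R := hf1.v .R rfl
  have hpos : 0 < (P.run inp s).v .hi := by
    rw [hhi]; split_ifs <;> omega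
  have c2 := contract_cost inp .T .T' .R (Or.inr rfl) (P.run inp s) (by omega) (by omega) hpos
  have hf2 := frame inp (contract .T .T' .R) (P.run inp s)
  have e3 := hf2.v .N rfl
  have e4 := hf2.v .R rfl
  have c3 := copy_cost inp .T' .T .R ((contract .T .T' .R).run inp (P.run inp s))
  have c4 : (assign .R (rR * rN)).cost inp ((copy .T' .T .R).run inp
    ((contract .T .T' .R).run inp (P.run inp s))) = 7 := rfl
  rw [show letterStep.cost inp s = P.cost inp s + ((contract .T .T' .R).cost inp (P.run inp s) +
    ((copy .T' .T .R).cost inp ((contract .T .T' .R).run inp (P.run inp s)) +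
      (assign .R (rR * rN)).cost inp ((copy .T' .T .R).run inp
        ((contract .T .T' .R).run inp (P.run inp s))))) from rfl]
  rw [e3, e4, e1, e2] at c3
  rw [e1, e2] at c2
  rw [← hhi]
  have g1 : s.v .N * s.v .N * s.v .R ≤ s.v .N * s.v .N * s.v .R * (P.run inp s).v .hi :=
    Nat.le_mul_of_pos_right _ hpos
  have g2 : 1 ≤ s.v .N * s.v .N * s.v .R := Nat.mul_pos (Nat.mul_pos hN hN) hR
  omega

/-- The fourth power comes from the product of the N × N matrix of the gate with the N² × N array
`B`; the other parts take at most of the order of N³ steps. -/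
theorem gateStep_cost (inp : Input) (s : St) (hN : 0 < s.v .N) (hhi : s.v .hi = s.v .N) :
    gateStep.cost inp s ≤ 1000 * s.v .N ^ 4 := by
  have c1 : (ite 0 rs cubic skip).cost inp s ≤ 20 + s.v .N * (11 + s.v .N * 205) := by
    have : cubic.cost inp s ≤ 6 + s.v .N * (6 + s.v .N * 205 + 5) :=
      cost_for_for_le (s.v .N) (s.v .N) 200 (by simp) (fun i s' hf => by simpa using hf.v .N rfl)
        (fun s' => cost_le inp rfl rfl s')
    rw [show 6 + s.v .N * 205 + 5 = 11 + s.v .N * 205 by ring] at this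
    rw [show (ite 0 rs cubic skip).cost inp s = 4 + if IExp.eval s 0 < rs.eval s then
      cubic.cost inp s else 1 from rfl]
    split_ifs <;> omega
  have hf1 := frame inp (ite 0 rs cubic skip) s
  have e1 : ((ite 0 rs cubic skip).run inp s).v .N = s.v .N := hf1.v .N rfl
  have e1' : ((ite 0 rs cubic skip).run inp s).v .hi = s.v .N := (hf1.v .hi rfl).trans hhi
  rw [show gateStep.cost inp s = (ite 0 rs cubic skip).cost inp s +
    (seq fillG (seq (contract .G .B' .N) (copy .B' .B .N))).cost inp
      ((ite 0 rs cubic skip).run inp s) from rfl]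
  generalize (ite 0 rs cubic skip).run inp s = s₁ at e1 e1' ⊢
  have c2 : fillG.cost inp s₁ ≤ 6 + s.v .N * (6 + s.v .N * 505 + 5) :=
    cost_for_for_le (s.v .N) (s.v .N) 500 (by simp [e1])
      (fun i s' hf => by simpa [e1] using hf.v .N rfl) (fun s' => cost_le inp rfl rfl s')
  have hf2 := frame inp fillG s₁
  have e2 : (fillG.run inp s₁).v .N = s.v .N := (hf2.v .N rfl).trans e1
  have e2' : (fillG.run inp s₁).v .hi = s.v .N := (hf2.v .hi rfl).trans e1'
  rw [cost_seq]
  generalize fillG.run inp s₁ = s₂ at e2 e2' ⊢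
  have c3 := contract_cost inp .G .B' .N (Or.inl rfl) s₂ (by omega) (by omega) (by omega)
  have hf3 := frame inp (contract .G .B' .N) s₂
  have e3 : ((contract .G .B' .N).run inp s₂).v .N = s.v .N := (hf3.v .N rfl).trans e2
  have c4 := copy_cost inp .B' .B .N ((contract .G .B' .N).run inp s₂)
  rw [cost_seq]
  rw [e3] at c4
  rw [e2, e2'] at c3
  generalize s.v .N = N at *
  have g1 : 1 ≤ N * N := Nat.mul_pos hN hN
  have g2 : N * N ≤ N * N * N := Nat.le_mul_of_pos_right _ hN
  have g3 : N * N * N ≤ N * N * N * N := Nat.le_mul_of_pos_right _ hN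
  have g4 : N ≤ N * N := Nat.le_mul_of_pos_right _ hN
  rw [show N ^ 4 = N * N * N * N by ring]
  have g5 : N * (11 + N * 205) = 11 * N + 205 * (N * N) := by ring
  have g6 : N * (6 + N * 505 + 5) = 11 * N + 505 * (N * N) := by ring
  omega

theorem blockSubst_cost (inp : Input) (s : St) (hN : 0 < s.v .N) :
    blockSubst.cost inp s ≤ 2000 * ((s.v .t + 1) * s.v .N ^ 4) := by
  have c1 : initB.cost inp s ≤ 9 + s.v .N * s.v .N * (6 + s.v .N * 105 + 5) :=
    cost_for_for_le (s.v .N * s.v .N) (s.v .N) 100 (by simp)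
      (fun i s' hf => by simpa using hf.v .N rfl) (fun s' => cost_le inp rfl rfl s')
  have hf1 := frame inp initB s
  rw [show blockSubst.cost inp s = initB.cost inp s + (4 +
    (seq (for_ .s (rt + 1) gateStep) (ite 0 rb rot skip)).cost inp
      ((assign .hi rN).run inp (initB.run inp s))) from rfl]
  have e1 : ((assign .hi rN).run inp (initB.run inp s)).v .N = s.v .N := hf1.v .N rfl
  have e1' : ((assign .hi rN).run inp (initB.run inp s)).v .hi = s.v .N := hf1.v .N rfl
  have e1'' : ((assign .hi rN).run inp (initB.run inp s)).v .t = s.v .t := hf1.v .t rfl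
  generalize (assign .hi rN).run inp (initB.run inp s) = s₁ at e1 e1' e1'' ⊢
  have c2 := cost_for_le (inp := inp) (x := .s) (e := rt + 1) (s := s₁) (P := gateStep)
    (s.v .t + 1) (by simp [e1'']) (1000 * s.v .N ^ 4) (by
      intro i _ s' hf
      have k1 : s'.v .N = s.v .N := (hf.v .N rfl).trans e1
      have k2 : s'.v .hi = s.v .N := (hf.v .hi rfl).trans e1'
      have := gateStep_cost inp (s'.setV .s i) (by simpa [k1] using hN) (by simp [k1, k2])
      simpa [k1] using this)
  have hf2 := frame inp (for_ .s (rt + 1) gateStep) s₁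
  rw [cost_seq]
  have e2 : ((for_ .s (rt + 1) gateStep).run inp s₁).v .N = s.v .N := (hf2.v .N rfl).trans e1
  generalize (for_ .s (rt + 1) gateStep).run inp s₁ = s₂ at e2 ⊢
  have c3 : (ite 0 rb rot skip).cost inp s₂ ≤ 20 + s.v .N * s.v .N * 205 := by
    have : rot.cost inp s₂ ≤ 5 + 4 + s.v .N * s.v .N * (200 + 5) :=
      cost_for_le _ (by simp [e2]) 200 (fun _ _ _ _ => cost_le inp rfl rfl _)
    rw [show (ite 0 rb rot skip).cost inp s₂ = 4 + if IExp.eval s₂ 0 < rb.eval s₂ then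
      rot.cost inp s₂ else 1 from rfl]
    split_ifs <;> omega
  have c4 : (rt + 1 : IExp).cost = 4 := rfl
  rw [c4] at c2
  generalize s.v .N = N at *
  have g1 : 1 ≤ N * N := Nat.mul_pos hN hN
  have g2 : N * N ≤ N * N * N := Nat.le_mul_of_pos_right _ hN
  have g3 : N * N * N ≤ N * N * N * N := Nat.le_mul_of_pos_right _ hN
  have g4 : N * N * N * N ≤ (s.v .t + 1) * (N * N * N * N) :=
    Nat.le_mul_of_pos_left _ (Nat.succ_pos _)
  rw [show N ^ 4 = N * N * N * N by ring] at c2 ⊢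
  have g5 : N * N * (6 + N * 105 + 5) = 11 * (N * N) + 105 * (N * N * N) := by ring
  have g6 : s.v .t + 1 ≤ (s.v .t + 1) * (N * N * N * N) :=
    Nat.le_mul_of_pos_right _ (by omega)
  have g7 : (s.v .t + 1) * (1000 * (N * N * N * N) + 5)
    = 1000 * ((s.v .t + 1) * (N * N * N * N)) + 5 * (s.v .t + 1) := by ring
  omega


theorem block_cost (inp : Input) (s : St) {l N E : ℕ} (hN1 : 0 < N) (hN : s.v .N = N)
    (hell : s.v .ell = l) (hR : s.v .R = N ^ (l - 1))
    (hE : ∀ j < l, N * N * N ^ (l - 1 + j) *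
      (if s.v .c - s.v .b + (l - 1 - j) < 1 ∧ 0 < s.v .b then 2 else N) ≤ 2 * E) :
    block.cost inp s ≤ 2000 * ((s.v .t + 1) * N ^ 4) + l * (600 * E + 5) + 20 := by
  have c1 := blockSubst_cost inp s (by omega)
  have hf0 := frame inp blockSubst s
  have n1 : (blockSubst.run inp s).v .N = N := (hf0.v .N rfl).trans hN
  have n2 : (blockSubst.run inp s).v .R = N ^ (l - 1) := (hf0.v .R rfl).trans hR
  have n3 : (blockSubst.run inp s).v .ell = l := (hf0.v .ell rfl).trans hell
  have n4 : (blockSubst.run inp s).v .b = s.v .b := hf0.v .b rfl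
  have n5 : (blockSubst.run inp s).v .c = s.v .c := hf0.v .c rfl
  rw [show block.cost inp s = blockSubst.cost inp s +
    ((for_ .j rell letterStep).cost inp (blockSubst.run inp s) + 7) from rfl]
  generalize blockSubst.run inp s = s₁ at n1 n2 n3 n4 n5 ⊢
  have c2 := cost_for_le_inv (inp := inp) (x := .j) (e := rell) (P := letterStep) (s := s₁)
    (fun j s' => s'.v .R = N ^ (l - 1 + j)) l (by simp [n3]) (600 * E) (by simpa using n2) (by
      intro j hj s' hf ih
      have e1 : s'.v .N = N := (hf.v .N rfl).trans n1
      have e2 : s'.v .ell = l := (hf.v .ell rfl).trans n3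
      have e3 : s'.v .b = s.v .b := (hf.v .b rfl).trans n4
      have e4 : s'.v .c = s.v .c := (hf.v .c rfl).trans n5
      obtain ⟨r1, -⟩ := letterStep_run inp (s'.setV .j j)
      have k := letterStep_cost inp (s'.setV .j j) (by simpa [e1] using hN1)
        (by simp only [St.setV_v, reduceCtorEq, if_false, ih]; positivity)
      simp only [St.setV_v, reduceCtorEq, if_false, if_true, e1, e2, e3, e4, ih] at r1 k
      have := hE j hj
      exact ⟨by rw [r1, ← pow_succ]; rfl, k.trans (by omega)⟩)
  have c3 : rell.cost = 2 := rfl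
  rw [hN] at c1
  omega

/-- With l = d 2^b letters, the step number j costs N^(l + j + 2) when it is not truncated, so at
most N^(2l + 1), and at most N^(2l) unless it is the last step of its round. The last step of an
earlier round is harmless because 2l + 1 is at most twice the number of letters of the final round.
The last step of the final round is truncated if c ≥ 1, and costs the extra factor N if c = 0. -/
theorem letter_exponent {N c d b j : ℕ} (hN : 0 < N) (hd : 0 < d) (hb : b ≤ c)
    (hj : j < d * 2 ^ b) : N * N * N ^ (d * 2 ^ b - 1 + j) *
      (if c - b + (d * 2 ^ b - 1 - j) < 1 ∧ 0 < b then 2 else N)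
      ≤ 2 * N ^ (if c = 0 then d * 2 ^ (c + 1) + 1 else d * 2 ^ (c + 1)) := by
  have hpow : ∀ i, d * 2 ^ (i + 1) = 2 * (d * 2 ^ i) := fun i => by ring
  have hmono : b < c → d * 2 ^ (b + 1) ≤ d * 2 ^ c := fun h =>
    Nat.mul_le_mul_left _ (Nat.pow_le_pow_right two_pos h)
  have hbc : b = c → d * 2 ^ b = d * 2 ^ c := fun h => by rw [h]
  have hpos : 0 < d * 2 ^ c := by positivity
  rw [hpow] at hmono
  rw [hpow]
  generalize d * 2 ^ b = l at *
  generalize d * 2 ^ c = l' at *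
  split_ifs with h1 h2 h2
  -- For c = 0 also b = 0, and the truncated case cannot occur.
  · omega
  · calc N * N * N ^ (l - 1 + j) * 2 = 2 * N ^ (l - 1 + j + 2) := by ring
      _ ≤ _ := Nat.mul_le_mul_left _ (Nat.pow_le_pow_right hN (by omega))
  · calc N * N * N ^ (l - 1 + j) * N = N ^ (l - 1 + j + 3) := by ring
      _ ≤ N ^ (2 * l' + 1) := Nat.pow_le_pow_right hN (by omega)
      _ ≤ _ := Nat.le_mul_of_pos_left _ two_pos
  · calc N * N * N ^ (l - 1 + j) * N = N ^ (l - 1 + j + 3) := by ring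
      _ ≤ N ^ (2 * l') := Nat.pow_le_pow_right hN (by
          rcases Nat.lt_or_ge b c with h | h
          · have := hmono h; omega
          · have := hbc (by omega); omega)
      _ ≤ _ := Nat.le_mul_of_pos_left _ two_pos

theorem words_cost (inp : Input) (s : St) (P : Stmt) (hP : P.loopFree = true)
    (hbd : Nat.ble P.bd 300 = true) (hN : 0 < s.v .N) (hR : 0 < s.v .R)
    (hw : (for_ .w rR (for_ .r rN P)).wv .N = false) :
    (for_ .w rR (for_ .r rN P)).cost inp s ≤ 400 * (s.v .R * s.v .N) := by
  have := cost_for_for_le (inp := inp) (x := .w) (y := .r) (e := rR) (f := rN) (P := P) (s := s)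
    (s.v .R) (s.v .N) 300 rfl (fun i s' hf => by simpa using hf.v .N hw)
    (fun s' => cost_le inp hP hbd s')
  have e1 : rR.cost = 2 := rfl
  have e2 : rN.cost = 2 := rfl
  rw [e1, e2] at this
  have g1 : s.v .R * (2 + 4 + s.v .N * (300 + 5) + 5)
    = 11 * s.v .R + 305 * (s.v .R * s.v .N) := by ring
  have g2 : s.v .R ≤ s.v .R * s.v .N := Nat.le_mul_of_pos_right _ hN
  omega

theorem loadH_cost (inp : Input) (s : St) (hN : 0 < s.v .N) (hR : 0 < s.v .R) :
    loadH.cost inp s ≤ 50 + 400 * (s.v .R * s.v .N) := by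
  have hf := frame inp initWords s
  have c1 : initWords.cost inp s ≤ 50 := cost_le inp rfl rfl s
  have e1 := hf.v .N rfl
  have e2 := hf.v .R rfl
  rw [loadH, cost_seq]
  generalize initWords.run inp s = s₁ at e1 e2 ⊢
  rw [← e1, ← e2]
  exact Nat.add_le_add c1 (words_cost inp s₁ _ rfl rfl (by omega) (by omega) rfl)

theorem readout_cost (inp : Input) (s : St) (hN : 0 < s.v .N) (hR : 0 < s.v .R) :
    readout.cost inp s ≤ 100 + 400 * (s.v .R * s.v .N) := by
  have hf := frame inp (seq initWords (storeS .acc 0 (.const 0))) s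
  have c1 : (seq initWords (storeS .acc 0 (.const 0))).cost inp s ≤ 100 := cost_le inp rfl rfl s
  have e1 := hf.v .N rfl
  have e2 := hf.v .R rfl
  rw [readout, cost_seq, cost_seq, ← add_assoc, ← cost_seq]
  rw [← run_seq] at *
  generalize (seq initWords (storeS .acc 0 (.const 0))).run inp s = s₁ at e1 e2 ⊢
  rw [← e1, ← e2]
  exact Nat.add_le_add c1 (words_cost inp s₁ _ rfl rfl (by omega) (by omega) rfl)

theorem powers_cost (inp : Input) (s : St) : powers.cost inp s ≤ 30 + 12 * s.v .d := by
  have := cost_for_le (inp := inp) (x := .j) (e := rd - 1) (P := assign .R (rR * rN))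
    (s := (assign .R 1).run inp ((assign .N (2 * rm + 1)).run inp s)) (s.v .d - 1) (by simp) 7
    (fun _ _ _ _ => le_rfl)
  have e1 : (rd - 1 : IExp).cost = 4 := rfl
  rw [e1] at this
  rw [show powers.cost inp s = 8 + (3 + (for_ .j (rd - 1) (assign .R (rR * rN))).cost inp
    ((assign .R 1).run inp ((assign .N (2 * rm + 1)).run inp s))) from rfl]
  omega

theorem main_cost_zero (inp : Input) (s : St) (hd : s.v .d = 0) : main.cost inp s ≤ 50 := by
  rw [show main.cost inp s = 4 + if IExp.eval s 0 < rd.eval s then _ else _ from rfl,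
    if_neg (by simp [hd])]
  have : (storeS .acc 0 (input 0 0 0 * input 1 0 0)).cost inp s ≤ 40 := cost_le inp rfl rfl s
  omega

/-- There are c + 1 rounds, each with at most d 2^c letter steps of at most 600 E machine steps,
besides the preparation of the array `B`. The invariant of the main loop is needed because the cost
of a round depends on the current size of the tensor. -/
theorem main_cost {m t c d : ℕ} [NeZero m] (hd : 0 < d) {inp : Input} {h : List (Quad m) → ℂ}
    {ρ : Module.End ℂ (Wave m)} {D : Circuit m} (hD : Describes t c d inp h ρ D) {s : St}
    (hm : s.v .m = m) (ht : s.v .t = t) (hc : s.v .c = c) (hd' : s.v .d = d) :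
    main.cost inp s ≤ 2000 * ((c + 1) * (d * 2 ^ c + 1)) *
        (2 * m + 1) ^ (if c = 0 then d * 2 ^ (c + 1) + 1 else d * 2 ^ (c + 1))
      + 2000 * ((c + 1) * ((t + 1) * (2 * m + 1) ^ 4)) := by
  have hstart := startSt_regs inp s
  rw [hm, ht, hc, hd'] at hstart
  have c1 := powers_cost inp s
  obtain ⟨p1, p2⟩ := powers_run inp s
  rw [hm] at p1 p2
  rw [hd'] at p2 c1
  have c2 := loadH_cost inp (powers.run inp s) (by rw [p1]; positivity) (by rw [p2]; positivity)
  rw [p1, p2, ← pow_succ, Nat.sub_add_cancel hd] at c2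
  have hN : 0 < 2 * m + 1 := by positivity
  have hinv : ∀ b < c + 1, ∀ s', (for_ .b (rc + 1) block).Frame (startSt inp s) s' →
      (LoopRegs m t c d b s' ∧ (0 < b → LeadSupp m 0 (d * 2 ^ b) (s'.s .T))) →
      LoopRegs m t c d (b + 1) (block.run inp (s'.setV .b b)) ∧
        (0 < b + 1 → LeadSupp m 0 (d * 2 ^ (b + 1)) ((block.run inp (s'.setV .b b)).s .T)) := by
    rintro b hb s' - ⟨i1, i2⟩
    obtain ⟨k1, k2, -⟩ := loop_step hd hD (by omega) i1 i2
    exact ⟨k1, fun _ => k2⟩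
  have h0 : LoopRegs m t c d 0 (startSt inp s) ∧
      (0 < 0 → LeadSupp m 0 (d * 2 ^ 0) ((startSt inp s).s .T)) :=
    ⟨hstart, fun h => absurd h (lt_irrefl 0)⟩
  have hfin := (run_for (inp := inp) (x := .b) (e := rc + 1) (P := block) (s := startSt inp s)
    (fun b s' => LoopRegs m t c d b s' ∧ (0 < b → LeadSupp m 0 (d * 2 ^ b) (s'.s .T))) (c + 1)
    (by simp [hstart.hc]) h0 hinv).1
  set e := if c = 0 then d * 2 ^ (c + 1) + 1 else d * 2 ^ (c + 1) with he
  set E := (2 * m + 1) ^ e with hE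
  set F := (t + 1) * (2 * m + 1) ^ 4 with hF
  have c3 := cost_for_le_inv (inp := inp) (x := .b) (e := rc + 1) (P := block) (s := startSt inp s)
    (fun b s' => LoopRegs m t c d b s' ∧ (0 < b → LeadSupp m 0 (d * 2 ^ b) (s'.s .T))) (c + 1)
    (by simp [hstart.hc]) (2000 * F + d * 2 ^ c * (600 * E + 5) + 20) h0 (by
      intro b hb s' hf hi
      refine ⟨hinv b hb s' hf hi, ?_⟩
      obtain ⟨hr, -⟩ := hi
      have := block_cost inp (s'.setV .b b) (l := d * 2 ^ b) (N := 2 * m + 1) (E := E) hN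
        (by simpa using hr.hN) (by simpa using hr.hell) (by simpa using hr.hR) (by
          intro j hj
          have := letter_exponent (c := c) hN hd (by omega) hj
          simpa only [St.setV_v, reduceCtorEq, if_false, if_true, hr.hc] using this)
      simp only [St.setV_v, reduceCtorEq, if_false, hr.ht] at this
      refine this.trans ?_
      gcongr
      · exact one_le_two
      · omega)
  have c4 := readout_cost inp ((for_ .b (rc + 1) block).run inp (startSt inp s))
    (by rw [hfin.hN]; positivity) (by rw [hfin.hR]; positivity)
  have hexp : d * 2 ^ (c + 1) - 1 + 1 = d * 2 ^ (c + 1) :=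
    Nat.sub_add_cancel (Nat.succ_le_of_lt (by positivity))
  rw [hfin.hN, hfin.hR, ← pow_succ, hexp] at c4
  have cost_eq : main.cost inp s = 4 + (powers.cost inp s + (loadH.cost inp (powers.run inp s) +
      (4 + ((for_ .b (rc + 1) block).cost inp (startSt inp s) +
        readout.cost inp ((for_ .b (rc + 1) block).run inp (startSt inp s)))))) := by
    rw [show main.cost inp s = 4 + if IExp.eval s 0 < rd.eval s then _ else _ from rfl,
      if_pos (show IExp.eval s 0 < rd.eval s by simp [hd', hd])]
    rfl
  rw [cost_eq]
  have e1 : (rc + 1 : IExp).cost = 4 := rfl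
  rw [e1] at c3
  have hle : d * 2 ^ (c + 1) ≤ e := by rw [he]; split_ifs <;> omega
  have g1 : (2 * m + 1) ^ (d * 2 ^ (c + 1)) ≤ E := Nat.pow_le_pow_right hN hle
  have g2 : (2 * m + 1) ^ d ≤ E :=
    Nat.pow_le_pow_right hN ((Nat.le_mul_of_pos_right _ (by positivity)).trans hle)
  have g3 : 1 ≤ E := Nat.pow_pos hN
  have g4 : d ≤ d * 2 ^ c := Nat.le_mul_of_pos_right _ (by positivity)
  generalize d * 2 ^ c = x at *
  have g5 : (c + 1) * (2000 * F + x * (600 * E + 5) + 20 + 5)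
      = 2000 * ((c + 1) * F) + (600 * ((c + 1) * x * E) + (5 * ((c + 1) * x)) + 25 * (c + 1)) := by
    ring
  have g6 : (c + 1) * x ≤ (c + 1) * x * E := Nat.le_mul_of_pos_right _ g3
  have g7 : c + 1 ≤ (c + 1) * E := Nat.le_mul_of_pos_right _ g3
  have g8 : 2000 * ((c + 1) * (x + 1)) * E = 2000 * ((c + 1) * x * E) + 2000 * ((c + 1) * E) := by
    ring
  have g9 : x ≤ (c + 1) * x := Nat.le_mul_of_pos_left _ (Nat.succ_pos c)
  have g10 : E ≤ (c + 1) * E := Nat.le_mul_of_pos_left _ (Nat.succ_pos c)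
  omega

end Sim

/-- The algorithm: move `m`, `t`, `c`, `d` to the registers of the structured program and run it. -/
def simulator : Prog :=
  .seq (.iadd 4 1 5) <| .seq (.iadd 8 2 5) <| .seq (.iadd 12 3 5) <| .seq (.iconst 3 0) <|
    Sim.main.comp 0

/-- The initial state of the structured program. -/
def initSt (m t c d : ℕ) : St where
  v x := match x with
    | .m => m
    | .t => t
    | .c => c
    | .d => d
    | _ => 0
  n _ _ := 0
  s _ _ := 0

/-- Cell 5 is initially zero and serves to copy `t`, `c`, `d` to the addresses of their registers;
`m` is already in place. Cell 3 is entry 0 of the array `len` and must be cleared, while cells 1 and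
2 are scratch cells. The output cell 0 is entry 0 of `acc`. -/
theorem simulator_exec (inp : Input) (m t c d : ℕ) :
    ∃ σ, Exec inp simulator (initMem m t c d) (4 + Sim.main.cost inp (initSt m t c d)) σ ∧
      σ.S 0 = (Sim.main.run inp (initSt m t c d)).s .acc 0 := by
  have hrel : Rel (((((initMem m t c d).setN 4 t).setN 8 c).setN 12 d).setN 3 0)
      (initSt m t c d) := by
    refine ⟨fun x => ?_, fun a i => ?_, fun a i => rfl⟩
    · cases x <;> simp [Mem.setN, initMem, initSt, adV, Reg.num]
    · have h := a.num_lt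
      have h1 : adA a i ≠ 0 := by unfold adA; omega
      have h2 : adA a i ≠ 1 := by unfold adA; omega
      have h3 : adA a i ≠ 2 := by unfold adA; omega
      have h4 : adA a i ≠ 4 := by unfold adA; omega
      have h5 : adA a i ≠ 8 := by unfold adA; omega
      have h6 : adA a i ≠ 12 := by unfold adA; omega
      by_cases h7 : adA a i = 3
      · simp [Mem.setN, initSt, h7]
      · simp [Mem.setN, initSt, initMem, h1, h2, h3, h4, h5, h6, h7]
  obtain ⟨σ', hx, hr, -⟩ := Stmt.exec inp Sim.main 0 hrel
  refine ⟨σ', ?_, hr.s .acc 0⟩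
  refine (Exec.iadd 4 1 5 _).then ((Exec.iadd 8 2 5 _).then ((Exec.iadd 12 3 5 _).then
    ((Exec.iconst 3 0 _).then (l := Sim.main.cost inp (initSt m t c d)) ?_ rfl) rfl) rfl)
    (by omega)
  convert hx using 1
  simp [Mem.setN, initMem]

theorem simulator_simulatesWithin {c d m t T : ℕ} [NeZero m]
    (h0 : d = 0 → 54 ≤ T)
    (h1 : 0 < d → 4 + (2000 * ((c + 1) * (d * 2 ^ c + 1)) *
        (2 * m + 1) ^ (if c = 0 then d * 2 ^ (c + 1) + 1 else d * 2 ^ (c + 1))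
      + 2000 * ((c + 1) * ((t + 1) * (2 * m + 1) ^ 4))) ≤ T) :
    simulator.SimulatesWithin c d m t T := by
  intro D ρ h inp _ hD
  obtain ⟨σ, hx, hv⟩ := simulator_exec inp m t c d
  refine ⟨_, ⟨_, σ, hx, ?_, hv⟩, Sim.main_correct hD rfl rfl rfl rfl⟩
  rcases Nat.eq_zero_or_pos d with rfl | hd
  · have := Sim.main_cost_zero inp (initSt m t c 0) rfl
    have := h0 rfl
    omega
  · have := Sim.main_cost hd hD (s := initSt m t c d) rfl rfl rfl rfl
    have := h1 hd
    omega

theorem two_mul_add_one_pow_le {m : ℕ} (hm : 0 < m) (k : ℕ) : (2 * m + 1) ^ k ≤ 3 ^ k * m ^ k := by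
  rw [← mul_pow]
  exact Nat.pow_le_pow_left (by omega) k

end CVSim

end

theorem theorem2 :
    ∃ P : CVSim.Prog,
      (∀ c d : ℕ, 1 ≤ c → ∃ C : ℕ, ∀ (m t : ℕ) [NeZero m],
        P.SimulatesWithin c d m t (C * (m ^ (d * 2 ^ (c + 1)) + (c + 1) * t ^ 2 * m ^ 7))) ∧
      (∀ c d K : ℕ, ∃ L : ℕ, ∀ (m t : ℕ) [NeZero m], t ≤ K * m ^ K →
        P.SimulatesWithin c d m t (L * m ^ L)) := by
  refine ⟨CVSim.simulator, fun c d hc => ?_, fun c d K => ?_⟩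
  -- The powers of 3 come from 2m + 1 ≤ 3m, with 162000 = 2000 · 3⁴; 54 covers the case d = 0, which
  -- takes at most 50 steps after the 4 steps of initialization.
  · refine ⟨54 + 2000 * ((c + 1) * (d * 2 ^ c + 1)) * 3 ^ (d * 2 ^ (c + 1)) + 162000 * (c + 1),
      fun m t _ => ?_⟩
    have hm : 0 < m := Nat.pos_of_ne_zero (NeZero.ne m)
    refine CVSim.simulator_simulatesWithin (fun hd => ?_) fun hd => ?_
    · subst hd
      have : 1 ≤ m ^ (0 * 2 ^ (c + 1)) + (c + 1) * t ^ 2 * m ^ 7 := by simp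
      calc 54 = 54 * 1 := rfl
        _ ≤ _ := Nat.mul_le_mul (by omega) this
    · rw [if_neg (by omega)]
      -- Here c ≥ 1 is used: m⁴ is absorbed by m^(d 2^(c+1)), and t m⁴ by t² m⁷, so the preparation
      -- cost (t + 1) m⁴ fits into the bound also for t = 0.
      have h4 : 4 ≤ d * 2 ^ (c + 1) := by
        calc 4 = 1 * 2 ^ (1 + 1) := rfl
          _ ≤ _ := Nat.mul_le_mul hd (Nat.pow_le_pow_right two_pos (by omega))
      generalize d * 2 ^ (c + 1) = e at *
      generalize (c + 1) * (d * 2 ^ c + 1) = x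
      have g1 := CVSim.two_mul_add_one_pow_le hm e
      have g2 : (2 * m + 1) ^ 4 ≤ 81 * m ^ 4 := CVSim.two_mul_add_one_pow_le hm 4
      have g3 : (t + 1) * m ^ 4 ≤ t ^ 2 * m ^ 7 + m ^ e := by
        rw [add_one_mul]
        gcongr
        · exact Nat.le_self_pow two_ne_zero t
        · norm_num
      have g4 : 1 ≤ m ^ e := Nat.pow_pos hm
      calc 4 + (2000 * x * (2 * m + 1) ^ e + 2000 * ((c + 1) * ((t + 1) * (2 * m + 1) ^ 4)))
          ≤ 4 * m ^ e + (2000 * x * (3 ^ e * m ^ e)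
            + 2000 * ((c + 1) * ((t + 1) * (81 * m ^ 4)))) := by gcongr; omega
        _ = 4 * m ^ e + (2000 * x * (3 ^ e * m ^ e)
            + 162000 * ((c + 1) * ((t + 1) * m ^ 4))) := by ring
        _ ≤ 4 * m ^ e + (2000 * x * (3 ^ e * m ^ e)
            + 162000 * ((c + 1) * (t ^ 2 * m ^ 7 + m ^ e))) := by gcongr
        _ = (4 + 2000 * x * 3 ^ e + 162000 * (c + 1)) * m ^ e
            + 162000 * ((c + 1) * t ^ 2 * m ^ 7) := by ring
        _ ≤ (54 + 2000 * x * 3 ^ e + 162000 * (c + 1)) * m ^ e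
            + (54 + 2000 * x * 3 ^ e + 162000 * (c + 1)) * ((c + 1) * t ^ 2 * m ^ 7) := by
          gcongr
          · norm_num
          · nlinarith [Nat.zero_le (2000 * x * 3 ^ e)]
        _ = _ := by ring
  · obtain ⟨e, he⟩ : ∃ e, e = if c = 0 then d * 2 ^ (c + 1) + 1 else d * 2 ^ (c + 1) := ⟨_, rfl⟩
    obtain ⟨x, hx⟩ : ∃ x, x = (c + 1) * (d * 2 ^ c + 1) := ⟨_, rfl⟩
    -- The same number serves as factor and as exponent, so it has to dominate the sum of all
    -- coefficients and both exponents e and K + 4.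
    obtain ⟨L, hL⟩ : ∃ L, L = 54 + 2000 * x * 3 ^ e + 162000 * (c + 1) * (K + 1) + e + K + 4 :=
      ⟨_, rfl⟩
    refine ⟨L, fun m t _ ht => ?_⟩
    have hm : 0 < m := Nat.pos_of_ne_zero (NeZero.ne m)
    have hpow : ∀ k ≤ L, m ^ k ≤ m ^ L := fun k hk => Nat.pow_le_pow_right hm hk
    have h1 : 1 ≤ m ^ L := Nat.pow_pos hm
    refine CVSim.simulator_simulatesWithin (fun hd => ?_) fun hd => ?_
    · calc 54 = 54 * 1 := rfl
        _ ≤ _ := Nat.mul_le_mul (by omega) h1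
    · rw [← he, ← hx]
      have g1 := CVSim.two_mul_add_one_pow_le hm e
      have g2 : (2 * m + 1) ^ 4 ≤ 81 * m ^ 4 := CVSim.two_mul_add_one_pow_le hm 4
      have g3 : t + 1 ≤ (K + 1) * m ^ K := by
        rw [add_one_mul]
        exact Nat.add_le_add ht (Nat.pow_pos hm)
      calc 4 + (2000 * x * (2 * m + 1) ^ e + 2000 * ((c + 1) * ((t + 1) * (2 * m + 1) ^ 4)))
          ≤ 4 * m ^ L + (2000 * x * (3 ^ e * m ^ e)
            + 2000 * ((c + 1) * (((K + 1) * m ^ K) * (81 * m ^ 4)))) := by gcongr; omega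
        _ = 4 * m ^ L + (2000 * x * 3 ^ e * m ^ e
            + 162000 * (c + 1) * (K + 1) * m ^ (K + 4)) := by ring
        _ ≤ 4 * m ^ L + (2000 * x * 3 ^ e * m ^ L
            + 162000 * (c + 1) * (K + 1) * m ^ L) := by
          gcongr <;> omega
        _ = (4 + 2000 * x * 3 ^ e + 162000 * (c + 1) * (K + 1)) * m ^ L := by ring
        _ ≤ L * m ^ L := by
          gcongr
          omega
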